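/- Let $K$ be a commutative ring and let $Q$, $Q'$ be finite quivers with the same vertex set $Q_0$. Paths are composed from left to right, $e_i$ (resp. $e_i'$) denotes the trivial path at $i$, and for an arrow $\alpha\colon i\to j$ we put $s(\alpha)=i$, $t(\alpha)=j$, so $\alpha=e_i\alpha e_j$. Let $A=\widehat{KQ}$ be the completed path algebra, whose elements are the infinite $K$-linear combinations of paths, with the topology given by path length. A hyperpotential on $Q$ is a family $(\rho_\alpha)_{\alpha\in Q_1}$ of elements of $A$ with $\rho_\alpha\in e_{t(\alpha)}Ae_{s(\alpha)}$ for all $\alpha$ and $\sum_{\alpha}[\alpha,\rho_\alpha]=0$. It is identified with the class of the cycle $\sum_\alpha \rho_\alpha\otimes\alpha$ in the first continuous Hochschild homology $HH_1(A)$, computed by the complex $A\hat\otimes A\hat\otimes A\xrightarrow{d_2}A\hat\otimes A\xrightarrow{d_1}A$ with $d_2(a\otimes b\otimes c)=ab\otimes c-a\otimes bc+ca\otimes b$ and $d_1(a\otimes b)=ab-ba$. A continuous algebra homomorphism $\varphi\colon A\to A'=\widehat{KQ'}$ induces $\varphi_*\colon HH_1(A)\to HH_1(A')$. Hyperpotentials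 $(Q,(\rho_\alpha))$ and $(Q',(\rho'_\beta))$ are right equivalent if there is a continuous isomorphism of $K$-algebras $\varphi\colon A\to A'$ with $\varphi(e_i)=e_i'$ for all $i\in Q_0$ and $\varphi_*((\rho_\alpha))=(\rho'_\beta)$. They are weakly right equivalent if for some $c\in K^\times$ the hyperpotentials $(Q,(c\rho_\alpha))$ and $(Q',(\rho'_\beta))$ are right equivalent. The Ginzburg dg-algebra $\Gamma=\Gamma(Q,(\rho_\alpha))$ is the following. Let $\widetilde Q$ be the graded quiver with vertex set $Q_0$ whose arrows are those of $Q$ in degree $0$, an arrow $\alpha^*\colon j\to i$ of degree $-1$ for each arrow $\alpha\colon i\to j$ of $Q$, and a loop $t_i$ of degree $-2$ at each vertex $i$. As a graded algebra, $\Gamma$ is the completion of the graded path algebra $K\widetilde Q$ with respect to path length, so each graded piece consists of the infinite linear combinations of paths of a given degree. Its differential is the continuous linear map of degree $1$ satisfying the Leibniz rule $d(xy)=d(x)y+(-1)^{|x|}x\,d(y)$ for homogeneous $x$ and $$d(\alpha)=0,\qquad d(\alpha^*)=\rho_\alpha,\qquad d(t_i)=e_i\Bigl(\sum_{\beta\in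 Q_1}[\beta,\beta^*]\Bigr)e_i .$$ Let $(Q,(\rho_\alpha))$ and $(Q',(\rho'_\beta))$ be hyperpotentials and let $\Gamma$, $\Gamma'$ be the corresponding Ginzburg dg-algebras, with loops $t_i$ and $t_i'$. Then: (a) $(Q,(\rho_\alpha))$ and $(Q',(\rho'_\beta))$ are right equivalent if and only if there exists a continuous isomorphism of dg-algebras $\Phi\colon\Gamma\to\Gamma'$ such that $\Phi(e_i)=e_i'$ and $\Phi(t_i)=t_i'$ for all $i\in Q_0$. (b) $(Q,(\rho_\alpha))$ and $(Q',(\rho'_\beta))$ are weakly right equivalent if and only if there exist a continuous isomorphism of dg-algebras $\Phi\colon\Gamma\to\Gamma'$ and an element $c\in K^\times$ such that $\Phi(e_i)=e_i'$ and $\Phi(t_i)=c\,t_i'$ for all $i\in Q_0$. -/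

import Mathlib

namespace Hyperpot

universe u v v' w

/-- A quiver with vertex set `V`: a set of arrows with source and target maps. -/
structure QuiverOn (V : Type u) where
  Arrow : Type v
  src : Arrow → V
  tgt : Arrow → V

namespace QuiverOn

variable {V : Type u} (Q : QuiverOn.{u, v} V)

/-- `Q.IsPath i w`: the arrows of the word `w`, read from left to right, form a path that
starts at the vertex `i`. -/
def IsPath : V → List Q.Arrow → Prop
  | _, [] => True
  | i, a :: w => Q.src a = i ∧ IsPath (Q.tgt a) w

/-- The vertex at which the path `w` starting at `i` ends. -/
def endOf : V → List Q.Arrow → V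
  | i, [] => i
  | _, a :: w => endOf (Q.tgt a) w

theorem isPath_append (i : V) (x y : List Q.Arrow) :
    Q.IsPath i (x ++ y) ↔ Q.IsPath i x ∧ Q.IsPath (Q.endOf i x) y := by
  induction x generalizing i with
  | nil => simp [IsPath, endOf]
  | cons a x ih => simp [IsPath, endOf, ih, and_assoc]

theorem endOf_append (i : V) (x y : List Q.Arrow) :
    Q.endOf i (x ++ y) = Q.endOf (Q.endOf i x) y := by
  induction x generalizing i with
  | nil => simp [endOf]
  | cons a x ih => simp [endOf, ih]

end QuiverOn

open QuiverOn

/-- Paths in `Q`. A path of length zero is determined by its starting vertex. -/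
@[ext]
structure Path {V : Type u} (Q : QuiverOn.{u, v} V) where
  start : V
  word : List Q.Arrow
  isPath : Q.IsPath start word

section PathAlgebra

variable {V : Type u} {Q : QuiverOn.{u, v} V}

/-- The trivial path at `i`. -/
def Path.nil (Q : QuiverOn.{u, v} V) (i : V) : Path Q := ⟨i, [], trivial⟩

/-- An arrow as a path of length one. -/
def Path.single (Q : QuiverOn.{u, v} V) (a : Q.Arrow) : Path Q :=
  ⟨Q.src a, [a], rfl, trivial⟩

/-- The initial subpath of length `k` (the whole path, if `k` exceeds its length). -/
def Path.take (p : Path Q) (k : ℕ) : Path Q :=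
  ⟨p.start, p.word.take k, by
    have h := p.isPath
    rw [← List.take_append_drop k p.word, isPath_append] at h
    exact h.1⟩

/-- The path that remains after removing the initial subpath of length `k`. -/
def Path.drop (p : Path Q) (k : ℕ) : Path Q :=
  ⟨Q.endOf p.start (p.word.take k), p.word.drop k, by
    have h := p.isPath
    rw [← List.take_append_drop k p.word, isPath_append] at h
    exact h.2⟩

/-- The length of a path. -/
def Path.length (p : Path Q) : ℕ := p.word.length

/-- The completed path algebra: families of coefficients indexed by the paths, that is,
infinite `K`-linear combinations of paths. -/
structure CPA (Q : QuiverOn.{u, v} V) (K : Type w) : Type (max u v w) where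
  toFun : Path Q → K

instance {K : Type w} : FunLike (CPA Q K) (Path Q) K :=
  ⟨CPA.toFun, fun f g h => by cases f; cases g; congr⟩

@[ext]
theorem CPA.ext {K : Type w} {f g : CPA Q K} (h : ∀ p : Path Q, f p = g p) : f = g :=
  DFunLike.ext f g h

/-- Elements of the completed path algebra as functions on paths. -/
def CPA.equivFun (Q : QuiverOn.{u, v} V) (K : Type w) : CPA Q K ≃ (Path Q → K) :=
  ⟨CPA.toFun, CPA.mk, fun _ => rfl, fun _ => rfl⟩

variable {K : Type w} [CommRing K]

/-- Addition is coefficientwise. -/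
instance : AddCommGroup (CPA Q K) := (CPA.equivFun Q K).addCommGroup

/-- Scalar multiplication is coefficientwise. -/
instance : Module K (CPA Q K) := (CPA.equivFun Q K).module K

/-- The topology of coefficientwise convergence, `K` being discrete. For a finite quiver the
sets of all elements with vanishing coefficients at the paths of length `< n` are a
neighbourhood basis of `0`, so that this is the topology given by path length. -/
instance : TopologicalSpace (CPA Q K) :=
  TopologicalSpace.induced (CPA.equivFun Q K)
    (@Pi.topologicalSpace (Path Q) (fun _ => K) (fun _ => ⊥))

theorem CPA.add_apply (f g : CPA Q K) (p : Path Q) : (f + g) p = f p + g p := rfl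

theorem CPA.zero_apply (p : Path Q) : (0 : CPA Q K) p = 0 := rfl

theorem CPA.smul_apply (c : K) (f : CPA Q K) (p : Path Q) : (c • f) p = c * f p := rfl

open Classical in
/-- A path, as an element of the completed path algebra. -/
noncomputable def CPA.ofPath (K : Type w) [CommRing K] (p : Path Q) : CPA Q K :=
  ⟨fun q => if q = p then 1 else 0⟩

open Classical in
theorem CPA.ofPath_apply (p q : Path Q) :
    CPA.ofPath K p q = if q = p then 1 else 0 := rfl

/-- The unit is the sum of the trivial paths. -/
instance : One (CPA Q K) := ⟨⟨fun p => if p.length = 0 then 1 else 0⟩⟩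

/-- The product extends the concatenation of paths: the coefficient of `f * g` at `p` is the
sum of `f q * g r` over all factorizations of `p` into a path `q` followed by a path `r`. -/
instance : Mul (CPA Q K) :=
  ⟨fun f g => ⟨fun p => ∑ k ∈ Finset.range (p.length + 1), f (p.take k) * g (p.drop k)⟩⟩

theorem CPA.one_apply (p : Path Q) :
    (1 : CPA Q K) p = if p.length = 0 then 1 else 0 := rfl

theorem CPA.mul_apply (f g : CPA Q K) (p : Path Q) :
    (f * g) p = ∑ k ∈ Finset.range (p.length + 1), f (p.take k) * g (p.drop k) := rfl

theorem Path.length_take (p : Path Q) (k : ℕ) : (Path.take p k).length = min k p.length := by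
  simp [Path.take, Path.length]

theorem Path.length_drop (p : Path Q) (k : ℕ) : (Path.drop p k).length = p.length - k := by
  simp [Path.drop, Path.length]

theorem Path.take_length (p : Path Q) : Path.take p p.length = p := by
  ext1 <;> simp [Path.take, Path.length]

theorem Path.drop_zero (p : Path Q) : Path.drop p 0 = p := by
  ext1 <;> simp [Path.drop, endOf]

theorem Path.take_take (p : Path Q) {l k : ℕ} (h : l ≤ k) :
    Path.take (Path.take p k) l = Path.take p l := by
  ext1 <;> simp [Path.take, List.take_take, h]

theorem Path.drop_drop (p : Path Q) (l m : ℕ) :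
    Path.drop (Path.drop p l) m = Path.drop p (l + m) := by
  ext1
  · simp [Path.drop, ← endOf_append, List.take_add]
  · simp [Path.drop]

theorem Path.take_drop (p : Path Q) (l m : ℕ) :
    Path.take (Path.drop p l) m = Path.drop (Path.take p (l + m)) l := by
  ext1
  · simp [Path.drop, Path.take, List.take_take]
  · simp [Path.drop, Path.take, List.drop_take]

theorem CPA.mul_assoc' (f g h : CPA Q K) : f * g * h = f * (g * h) := by
  ext p
  simp only [CPA.mul_apply, Finset.sum_mul, Finset.mul_sum, Path.length_take,
    Path.length_drop]
  rw [Finset.sum_sigma', Finset.sum_sigma']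
  refine Finset.sum_bij' (fun x _ => ⟨x.2, x.1 - x.2⟩) (fun x _ => ⟨x.1 + x.2, x.1⟩)
    ?_ ?_ ?_ ?_ ?_
  · rintro ⟨k, l⟩ hx
    simp only [Finset.mem_sigma, Finset.mem_range] at hx ⊢
    omega
  · rintro ⟨k, l⟩ hx
    simp only [Finset.mem_sigma, Finset.mem_range] at hx ⊢
    omega
  · rintro ⟨k, l⟩ hx
    simp only [Finset.mem_sigma, Finset.mem_range] at hx
    have : l + (k - l) = k := by omega
    simp [this]
  · rintro ⟨k, l⟩ hx
    simp
  · rintro ⟨k, l⟩ hx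
    simp only [Finset.mem_sigma, Finset.mem_range] at hx
    have h1 : l ≤ k := by omega
    have h2 : l + (k - l) = k := by omega
    simp only [Path.take_take p h1, Path.take_drop, Path.drop_drop, h2, mul_assoc]

theorem CPA.one_mul' (f : CPA Q K) : 1 * f = f := by
  ext p
  rw [CPA.mul_apply, Finset.sum_eq_single 0]
  · simp [CPA.one_apply, Path.length_take, Path.drop_zero]
  · intro k hk hk0
    simp only [Finset.mem_range] at hk
    have : ¬ (k = 0 ∨ p.length = 0) := by omega
    simp [CPA.one_apply, Path.length_take, this]
  · simp

theorem CPA.mul_one' (f : CPA Q K) : f * 1 = f := by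
  ext p
  rw [CPA.mul_apply, Finset.sum_eq_single p.length]
  · simp [CPA.one_apply, Path.length_drop, Path.take_length]
  · intro k hk hk0
    simp only [Finset.mem_range] at hk
    have : ¬ (p.length - k = 0) := by omega
    simp [CPA.one_apply, Path.length_drop, this]
  · simp

noncomputable instance : Ring (CPA Q K) :=
  { (inferInstance : AddCommGroup (CPA Q K)), (inferInstance : One (CPA Q K)),
    (inferInstance : Mul (CPA Q K)) with
    left_distrib := fun f g h => by
      ext p
      simp [CPA.mul_apply, CPA.add_apply, mul_add, Finset.sum_add_distrib]
    right_distrib := fun f g h => by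
      ext p
      simp [CPA.mul_apply, CPA.add_apply, add_mul, Finset.sum_add_distrib]
    zero_mul := fun f => by
      ext p
      simp [CPA.mul_apply, CPA.zero_apply]
    mul_zero := fun f => by
      ext p
      simp [CPA.mul_apply, CPA.zero_apply]
    mul_assoc := CPA.mul_assoc'
    one_mul := CPA.one_mul'
    mul_one := CPA.mul_one' }

noncomputable instance : Algebra K (CPA Q K) :=
  Algebra.ofModule
    (fun c f g => by
      ext p
      simp [CPA.mul_apply, CPA.smul_apply, Finset.mul_sum, mul_assoc])
    (fun c f g => by
      ext p
      simp [CPA.mul_apply, CPA.smul_apply, Finset.mul_sum, mul_left_comm])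

/-- The idempotent at the vertex `i`. -/
noncomputable def CPA.e (Q : QuiverOn.{u, v} V) (K : Type w) [CommRing K] (i : V) : CPA Q K :=
  CPA.ofPath K (Path.nil Q i)

/-- An arrow, as an element of the completed path algebra. -/
noncomputable def CPA.arrow (K : Type w) [CommRing K] (a : Q.Arrow) : CPA Q K :=
  CPA.ofPath K (Path.single Q a)

open Classical in
/-- The coefficient of `f` at a word of arrows starting at `i`; it is zero if the word is not
a path. -/
noncomputable def CPA.coeff (f : CPA Q K) (i : V) (x : List Q.Arrow) : K :=
  if h : Q.IsPath i x then f ⟨i, x, h⟩ else 0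

theorem CPA.coeff_add (f g : CPA Q K) (i : V)
    (x : List Q.Arrow) : (f + g).coeff i x = f.coeff i x + g.coeff i x := by
  unfold CPA.coeff
  split_ifs
  · rfl
  · simp

theorem CPA.coeff_smul (c : K) (f : CPA Q K) (i : V)
    (x : List Q.Arrow) : (c • f).coeff i x = c * f.coeff i x := by
  unfold CPA.coeff
  split_ifs
  · rfl
  · simp

open Classical in
theorem CPA.e_mul (i : V) (f : CPA Q K) (p : Path Q) :
    (CPA.e Q K i * f) p = if p.start = i then f p else 0 := by
  rw [CPA.mul_apply, Finset.sum_eq_single 0]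
  · rw [Path.drop_zero]
    have : Path.take p 0 = Path.nil Q i ↔ p.start = i := by
      constructor
      · intro h; exact congrArg Path.start h
      · intro h; ext1 <;> simp [Path.take, Path.nil, h]
    simp [CPA.e, CPA.ofPath_apply, this]
  · intro k hk hk0
    have : Path.take p k ≠ Path.nil Q i := by
      intro h
      have h2 := congrArg Path.length h
      rw [Path.length_take] at h2
      simp only [Finset.mem_range] at hk
      simp only [Path.length, Path.nil, List.length_nil] at h2 hk
      omega
    simp [CPA.e, CPA.ofPath_apply, this]
  · simp

open Classical in
theorem CPA.mul_e (i : V) (f : CPA Q K) (p : Path Q) :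
    (f * CPA.e Q K i) p = if Q.endOf p.start p.word = i then f p else 0 := by
  rw [CPA.mul_apply, Finset.sum_eq_single p.length]
  · rw [Path.take_length]
    have : Path.drop p p.length = Path.nil Q i ↔ Q.endOf p.start p.word = i := by
      constructor
      · intro h; simpa [Path.drop, Path.length, Path.nil] using congrArg Path.start h
      · intro h; ext1 <;> simp [Path.drop, Path.nil, h, Path.length]
    simp [CPA.e, CPA.ofPath_apply, this]
  · intro k hk hk0
    have : Path.drop p k ≠ Path.nil Q i := by
      intro h
      have h2 := congrArg Path.length h
      rw [Path.length_drop] at h2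
      simp only [Finset.mem_range] at hk
      simp only [Path.length, Path.nil, List.length_nil] at h2 hk hk0
      omega
    simp [CPA.e, CPA.ofPath_apply, this]
  · simp

theorem CPA.coeff_mul (f g : CPA Q K) (i : V) (x : List Q.Arrow) :
    (f * g).coeff i x = ∑ k ∈ Finset.range (x.length + 1),
      f.coeff i (x.take k) * g.coeff (Q.endOf i (x.take k)) (x.drop k) := by
  by_cases h : Q.IsPath i x
  · unfold CPA.coeff
    rw [dif_pos h, CPA.mul_apply]
    refine Finset.sum_congr rfl fun k _ => ?_
    have h' := h
    rw [← List.take_append_drop k x, isPath_append] at h'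
    rw [dif_pos h'.1, dif_pos h'.2]
    rfl
  · rw [CPA.coeff, dif_neg h]
    symm
    apply Finset.sum_eq_zero
    intro k _
    by_cases h1 : Q.IsPath i (x.take k)
    · by_cases h2 : Q.IsPath (Q.endOf i (x.take k)) (x.drop k)
      · exact absurd (by rw [← List.take_append_drop k x, isPath_append]; exact ⟨h1, h2⟩) h
      · rw [CPA.coeff, CPA.coeff, dif_neg h2, mul_zero]
    · rw [CPA.coeff, dif_neg h1, zero_mul]

theorem CPA.coeff_mul_append (f g : CPA Q K) (i : V)
    (x y : List Q.Arrow) (a : Q.Arrow) :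
    (f * g).coeff i (x ++ a :: y) = (∑ k ∈ Finset.range (x.length + 1),
      f.coeff i (x.take k) * g.coeff (Q.endOf i (x.take k)) (x.drop k ++ a :: y)) +
     ∑ j ∈ Finset.range (y.length + 1),
      f.coeff i (x ++ a :: y.take j) * g.coeff (Q.endOf (Q.tgt a) (y.take j)) (y.drop j) := by
  rw [CPA.coeff_mul]
  have : (x ++ a :: y).length + 1 = (x.length + 1) + (y.length + 1) := by simp; omega
  rw [this, Finset.sum_range_add]
  congr 1
  · refine Finset.sum_congr rfl fun k hk => ?_
    have hk : k ≤ x.length := by simp at hk; omega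
    rw [List.take_append_of_le_length hk, List.drop_append_of_le_length hk]
  · refine Finset.sum_congr rfl fun k hk => ?_
    have e : x.length + 1 + k = x.length + (k+1) := by omega
    rw [e, List.take_length_add_append, List.drop_length_add_append, List.take_succ_cons, List.drop_succ_cons,
      endOf_append, QuiverOn.endOf]

end PathAlgebra

section Hyperpotentials

variable {V : Type u}

/-- Hyperpotentials: `ρ α ∈ e_j A e_i` for every arrow `α : i → j`, and
`∑ α, [α, ρ α] = 0`. -/
structure Hyperpotential (Q : QuiverOn.{u, v} V) [Fintype Q.Arrow] (K : Type w)
    [CommRing K] where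
  ρ : Q.Arrow → CPA Q K
  mem : ∀ a, CPA.e Q K (Q.tgt a) * ρ a * CPA.e Q K (Q.src a) = ρ a
  comm : ∑ a, (CPA.arrow K a * ρ a - ρ a * CPA.arrow K a) = 0

variable {Q : QuiverOn.{u, v} V} [Fintype Q.Arrow] {K : Type w} [CommRing K]

/-- The hyperpotential `(c ρ_α)`. -/
noncomputable def Hyperpotential.smul (c : K) (h : Hyperpotential Q K) : Hyperpotential Q K where
  ρ := fun a => c • h.ρ a
  mem := fun a => by rw [mul_smul_comm, smul_mul_assoc, h.mem]
  comm := by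
    have := congrArg (fun x => c • x) h.comm
    simpa [Finset.smul_sum, smul_sub] using this

theorem Hyperpotential.parallel (h : Hyperpotential Q K) (a : Q.Arrow) (p : Path Q)
    (hp : h.ρ a p ≠ 0) : p.start = Q.tgt a ∧ Q.endOf p.start p.word = Q.src a := by
  rw [← h.mem a, CPA.mul_e] at hp
  split_ifs at hp with h1
  · rw [CPA.e_mul] at hp
    split_ifs at hp with h2
    · exact ⟨h2, h1⟩
    · exact absurd rfl hp
  · exact absurd rfl hp

end Hyperpotentials

section Hochschild

variable {V : Type u} (Q : QuiverOn.{u, v} V) (K : Type w) [CommRing K]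

/-- The Hochschild differential `A ⊗ A ⊗ A → A ⊗ A` (completed tensor products), which is the
continuous linear map with `a ⊗ b ⊗ c ↦ ab ⊗ c - a ⊗ bc + ca ⊗ b`. Elements of the completed
tensor powers of `A` are infinite linear combinations of pairs or triples of paths. -/
def hochschildD : (Path Q × Path Q × Path Q → K) →ₗ[K] (Path Q × Path Q → K) where
  toFun F := fun x =>
    ∑ k ∈ Finset.range (x.1.length + 1), F (x.1.take k, x.1.drop k, x.2)
      - ∑ k ∈ Finset.range (x.2.length + 1), F (x.1, x.2.take k, x.2.drop k)
      + ∑ k ∈ Finset.range (x.1.length + 1), F (x.1.drop k, x.2, x.1.take k)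
  map_add' F G := by
    funext x
    simp only [Pi.add_apply, Finset.sum_add_distrib]
    ring
  map_smul' c F := by
    funext x
    simp only [Pi.smul_apply, smul_eq_mul, Finset.mul_sum, RingHom.id_apply, mul_add, mul_sub]

variable {Q K}

/-- The element `f ⊗ g` of the completed tensor product `A ⊗ A`. -/
def tmul (f g : CPA Q K) : Path Q × Path Q → K := fun x => f x.1 * g x.2

variable {Q' : QuiverOn.{u, v'} V} [Fintype Q.Arrow] [Fintype Q'.Arrow]

/-- `φ_* ρ = ρ'` for the map `φ_*` induced by `φ` on first (continuous) Hochschild homology,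
where a hyperpotential `(ρ_α)` is the homology class of the cycle `∑ α, ρ_α ⊗ α`. That is,
`∑ α, φ ρ_α ⊗ φ α` and `∑ β, ρ'_β ⊗ β` differ by a boundary. -/
def MapsHyperpotential (φ : CPA Q K →ₐ[K] CPA Q' K) (h : Hyperpotential Q K)
    (h' : Hyperpotential Q' K) : Prop :=
  ∑ a, tmul (φ (h.ρ a)) (φ (CPA.arrow K a)) - ∑ b, tmul (h'.ρ b) (CPA.arrow K b)
    ∈ LinearMap.range (hochschildD Q' K)

/-- Right equivalence of hyperpotentials. -/
def RightEquivalent (h : Hyperpotential Q K) (h' : Hyperpotential Q' K) : Prop :=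
  ∃ φ : CPA Q K ≃ₐ[K] CPA Q' K, Continuous φ ∧ (∀ i, φ (CPA.e Q K i) = CPA.e Q' K i) ∧
    MapsHyperpotential (φ : CPA Q K →ₐ[K] CPA Q' K) h h'

/-- Weak right equivalence of hyperpotentials. -/
def WeaklyRightEquivalent (h : Hyperpotential Q K) (h' : Hyperpotential Q' K) : Prop :=
  ∃ c : Kˣ, RightEquivalent (h.smul (c : K)) h'

end Hochschild

section Ginzburg

variable {V : Type u}

/-- The arrows of the graded quiver of the Ginzburg algebra: the arrows `α` of `Q`, a reversed
arrow `α*` for each of them, and a loop `t_i` at each vertex. -/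
inductive GArrow (Q : QuiverOn.{u, v} V) : Type (max u v)
  | orig (a : Q.Arrow)
  | star (a : Q.Arrow)
  | loop (i : V)

/-- The graded quiver of the Ginzburg algebra. -/
abbrev ginzburgQuiver (Q : QuiverOn.{u, v} V) : QuiverOn.{u, max u v} V where
  Arrow := GArrow Q
  src
    | .orig a => Q.src a
    | .star a => Q.tgt a
    | .loop i => i
  tgt
    | .orig a => Q.tgt a
    | .star a => Q.src a
    | .loop i => i

/-- The degree of an arrow of the Ginzburg quiver. -/
def arrowDegree {Q : QuiverOn.{u, v} V} : (ginzburgQuiver Q).Arrow → ℤ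
  | .orig _ => 0
  | .star _ => -1
  | .loop _ => -2

/-- The degree of a path of the Ginzburg quiver. -/
def degree {Q : QuiverOn.{u, v} V} (p : Path (ginzburgQuiver Q)) : ℤ :=
  (p.word.map arrowDegree).sum

variable {Q : QuiverOn.{u, v} V} {K : Type w} [CommRing K]

theorem degree_take_add_drop (p : Path (ginzburgQuiver Q)) (k : ℕ) :
    degree (p.take k) + degree (p.drop k) = degree p := by
  simp only [degree, Path.take, Path.drop]
  rw [← List.sum_append, ← List.map_append, List.take_append_drop]

variable (Q K) in
/-- The graded algebra underlying the Ginzburg dg-algebra: the direct sum of its graded pieces,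
that is, the infinite linear combinations of paths in the Ginzburg quiver that involve only
finitely many degrees. -/
def ginzburgAlgebra : Subalgebra K (CPA (ginzburgQuiver Q) K) where
  carrier := {f | (degree '' {p | f p ≠ 0}).Finite}
  mul_mem' {f g} hf hg := by
    refine (Set.Finite.image2 (fun m n : ℤ => m + n) hf hg).subset ?_
    rintro _ ⟨p, hp, rfl⟩
    rw [Set.mem_ofPred_eq, CPA.mul_apply] at hp
    obtain ⟨k, -, hk⟩ := Finset.exists_ne_zero_of_sum_ne_zero hp
    exact ⟨_, ⟨_, left_ne_zero_of_mul hk, rfl⟩, _, ⟨_, right_ne_zero_of_mul hk, rfl⟩,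
      degree_take_add_drop p k⟩
  add_mem' {f g} hf hg := by
    refine (hf.union hg).subset ?_
    rintro _ ⟨p, hp, rfl⟩
    by_cases h : f p = 0
    · refine Or.inr ⟨p, fun h' => hp ?_, rfl⟩
      rw [CPA.add_apply, h, h', add_zero]
    · exact Or.inl ⟨p, h, rfl⟩
  algebraMap_mem' c := by
    refine (Set.finite_singleton (0 : ℤ)).subset ?_
    rintro _ ⟨p, hp, rfl⟩
    rw [Set.mem_ofPred_eq, Algebra.algebraMap_eq_smul_one, CPA.smul_apply, CPA.one_apply] at hp
    have h : p.length = 0 := by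
      by_contra h
      simp [h] at hp
    have h2 : p.word = [] := List.length_eq_zero_iff.mp h
    simp [degree, h2]

theorem mem_ginzburgAlgebra (f : CPA (ginzburgQuiver Q) K) :
    f ∈ ginzburgAlgebra Q K ↔ (degree '' {p | f p ≠ 0}).Finite := Iff.rfl

variable (Q K) in
/-- The infinite linear combinations of paths of degree `n` in the Ginzburg quiver. -/
def homogeneous (n : ℤ) : Submodule K (CPA (ginzburgQuiver Q) K) where
  carrier := {f | ∀ p, f p ≠ 0 → degree p = n}
  add_mem' {f g} hf hg p hp := by
    by_cases h : f p = 0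
    · refine hg p fun h' => hp ?_
      rw [CPA.add_apply, h, h', add_zero]
    · exact hf p h
  zero_mem' p hp := absurd rfl hp
  smul_mem' c f hf p hp := hf p (right_ne_zero_of_mul (a := c) hp)

variable (Q K) in
/-- The piece of degree `n` of the Ginzburg algebra. -/
noncomputable def gradedPiece (n : ℤ) : Submodule K (ginzburgAlgebra Q K) :=
  (homogeneous Q K n).comap (ginzburgAlgebra Q K).val.toLinearMap

theorem mul_mem_homogeneous {m n : ℤ} {f g : CPA (ginzburgQuiver Q) K}
    (hf : f ∈ homogeneous Q K m) (hg : g ∈ homogeneous Q K n) :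
    f * g ∈ homogeneous Q K (m + n) := by
  intro p hp
  rw [CPA.mul_apply] at hp
  obtain ⟨k, -, hk⟩ := Finset.exists_ne_zero_of_sum_ne_zero hp
  rw [← degree_take_add_drop p k, hf _ (left_ne_zero_of_mul hk), hg _ (right_ne_zero_of_mul hk)]

theorem ofPath_mem_homogeneous (p : Path (ginzburgQuiver Q)) :
    CPA.ofPath K p ∈ homogeneous Q K (degree p) := by
  intro q hq
  by_cases h : q = p
  · rw [h]
  · exact absurd (if_neg h) hq

theorem ofPath_mem (p : Path (ginzburgQuiver Q)) : CPA.ofPath K p ∈ ginzburgAlgebra Q K := by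
  rw [mem_ginzburgAlgebra]
  refine (Set.finite_singleton (degree p)).subset ?_
  rintro _ ⟨q, hq, rfl⟩
  by_cases h : q = p
  · simp [h]
  · exact absurd (if_neg h) hq

variable (Q K) in
/-- The idempotent `e_i` in the Ginzburg algebra. -/
noncomputable def ginzburgE (i : V) : ginzburgAlgebra Q K :=
  ⟨CPA.e (ginzburgQuiver Q) K i, ofPath_mem _⟩

variable (Q K) in
/-- The loop `t_i` in the Ginzburg algebra. -/
noncomputable def ginzburgT (i : V) : ginzburgAlgebra Q K :=
  ⟨CPA.arrow (Q := ginzburgQuiver Q) K (GArrow.loop i), ofPath_mem _⟩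

theorem isPath_map_orig (i : V) (x : List Q.Arrow) (h : Q.IsPath i x) :
    (ginzburgQuiver Q).IsPath i (x.map GArrow.orig) := by
  induction x generalizing i with
  | nil => trivial
  | cons a x ih => exact ⟨h.1, ih _ h.2⟩

/-- A path of `Q`, as a path of the Ginzburg quiver. -/
def toGinzburgPath (p : Path Q) : Path (ginzburgQuiver Q) :=
  ⟨p.start, p.word.map GArrow.orig, isPath_map_orig _ _ p.isPath⟩

theorem toGinzburgPath_end (i : V) (x : List Q.Arrow) :
    (ginzburgQuiver Q).endOf i (x.map GArrow.orig) = Q.endOf i x := by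
  induction x generalizing i with
  | nil => rfl
  | cons a x ih => exact ih _

/-- The inclusion of the completed path algebra of `Q` into that of the Ginzburg quiver:
extension of the coefficients by zero. -/
noncomputable def toGinzburg (f : CPA Q K) : CPA (ginzburgQuiver Q) K :=
  ⟨Function.extend toGinzburgPath f 0⟩

noncomputable instance [Fintype V] [Fintype Q.Arrow] : Fintype (ginzburgQuiver Q).Arrow :=
  open Classical in
  Fintype.ofSurjective
    (fun x : Q.Arrow ⊕ Q.Arrow ⊕ V => match x with
      | .inl a => GArrow.orig a
      | .inr (.inl a) => GArrow.star a
      | .inr (.inr i) => GArrow.loop i)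
    (fun y => match y with
      | .orig a => ⟨.inl a, rfl⟩
      | .star a => ⟨.inr (.inl a), rfl⟩
      | .loop i => ⟨.inr (.inr i), rfl⟩)

variable [Fintype Q.Arrow]

/-- The differentials of the arrows of the Ginzburg quiver: `d α = 0`, `d α* = ρ_α` and
`d t_i = e_i (∑ β, [β, β*]) e_i`. -/
noncomputable def arrowDifferential (h : Hyperpotential Q K) :
    (ginzburgQuiver Q).Arrow → CPA (ginzburgQuiver Q) K
  | .orig _ => 0
  | .star a => toGinzburg (h.ρ a)
  | .loop i => CPA.e (ginzburgQuiver Q) K i *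
      (∑ b : Q.Arrow,
        (CPA.arrow (Q := ginzburgQuiver Q) K (GArrow.orig b) *
            CPA.arrow (Q := ginzburgQuiver Q) K (GArrow.star b) -
          CPA.arrow (Q := ginzburgQuiver Q) K (GArrow.star b) *
            CPA.arrow (Q := ginzburgQuiver Q) K (GArrow.orig b))) *
      CPA.e (ginzburgQuiver Q) K i

theorem arrowDifferential_mem (h : Hyperpotential Q K) (a : (ginzburgQuiver Q).Arrow) :
    arrowDifferential h a ∈ homogeneous Q K (arrowDegree a + 1) := by
  rcases a with a | a | i
  · exact Submodule.zero_mem _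
  · intro p hp
    by_cases hq : ∃ q : Path Q, toGinzburgPath q = p
    · obtain ⟨q, rfl⟩ := hq
      have hz : ∀ x : List Q.Arrow,
          ((x.map GArrow.orig).map (arrowDegree (Q := Q))).sum = 0 := by
        intro x
        induction x with
        | nil => rfl
        | cons b x ih =>
          rw [List.map_cons, List.map_cons, List.sum_cons, ih]
          rfl
      exact hz q.word
    · exact absurd (Function.extend_apply' _ _ _ hq) hp
  · have he : CPA.e (ginzburgQuiver Q) K i ∈ homogeneous Q K 0 := ofPath_mem_homogeneous _
    have ho : ∀ b, CPA.arrow (Q := ginzburgQuiver Q) K (GArrow.orig b) ∈ homogeneous Q K 0 :=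
      fun b => ofPath_mem_homogeneous (Path.single (ginzburgQuiver Q) (GArrow.orig b))
    have hs : ∀ b, CPA.arrow (Q := ginzburgQuiver Q) K (GArrow.star b) ∈
        homogeneous Q K (-1) :=
      fun b => ofPath_mem_homogeneous (Path.single (ginzburgQuiver Q) (GArrow.star b))
    have hsum := Submodule.sum_mem (homogeneous Q K (-1)) (t := Finset.univ)
      (f := fun b : Q.Arrow =>
        CPA.arrow (Q := ginzburgQuiver Q) K (GArrow.orig b) *
            CPA.arrow (Q := ginzburgQuiver Q) K (GArrow.star b) -
          CPA.arrow (Q := ginzburgQuiver Q) K (GArrow.star b) *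
            CPA.arrow (Q := ginzburgQuiver Q) K (GArrow.orig b))
      fun b _ => Submodule.sub_mem _ (mul_mem_homogeneous (ho b) (hs b))
        (mul_mem_homogeneous (hs b) (ho b))
    have := mul_mem_homogeneous (mul_mem_homogeneous he hsum) he
    exact this

theorem arrowDifferential_parallel (h : Hyperpotential Q K) (a : (ginzburgQuiver Q).Arrow)
    (p : Path (ginzburgQuiver Q)) (hp : arrowDifferential h a p ≠ 0) :
    p.start = (ginzburgQuiver Q).src a ∧
      (ginzburgQuiver Q).endOf p.start p.word = (ginzburgQuiver Q).tgt a := by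
  rcases a with a | a | i
  · exact absurd rfl hp
  · by_cases hq : ∃ q : Path Q, toGinzburgPath q = p
    · obtain ⟨q, rfl⟩ := hq
      have hinj : Function.Injective (toGinzburgPath (Q := Q)) := by
        intro x y hxy
        ext1
        · exact congrArg (fun z => z.start) hxy
        · have := congrArg (fun z => z.word) hxy
          exact List.map_injective_iff.mpr (fun b c hbc => by injection hbc) this
      have h1 : h.ρ a q ≠ 0 := by
        have : arrowDifferential h (GArrow.star a) (toGinzburgPath q) = h.ρ a q :=
          hinj.extend_apply _ _ _
        rwa [this] at hp
      refine ⟨(h.parallel a q h1).1, ?_⟩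
      exact (toGinzburgPath_end _ _).trans (h.parallel a q h1).2
    · exact absurd (Function.extend_apply' _ _ _ hq) hp
  · change (CPA.e (ginzburgQuiver Q) K i * _ * CPA.e (ginzburgQuiver Q) K i) p ≠ 0 at hp
    rw [CPA.mul_e] at hp
    split_ifs at hp with h1
    · rw [CPA.e_mul] at hp
      split_ifs at hp with h2
      · exact ⟨h2, h1⟩
      · exact absurd rfl hp
    · exact absurd rfl hp

variable [Fintype V]

/-- The continuous linear extension of the Leibniz rule
`d (a₁ ⋯ aₙ) = ∑ j, (-1) ^ deg (a₁ ⋯ aⱼ₋₁) • a₁ ⋯ aⱼ₋₁ (d aⱼ) aⱼ₊₁ ⋯ aₙ`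
to infinite linear combinations of paths. A path `p` occurs in the differential of a path
`u a v` once for each factorization `p = u m v` in which `m` occurs in `d a`. -/
noncomputable def differentialFun (h : Hyperpotential Q K) (f : CPA (ginzburgQuiver Q) K) :
    CPA (ginzburgQuiver Q) K where
  toFun p := ∑ k ∈ Finset.range (p.length + 1), ∑ l ∈ Finset.range (p.length - k + 1),
    ∑ a : (ginzburgQuiver Q).Arrow,
      ((Int.negOnePow (degree (p.take k)) : ℤ) : K) *
        (arrowDifferential h a ((p.drop k).take l) *
          f.coeff p.start ((p.take k).word ++ a :: ((p.drop k).drop l).word))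

theorem differentialFun_apply (h : Hyperpotential Q K) (f : CPA (ginzburgQuiver Q) K)
    (p : Path (ginzburgQuiver Q)) :
    differentialFun h f p =
      ∑ k ∈ Finset.range (p.length + 1), ∑ l ∈ Finset.range (p.length - k + 1),
        ∑ a : (ginzburgQuiver Q).Arrow,
          ((Int.negOnePow (degree (p.take k)) : ℤ) : K) *
            (arrowDifferential h a ((p.drop k).take l) *
              f.coeff p.start ((p.take k).word ++ a :: ((p.drop k).drop l).word)) := rfl

theorem differentialFun_degree (h : Hyperpotential Q K) (f : CPA (ginzburgQuiver Q) K)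
    (p : Path (ginzburgQuiver Q)) (hp : differentialFun h f p ≠ 0) :
    ∃ q, f q ≠ 0 ∧ degree p = degree q + 1 := by
  rw [differentialFun_apply] at hp
  obtain ⟨k, -, hk⟩ := Finset.exists_ne_zero_of_sum_ne_zero hp
  obtain ⟨l, -, hl⟩ := Finset.exists_ne_zero_of_sum_ne_zero hk
  obtain ⟨a, -, ha⟩ := Finset.exists_ne_zero_of_sum_ne_zero hl
  have h1 := right_ne_zero_of_mul ha
  have h2 := left_ne_zero_of_mul h1
  have h3 := right_ne_zero_of_mul h1
  unfold CPA.coeff at h3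
  split_ifs at h3 with h4
  · refine ⟨_, h3, ?_⟩
    have h5 := arrowDifferential_mem h a _ h2
    rw [← degree_take_add_drop p k, ← degree_take_add_drop (p.drop k) l, h5]
    simp only [degree, List.map_append, List.map_cons, List.sum_append, List.sum_cons]
    ring
  · exact absurd rfl h3

/-- The values of the differential on the arrows. -/
theorem differentialFun_arrow (h : Hyperpotential Q K) (a : (ginzburgQuiver Q).Arrow) :
    differentialFun h (CPA.arrow K a) = arrowDifferential h a := by
  classical
  ext p
  simp only [differentialFun_apply]
  have key : ∀ (i : V) (x : List (ginzburgQuiver Q).Arrow), 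
      (CPA.arrow K a : CPA (ginzburgQuiver Q) K).coeff i x
       = if i = (ginzburgQuiver Q).src a ∧ x = [a] then 1 else 0 := by
    intro i x
    simp only [CPA.coeff, CPA.arrow, CPA.ofPath_apply]
    by_cases h1 : i = (ginzburgQuiver Q).src a ∧ x = [a]
    · obtain ⟨rfl, rfl⟩ := h1
      have : (ginzburgQuiver Q).IsPath ((ginzburgQuiver Q).src a) [a] := ⟨rfl, trivial⟩
      rw [dif_pos this, if_pos (by rfl), if_pos ⟨rfl, rfl⟩]
    · rw [if_neg h1]
      split_ifs with h2 h3
      · exact absurd ⟨congrArg Path.start h3, congrArg Path.word h3⟩ h1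
      · rfl
      · rfl
  rw [Finset.sum_eq_single 0, Finset.sum_eq_single p.length, Finset.sum_eq_single a]
  · rw [key, Path.drop_zero, Path.take_length]
    have e1 : degree (p.take 0) = 0 := by simp [degree, Path.take]
    have e2 : (p.take 0).word ++ a :: (p.drop p.length).word = [a] := by
      simp [Path.take, Path.drop, Path.length]
    rw [e1, e2]
    by_cases h0 : arrowDifferential h a p = 0
    · simp [h0]
    · simp [(arrowDifferential_parallel h a p h0).1]
  · intro b _ hb
    rw [key, if_neg]
    · simp
    · rintro ⟨-, h2⟩
      simp [Path.take, Path.drop, Path.length] at h2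
      exact hb h2
  · simp
  · intro l hl hl0
    apply Finset.sum_eq_zero
    intro b _
    rw [key, if_neg]
    · simp
    · rintro ⟨-, h2⟩
      have h3 := congrArg List.length h2
      simp [Path.take, Path.drop] at h3
      simp [Path.length] at hl hl0
      omega
  · simp
  · intro k hk hk0
    apply Finset.sum_eq_zero
    intro l _
    apply Finset.sum_eq_zero
    intro b _
    rw [key, if_neg]
    · simp
    · rintro ⟨-, h2⟩
      have h3 := congrArg List.length h2
      simp [Path.take, Path.drop] at h3
      simp [Path.length] at hk
      omega
  · simp

/-- The Leibniz rule. -/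
theorem differentialFun_mul (h : Hyperpotential Q K) (n : ℤ) (f g : CPA (ginzburgQuiver Q) K)
    (hf : f ∈ homogeneous Q K n) :
    differentialFun h (f * g) = differentialFun h f * g +
      ((Int.negOnePow n : ℤ) : K) • (f * differentialFun h g) := by
  ext p
  rw [CPA.add_apply, CPA.smul_apply, CPA.mul_apply, CPA.mul_apply]
  simp only [differentialFun_apply]
  refine (Finset.sum_congr rfl fun k _ => Finset.sum_congr rfl fun l _ => Finset.sum_congr rfl
    fun a _ => by rw [CPA.coeff_mul_append (Q := ginzburgQuiver Q)]).trans ?_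
  simp only [mul_add, Finset.sum_add_distrib]
  rw [add_comm]
  congr 1
  · simp only [Finset.sum_mul, Finset.mul_sum]
    simp only [Finset.sum_sigma']
    refine Finset.sum_bij'
      (fun x _ => ⟨x.1 + x.2.1 + x.2.2.2, x.1, x.2.1, x.2.2.1⟩)
      (fun x _ => ⟨x.2.1, x.2.2.1, x.2.2.2, x.1 - x.2.1 - x.2.2.1⟩) ?_ ?_ ?_ ?_ ?_
    · rintro ⟨k, l, a, j⟩ hx
      simp [Path.length_take, Path.length_drop] at hx ⊢
      simp [Path.drop, Path.length] at hx ⊢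
      omega
    · rintro ⟨k', k, l, a⟩ hx
      simp [Path.length_take, Path.length_drop] at hx ⊢
      simp [Path.drop, Path.length] at hx ⊢
      omega
    · rintro ⟨k, l, a, j⟩ hx
      simp
      congr 1
      omega
    · rintro ⟨k', k, l, a⟩ hx
      simp [Path.length_take, Path.length_drop] at hx ⊢
      have : k + l + (k' - k - l) = k' := by omega
      simp [this]
    · rintro ⟨k, l, a, j⟩ hx
      simp [Path.length_take, Path.length_drop] at hx
      simp only [Path.drop, Path.length, List.length_drop] at hx
      dsimp only
      have e1 : Path.take (Path.take p (k + l + j)) k = Path.take p k :=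
        Path.take_take p (by omega)
      have e2 : ((p.take (k + l + j)).drop k).take l = (p.drop k).take l := by
        rw [show k + l + j = k + (l + j) by omega, ← Path.take_drop, Path.take_take _ (by omega)]
      have e3 : ((p.take (k + l + j)).drop k).drop l = ((p.drop k).drop l).take j := by
        rw [Path.drop_drop, Path.drop_drop, Path.take_drop]
      rw [e1, e2, e3]
      by_cases h0 : arrowDifferential h a ((p.drop k).take l) = 0
      · simp [h0]
      have hpar := (arrowDifferential_parallel h a _ h0).2
      have e4 : g.coeff ((ginzburgQuiver Q).endOf ((ginzburgQuiver Q).tgt a)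
          (((p.drop k).drop l).word.take j)) (((p.drop k).drop l).word.drop j)
          = g (p.drop (k + l + j)) := by
        rw [← hpar]
        have : p.drop (k + l + j) = ((p.drop k).drop l).drop j := by
          rw [Path.drop_drop, Path.drop_drop]; congr 1; omega
        rw [this]
        exact dif_pos (Path.isPath (((p.drop k).drop l).drop j))
      rw [e4]
      simp only [Path.take]
      ring
  · simp only [Finset.mul_sum]
    simp only [Finset.sum_sigma']
    refine Finset.sum_bij'
      (fun x _ => ⟨x.2.2.2, x.1 - x.2.2.2, x.2.1, x.2.2.1⟩)
      (fun x _ => ⟨x.1 + x.2.1, x.2.2.1, x.2.2.2, x.1⟩) ?_ ?_ ?_ ?_ ?_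
    · rintro ⟨k, l, a, j⟩ hx
      simp [Path.length_drop] at hx ⊢
      simp [Path.take, Path.length] at hx ⊢
      omega
    · rintro ⟨k', k, l, a⟩ hx
      simp [Path.length_drop] at hx ⊢
      simp [Path.take, Path.length] at hx ⊢
      omega
    · rintro ⟨k, l, a, j⟩ hx
      simp [Path.length_drop] at hx ⊢
      simp [Path.take, Path.length] at hx ⊢
      omega
    · rintro ⟨k', k, l, a⟩ hx
      simp
    · rintro ⟨k, l, a, j⟩ hx
      simp [Path.length_drop] at hx
      simp only [Path.take, List.length_take] at hx
      dsimp only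
      have hj : j ≤ k := by omega
      have e0 : j + (k - j) = k := by omega
      have e1 : (p.drop j).drop (k - j) = p.drop k := by rw [Path.drop_drop, e0]
      have e2 : f.coeff p.start ((p.take k).word.take j) = f (p.take j) := by
        have : (p.take k).word.take j = (p.take j).word := by
          simp [Path.take, List.take_take, hj]
        rw [this]
        exact dif_pos (p.take j).isPath
      have e3 : (p.take k).word.drop j = ((p.drop j).take (k - j)).word := by
        simp [Path.take, Path.drop, List.drop_take]
      have e4 : (ginzburgQuiver Q).endOf p.start ((p.take k).word.take j) = (p.drop j).start := by
        simp [Path.take, Path.drop, List.take_take, hj]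
      rw [e1, e2, e3, e4]
      by_cases h0 : f (p.take j) = 0
      · simp [h0]
      have hd : degree (p.take k) = n + degree ((p.drop j).take (k - j)) := by
        rw [← hf _ h0, ← degree_take_add_drop (p.take k) j, Path.take_take p hj, Path.take_drop, e0]
      rw [hd, Int.negOnePow_add]
      push_cast
      ring

/-- The differential is continuous. -/
theorem continuous_differentialFun (h : Hyperpotential Q K) : Continuous (differentialFun h) := by
  let : TopologicalSpace K := ⊥
  have : DiscreteTopology K := ⟨rfl⟩
  refine continuous_induced_rng.mpr (continuous_pi fun p => ?_)
  change Continuous fun f => differentialFun h f p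
  simp only [differentialFun_apply]
  refine continuous_finsetSum _ fun k _ => continuous_finsetSum _ fun l _ => continuous_finsetSum _ fun a _ => ?_
  refine continuous_const.mul (continuous_const.mul ?_)
  unfold CPA.coeff
  split_ifs with h1
  · exact (continuous_apply (A := fun _ : Path (ginzburgQuiver Q) => K) _).comp continuous_induced_dom
  · exact continuous_const
/-- The differential of the Ginzburg dg-algebra, as a linear endomorphism. -/
noncomputable def differential (h : Hyperpotential Q K) :
    ginzburgAlgebra Q K →ₗ[K] ginzburgAlgebra Q K where
  toFun f := ⟨differentialFun h f.1, by
    rw [mem_ginzburgAlgebra]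
    refine (Set.Finite.image (fun n : ℤ => n + 1)
      ((mem_ginzburgAlgebra _).mp f.2)).subset ?_
    rintro _ ⟨p, hp, rfl⟩
    obtain ⟨q, hq, hpq⟩ := differentialFun_degree h f.1 p hp
    exact ⟨degree q, ⟨q, hq, rfl⟩, hpq.symm⟩⟩
  map_add' f g := by
    ext p
    change differentialFun h (f.1 + g.1) p = differentialFun h f.1 p + differentialFun h g.1 p
    simp only [differentialFun_apply, CPA.coeff_add, mul_add, Finset.sum_add_distrib]
  map_smul' c f := by
    ext p
    change differentialFun h (c • f.1) p = c * differentialFun h f.1 p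
    simp only [differentialFun_apply, CPA.coeff_smul, Finset.mul_sum]
    refine Finset.sum_congr rfl fun k _ => Finset.sum_congr rfl fun l _ =>
      Finset.sum_congr rfl fun a _ => ?_
    ring

variable {Q' : QuiverOn.{u, v'} V} [Fintype Q'.Arrow]

/-- `Φ` is a continuous isomorphism of dg-algebras `Γ(Q, ρ) → Γ(Q', ρ')`: it is continuous,
preserves degrees and commutes with the differentials. -/
def IsContinuousDGIso (h : Hyperpotential Q K) (h' : Hyperpotential Q' K)
    (Φ : ginzburgAlgebra Q K ≃ₐ[K] ginzburgAlgebra Q' K) : Prop :=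
  Continuous Φ ∧
  (∀ n : ℤ, ∀ x ∈ gradedPiece Q K n, Φ x ∈ gradedPiece Q' K n) ∧
  ∀ x, Φ (differential h x) = differential h' (Φ x)

end Ginzburg

end Hyperpot

/-!
Write `A`, `A'` for the two completed path algebras and `φ : A ≃ A'` for a continuous isomorphism
that preserves the idempotents. The *cyclic derivative* of a path with respect to an arrow `b`, with
an element `m` inserted, is the sum of `v m u` over all factorizations `u b v` of the path. It has
two uses.

First, a class in `HH₁(A')` is determined by its components in the small complex
`⨁_b e_{t(b)} A' e_{s(b)} → A'`: the component at `b` of `m ⊗ p` is the cyclic derivative of `p`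
with `m` inserted. The components of boundaries vanish (`hochschildComponent_hochschildD`), and a
cyclic chain whose components all vanish is a boundary, by an explicit contracting homotopy
(`mem_range_hochschildD`). So `φ_* ρ = ρ'` becomes a family of equations in `A'`, one for each arrow
(`mapsHyperpotential_iff`).

Second, the commutator of `f` with `m` is the sum over the arrows `b` of the commutators of `b` with
the cyclic derivatives of `f` (`sum_commutator_cyclicDeriv`). In the Ginzburg algebra an expression
`∑_b [b, m_b]` determines the entries `m_b`, if these have no component of degree zero
(`eq_zero_of_sum_commutator_eq_zero`).

Given a dg-isomorphism `Φ` with `Φ(t_i) = c t'_i`, its part of degree zero is such a `φ`. The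
differentials of the loops give `∑_a [φ(a), Φ(a*)] = c ∑_b [b, b*]`. Expanding the left side in the
arrows of `Q'`, uniqueness of the entries shows that the cyclic derivatives of the `φ(a)`, with
`Φ(a*)` inserted, add up to `c b*`. Applying the differential gives the equations that say
`φ_* ρ = c ρ'` (`exists_algEquiv_of_dgIso`).

Conversely, `φ` is extended by `t_i ↦ c t'_i`, and `a*` is sent to `c` times the sum over `b` of the
cyclic derivatives of `φ⁻¹(b)` with respect to `a`, with `b*` inserted. Then
`∑_a [a, a*] ↦ c ∑_b [b, b*]`. The same construction for `φ⁻¹` and `c⁻¹` gives an inverse, again by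
uniqueness of the entries of a sum of commutators, and `φ_* ρ = c ρ'` says precisely that this
inverse commutes with the differentials (`exists_dgIso_of_components`).

All constructions require that the arrows can be replaced by arbitrary images in infinite linear
combinations. The image of a loop under `φ` may have constant coefficients, but by continuity these
are nilpotent, hence generate a nilpotent ideal of `K`, which suffices for convergence (`IsTame`).
This also makes `φ⁻¹` continuous (`continuous_symm`).
-/

namespace Hyperpot

universe u v v' v'' w
open QuiverOn

/-! ### Infinite linear combinations -/

section ColumnFinite

variable {S : Type*} {S' : Type*} {K : Type w} [CommRing K]

/-- The linear map between spaces of infinite linear combinations that is given by a matrix whose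
columns are finite: a basis element `s` is sent to `M s`. -/
noncomputable def matrixMap (M : S → S' → K) (hM : ∀ s', {s | M s s' ≠ 0}.Finite) :
    (S → K) →ₗ[K] (S' → K) where
  toFun F := fun s' => ∑ s ∈ (hM s').toFinset, F s * M s s'
  map_add' F G := by
    funext s'
    simp only [Pi.add_apply, add_mul, Finset.sum_add_distrib]
  map_smul' c F := by
    funext s'
    simp only [Pi.smul_apply, smul_eq_mul, mul_assoc, Finset.mul_sum, RingHom.id_apply]

variable (K) in
open Classical in
/-- The basis element `s` of the space of infinite linear combinations of elements of `S`. -/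
noncomputable def basisVec (s : S) : S → K := Pi.single s 1

open Classical in
theorem basisVec_apply (s t : S) : basisVec K s t = if t = s then 1 else 0 :=
  Pi.single_apply s 1 t

theorem matrixMap_basisVec (M : S → S' → K) (hM : ∀ s', {s | M s s' ≠ 0}.Finite) (s : S) :
    matrixMap M hM (basisVec K s) = M s := by
  funext s'
  change ∑ t ∈ (hM s').toFinset, basisVec K s t * M t s' = M s s'
  rw [Finset.sum_eq_single s]
  · simp [basisVec_apply]
  · intro t _ ht
    simp [basisVec_apply, ht]
  · intro hs
    simp only [Set.Finite.mem_toFinset, Set.mem_ofPred_eq, not_not] at hs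
    rw [hs, mul_zero]

variable [TopologicalSpace K]

theorem continuous_matrixMap [DiscreteTopology K] (M : S → S' → K)
    (hM : ∀ s', {s | M s s' ≠ 0}.Finite) :
    Continuous (matrixMap M hM) :=
  continuous_pi fun _ => continuous_finsetSum _ fun s _ => (continuous_apply s).mul continuous_const

theorem hasSum_smul_basisVec (F : S → K) :
    HasSum (fun s => F s • basisVec K s) F := by
  refine Pi.hasSum.mpr fun t => ?_
  convert hasSum_single (f := fun s => (F s • basisVec K s) t) t ?_ using 1
  · simp [basisVec_apply]
  · intro s hs
    simp [basisVec_apply, hs.symm]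

/-- Continuous linear maps are determined by their values on the basis elements that occur. -/
theorem eq_of_eq_on_basisVec [DiscreteTopology K] {N : Type*} [AddCommGroup N] [Module K N]
    [TopologicalSpace N] [T2Space N] {U U' : (S → K) →ₗ[K] N} (hU : Continuous U) (hU' : Continuous U')
    (F : S → K) (h : ∀ s, F s ≠ 0 → U (basisVec K s) = U' (basisVec K s)) : U F = U' F := by
  have h1 := (hasSum_smul_basisVec F).map U hU
  have h2 := (hasSum_smul_basisVec F).map U' hU'
  refine h1.unique ?_
  convert h2 using 1
  funext s
  simp only [Function.comp_apply, map_smul]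
  by_cases hs : F s = 0
  · simp [hs]
  · rw [h s hs]

end ColumnFinite

/-! ### The topology of the completed path algebra -/

section Topology

variable {V : Type u} {Q : QuiverOn.{u, v} V} {K : Type w} [CommRing K]

variable (Q K) in
/-- The coefficients, as a linear equivalence. -/
def CPA.toPi : CPA Q K ≃ₗ[K] (Path Q → K) :=
  { CPA.equivFun Q K with
    map_add' := fun _ _ => rfl
    map_smul' := fun _ _ => rfl }

theorem CPA.toPi_apply (f : CPA Q K) (p : Path Q) : CPA.toPi Q K f p = f p := rfl

theorem CPA.sum_apply {ι : Type*} (s : Finset ι) (f : ι → CPA Q K) (p : Path Q) :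
    (∑ i ∈ s, f i) p = ∑ i ∈ s, f i p := by
  rw [← CPA.toPi_apply, map_sum, Finset.sum_apply]
  rfl

theorem CPA.continuous_iff {K : Type w} [tK : TopologicalSpace K] [DiscreteTopology K] {X : Type*}
    [TopologicalSpace X] {T : X → CPA Q K} :
    Continuous T ↔ ∀ p, Continuous fun x => T x p := by
  obtain rfl : tK = ⊥ := DiscreteTopology.eq_bot
  exact continuous_induced_rng.trans (@continuous_pi_iff _ _ _ _ (fun _ => ⊥) _)

theorem CPA.continuous_apply {K : Type w} [TopologicalSpace K] [DiscreteTopology K] (p : Path Q) :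
    Continuous fun f : CPA Q K => f p :=
  CPA.continuous_iff.mp continuous_id p

theorem CPA.continuous_toPi [TopologicalSpace K] [DiscreteTopology K] :
    Continuous (CPA.toPi Q K) :=
  continuous_pi fun p => CPA.continuous_apply p

theorem CPA.continuous_toPi_symm [TopologicalSpace K] [DiscreteTopology K] :
    Continuous (CPA.toPi Q K).symm :=
  CPA.continuous_iff.mpr fun p => _root_.continuous_apply p

instance : T2Space (CPA Q K) := by
  let : TopologicalSpace K := ⊥
  have : DiscreteTopology K := ⟨rfl⟩
  exact T2Space.of_injective_continuous (CPA.toPi Q K).injective CPA.continuous_toPi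

instance : IsTopologicalRing (CPA Q K) := by
  let : TopologicalSpace K := ⊥
  have : DiscreteTopology K := ⟨rfl⟩
  have h1 (p : Path Q) : Continuous fun x : CPA Q K × CPA Q K => x.1 p :=
    (CPA.continuous_apply p).comp continuous_fst
  have h2 (p : Path Q) : Continuous fun x : CPA Q K × CPA Q K => x.2 p :=
    (CPA.continuous_apply p).comp continuous_snd
  exact
    { continuous_add := CPA.continuous_iff.mpr fun p => (h1 p).add (h2 p)
      continuous_mul := CPA.continuous_iff.mpr fun p =>
        continuous_finsetSum (Finset.range (p.length + 1)) fun k _ =>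
          (h1 (p.take k)).mul (h2 (p.drop k))
      continuous_neg := CPA.continuous_iff.mpr fun p => (CPA.continuous_apply p).neg }

instance : ContinuousConstSMul K (CPA Q K) := by
  let : TopologicalSpace K := ⊥
  have : DiscreteTopology K := ⟨rfl⟩
  exact ⟨fun c => CPA.continuous_iff.mpr fun p => continuous_const.mul (CPA.continuous_apply p)⟩

theorem CPA.toPi_ofPath (p : Path Q) : CPA.toPi Q K (CPA.ofPath K p) = basisVec K p := by
  funext q
  rw [CPA.toPi_apply, CPA.ofPath_apply, basisVec_apply]

/-- Continuous linear maps on a completed path algebra are determined by their values on the paths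
that occur. -/
theorem CPA.eq_of_eq_on_ofPath {N : Type*} [AddCommGroup N] [Module K N] [TopologicalSpace N]
    [T2Space N] {U U' : CPA Q K →ₗ[K] N} (hU : Continuous U) (hU' : Continuous U') (f : CPA Q K)
    (h : ∀ p, f p ≠ 0 → U (CPA.ofPath K p) = U' (CPA.ofPath K p)) : U f = U' f := by
  classical
  let : TopologicalSpace K := ⊥
  have : DiscreteTopology K := ⟨rfl⟩
  have := eq_of_eq_on_basisVec (U := U ∘ₗ (CPA.toPi Q K).symm.toLinearMap)
    (U' := U' ∘ₗ (CPA.toPi Q K).symm.toLinearMap) (hU.comp CPA.continuous_toPi_symm)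
    (hU'.comp CPA.continuous_toPi_symm) (CPA.toPi Q K f) fun p hp => ?_
  · simpa using this
  · simpa [← CPA.toPi_ofPath] using h p hp

theorem CPA.hasSum_ofPath (f : CPA Q K) : HasSum (fun p => f p • CPA.ofPath K p) f := by
  classical
  let : TopologicalSpace K := ⊥
  have : DiscreteTopology K := ⟨rfl⟩
  convert (hasSum_smul_basisVec (CPA.toPi Q K f)).map (CPA.toPi Q K).symm CPA.continuous_toPi_symm
    using 1
  · funext p
    simp [← CPA.toPi_ofPath, CPA.toPi_apply]
  · simp

/-- A coefficient of the image under a continuous linear map can only come from paths that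
occur. -/
theorem CPA.exists_of_map_apply_ne_zero {Q' : QuiverOn.{u, v'} V} {U : CPA Q K →ₗ[K] CPA Q' K}
    (hU : Continuous U) {f : CPA Q K} {q : Path Q'} (hq : U f q ≠ 0) :
    ∃ p, f p ≠ 0 ∧ U (CPA.ofPath K p) q ≠ 0 := by
  let : TopologicalSpace K := ⊥
  have : DiscreteTopology K := ⟨rfl⟩
  by_contra! H
  refine hq ?_
  have hc : Continuous (LinearMap.proj q ∘ₗ (CPA.toPi Q' K).toLinearMap ∘ₗ U) :=
    (CPA.continuous_apply q).comp hU
  exact CPA.eq_of_eq_on_ofPath (U' := 0) hc continuous_const f fun p hp => H p hp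

variable {S : Type*}

/-- The continuous linear map that sends a basis element `s` to `y s`. -/
noncomputable def sumMap (y : S → CPA Q K) (hy : ∀ q, {s | y s q ≠ 0}.Finite) :
    (S → K) →ₗ[K] CPA Q K :=
  (CPA.toPi Q K).symm.toLinearMap ∘ₗ matrixMap (fun s q => y s q) hy

theorem sumMap_basisVec (y : S → CPA Q K) (hy : ∀ q, {s | y s q ≠ 0}.Finite) (s : S) :
    sumMap y hy (basisVec K s) = y s := by
  rw [sumMap, LinearMap.comp_apply, matrixMap_basisVec]
  rfl

theorem continuous_sumMap [TopologicalSpace K] [DiscreteTopology K] (y : S → CPA Q K)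
    (hy : ∀ q, {s | y s q ≠ 0}.Finite) : Continuous (sumMap y hy) :=
  CPA.continuous_toPi_symm.comp (continuous_matrixMap _ hy)

variable {Q' : QuiverOn.{u, v'} V}

/-- The continuous linear map of completed path algebras that sends a path `p` to `y p`. -/
noncomputable def pathMap (y : Path Q → CPA Q' K) (hy : ∀ q, {p | y p q ≠ 0}.Finite) :
    CPA Q K →ₗ[K] CPA Q' K :=
  sumMap y hy ∘ₗ (CPA.toPi Q K).toLinearMap

theorem pathMap_ofPath (y : Path Q → CPA Q' K) (hy : ∀ q, {p | y p q ≠ 0}.Finite) (p : Path Q) :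
    pathMap y hy (CPA.ofPath K p) = y p := by
  classical
  simp [pathMap, CPA.toPi_ofPath, sumMap_basisVec]

theorem continuous_pathMap (y : Path Q → CPA Q' K) (hy : ∀ q, {p | y p q ≠ 0}.Finite) :
    Continuous (pathMap y hy) := by
  let : TopologicalSpace K := ⊥
  have : DiscreteTopology K := ⟨rfl⟩
  exact (continuous_sumMap y hy).comp CPA.continuous_toPi

end Topology

/-! ### Paths and idempotents -/

section Paths

variable {V : Type u} {Q : QuiverOn.{u, v} V} {K : Type w} [CommRing K]

/-- The end vertex of a path. -/
def Path.finish (p : Path Q) : V := Q.endOf p.start p.word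

/-- The path that traverses the arrow `a` and then the path `p`. -/
def Path.cons (a : Q.Arrow) (p : Path Q) (h : p.start = Q.tgt a) : Path Q :=
  ⟨Q.src a, a :: p.word, rfl, h ▸ p.isPath⟩

theorem Path.finish_cons (a : Q.Arrow) (p : Path Q) (h : p.start = Q.tgt a) :
    (Path.cons a p h).finish = p.finish := by
  simp [Path.cons, Path.finish, endOf, h]

theorem Path.cons_induction {P : Path Q → Prop} (nil : ∀ i, P (Path.nil Q i))
    (cons : ∀ a p (h : p.start = Q.tgt a), P p → P (Path.cons a p h)) (p : Path Q) : P p := by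
  obtain ⟨i, x, hx⟩ := p
  induction x generalizing i with
  | nil => exact nil i
  | cons a x ih =>
    obtain ⟨rfl, h2⟩ := hx
    exact cons a ⟨_, x, h2⟩ rfl (ih _ h2)

theorem Path.finite_length_lt [Finite V] [Finite Q.Arrow] (n : ℕ) :
    {p : Path Q | p.length < n}.Finite := by
  have h := (Set.finite_univ (α := V)).prod (List.finite_length_lt Q.Arrow n)
  refine Set.Finite.of_finite_image (f := fun p : Path Q => (p.start, p.word)) (h.subset ?_) ?_
  · rintro _ ⟨p, hp, rfl⟩
    exact ⟨trivial, hp⟩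
  · intro p _ q _ hpq
    simp only [Prod.mk.injEq] at hpq
    exact Path.ext hpq.1 hpq.2

theorem CPA.e_mul_ofPath_start (p : Path Q) :
    CPA.e Q K p.start * CPA.ofPath K p = CPA.ofPath K p := by
  classical
  ext q
  rw [CPA.e_mul, CPA.ofPath_apply]
  by_cases h : q = p
  · simp [h]
  · simp [h]

theorem CPA.ofPath_mul_e_finish (p : Path Q) :
    CPA.ofPath K p * CPA.e Q K p.finish = CPA.ofPath K p := by
  classical
  ext q
  rw [CPA.mul_e, CPA.ofPath_apply]
  by_cases h : q = p
  · simp [h, Path.finish]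
  · simp [h]

theorem CPA.e_mul_e_self (i : V) : CPA.e Q K i * CPA.e Q K i = CPA.e Q K i :=
  CPA.e_mul_ofPath_start (Path.nil Q i)

theorem CPA.e_mul_e_of_ne {i j : V} (h : i ≠ j) : CPA.e Q K i * CPA.e Q K j = 0 := by
  classical
  ext q
  rw [CPA.e_mul, CPA.e, CPA.ofPath_apply, CPA.zero_apply]
  split_ifs with h1 h2
  · exact absurd (h1.symm.trans (congrArg Path.start h2)) h
  · rfl
  · rfl

theorem CPA.sum_e [Fintype V] : ∑ i, CPA.e Q K i = 1 := by
  classical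
  ext q
  rw [CPA.sum_apply, CPA.one_apply]
  simp only [CPA.e, CPA.ofPath_apply]
  have (i : V) : q = Path.nil Q i ↔ i = q.start ∧ q.length = 0 := by
    constructor
    · rintro rfl
      exact ⟨rfl, rfl⟩
    · rintro ⟨rfl, h⟩
      ext1
      · rfl
      · exact List.length_eq_zero_iff.mp h
  by_cases h : q.length = 0
  · simp [this, h]
  · simp [this, h]

theorem CPA.e_mul_arrow (a : Q.Arrow) :
    CPA.e Q K (Q.src a) * CPA.arrow K a = CPA.arrow K a :=
  CPA.e_mul_ofPath_start (Path.single Q a)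

theorem CPA.arrow_mul_e (a : Q.Arrow) :
    CPA.arrow K a * CPA.e Q K (Q.tgt a) = CPA.arrow K a :=
  CPA.ofPath_mul_e_finish (Path.single Q a)

open Classical in
theorem CPA.arrow_mul_apply (a : Q.Arrow) (f : CPA Q K) (p : Path Q) :
    (CPA.arrow K a * f) p = if p.word.head? = some a then f (p.drop 1) else 0 := by
  have key (k : ℕ) : Path.take p k = Path.single Q a ↔
      (min k p.length = 1 ∧ p.word.head? = some a) := by
    obtain ⟨i, x, hx⟩ := p
    rcases x with _ | ⟨b, x⟩
    · simp [Path.ext_iff, Path.take, Path.single, Path.length]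
    · obtain ⟨rfl, hx⟩ := hx
      rcases k with _ | k
      · simp [Path.ext_iff, Path.take, Path.single, Path.length]
      · constructor
        · intro h
          have h1 := congrArg Path.word h
          simp only [Path.take, Path.single, List.take_succ_cons, List.cons.injEq] at h1
          have h2 := congrArg List.length h1.2
          rw [List.length_take] at h2
          simp [h1.1, Path.length] at h2 ⊢
          omega
        · rintro ⟨h1, h2⟩
          simp only [List.head?_cons, Option.some.injEq] at h2
          subst h2
          simp only [Path.length, List.length_cons] at h1
          have h3 : (List.take k x) = [] := by
            rw [← List.length_eq_zero_iff, List.length_take]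
            omega
          ext1
          · rfl
          · simp [Path.take, Path.single, h3]
  rw [CPA.mul_apply, Finset.sum_eq_single 1]
  · simp only [CPA.arrow, CPA.ofPath_apply, key]
    rcases hx : p.word with _ | ⟨b, x⟩
    · simp [Path.length, hx]
    · simp [Path.length, hx]
  · intro k hk hk1
    simp only [CPA.arrow, CPA.ofPath_apply, key]
    simp only [Finset.mem_range] at hk
    rw [if_neg (by omega), zero_mul]
  · intro h
    simp only [Finset.mem_range] at h
    simp only [CPA.arrow, CPA.ofPath_apply, key]
    rw [if_neg (by omega), zero_mul]

theorem CPA.ofPath_cons (a : Q.Arrow) (p : Path Q) (h : p.start = Q.tgt a) :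
    CPA.ofPath K (Path.cons a p h) = CPA.arrow K a * CPA.ofPath K p := by
  classical
  ext q
  rw [CPA.arrow_mul_apply, CPA.ofPath_apply, CPA.ofPath_apply, ← ite_and]
  congr 1
  refine propext ⟨?_, ?_⟩
  · rintro rfl
    refine ⟨rfl, ?_⟩
    ext1
    · simp [Path.drop, Path.cons, endOf, h]
    · simp [Path.drop, Path.cons]
  · rintro ⟨h1, rfl⟩
    obtain ⟨i, x, hx⟩ := q
    rcases x with _ | ⟨b, x⟩
    · simp at h1
    · obtain ⟨rfl, hx⟩ := hx
      simp only [List.head?_cons, Option.some.injEq] at h1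
      subst h1
      rfl

theorem CPA.ofPath_eq (p : Path Q) :
    CPA.ofPath K p = CPA.e Q K p.start * (p.word.map (CPA.arrow K)).prod := by
  induction p using Path.cons_induction with
  | nil i => simp [CPA.e, Path.nil]
  | cons a p h ih =>
    rw [CPA.ofPath_cons, ih]
    simp only [Path.cons, List.map_cons, List.prod_cons]
    rw [h, ← mul_assoc, ← mul_assoc, CPA.arrow_mul_e, CPA.e_mul_arrow]

/-- The elements of `e_i A e_j`. -/
def IsBetween (i j : V) (f : CPA Q K) : Prop := CPA.e Q K i * f * CPA.e Q K j = f

namespace IsBetween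

theorem left {i j : V} {f : CPA Q K} (h : IsBetween i j f) : CPA.e Q K i * f = f := by
  have h' : CPA.e Q K i * f * CPA.e Q K j = f := h
  rw [← h', ← mul_assoc, ← mul_assoc, CPA.e_mul_e_self]

theorem right {i j : V} {f : CPA Q K} (h : IsBetween i j f) : f * CPA.e Q K j = f := by
  have h' : CPA.e Q K i * f * CPA.e Q K j = f := h
  rw [← h', mul_assoc, CPA.e_mul_e_self]

theorem of_left_right {i j : V} {f : CPA Q K} (h : CPA.e Q K i * f = f)
    (h' : f * CPA.e Q K j = f) : IsBetween i j f := by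
  rw [IsBetween, h, h']

theorem mul {i j k : V} {f g : CPA Q K} (hf : IsBetween i j f) (hg : IsBetween j k g) :
    IsBetween i k (f * g) :=
  of_left_right (by rw [← mul_assoc, hf.left]) (by rw [mul_assoc, hg.right])

theorem sum {ι : Type*} {i j : V} (s : Finset ι) {f : ι → CPA Q K}
    (h : ∀ x ∈ s, IsBetween i j (f x)) : IsBetween i j (∑ x ∈ s, f x) := by
  rw [IsBetween, Finset.mul_sum, Finset.sum_mul]
  exact Finset.sum_congr rfl h

theorem add {i j : V} {f g : CPA Q K} (hf : IsBetween i j f) (hg : IsBetween i j g) :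
    IsBetween i j (f + g) := by
  rw [IsBetween, mul_add, add_mul, hf, hg]

theorem sub {i j : V} {f g : CPA Q K} (hf : IsBetween i j f) (hg : IsBetween i j g) :
    IsBetween i j (f - g) := by
  rw [IsBetween, mul_sub, sub_mul, hf, hg]

theorem smul {i j : V} (c : K) {f : CPA Q K} (hf : IsBetween i j f) : IsBetween i j (c • f) := by
  rw [IsBetween, mul_smul_comm, smul_mul_assoc, hf]

theorem arrow (a : Q.Arrow) : IsBetween (Q.src a) (Q.tgt a) (CPA.arrow K a) :=
  of_left_right (CPA.e_mul_arrow a) (CPA.arrow_mul_e a)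

theorem parallel {i j : V} {f : CPA Q K} (h : IsBetween i j f) {p : Path Q} (hp : f p ≠ 0) :
    p.start = i ∧ p.finish = j := by
  classical
  constructor
  · by_contra h1
    rw [← h.left, CPA.e_mul, if_neg h1] at hp
    exact hp rfl
  · by_contra h1
    rw [← h.right, CPA.mul_e] at hp
    exact hp (if_neg h1)

theorem map {Q' : QuiverOn.{u, v'} V} {F : Type*} [FunLike F (CPA Q K) (CPA Q' K)]
    [MulHomClass F (CPA Q K) (CPA Q' K)] (φ : F)
    (he : ∀ i, φ (CPA.e Q K i) = CPA.e Q' K i) {i j : V} {f : CPA Q K} (h : IsBetween i j f) :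
    IsBetween i j (φ f) := by
  rw [IsBetween, ← he, ← he, ← map_mul, ← map_mul, h]

end IsBetween

end Paths

/-! ### The filtration by powers of the arrow ideal -/

section Filtration

variable {V : Type u} (Q : QuiverOn.{u, v} V) {K : Type w} [CommRing K]

/-- The filtration of the completed path algebra by the powers of the ideal generated by the
arrows and an ideal `I` of `K`. The subtraction is truncated, so that there is no condition on the
coefficients at the paths of length at least `n`; for `I = ⊥` the coefficients at all shorter paths
vanish. -/
def filtration (I : Ideal K) (n : ℕ) : Submodule K (CPA Q K) where
  carrier := {f | ∀ p, f p ∈ I ^ (n - p.length)}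
  add_mem' hf hg p := add_mem (hf p) (hg p)
  zero_mem' _ := zero_mem _
  smul_mem' c _ hf p := Ideal.mul_mem_left _ c (hf p)

variable {Q}

theorem filtration_antitone (I : Ideal K) {m n : ℕ} (h : m ≤ n) :
    filtration Q I n ≤ filtration Q I m :=
  fun _ hf p => Ideal.pow_le_pow_right (by omega) (hf p)

theorem mem_filtration_zero (I : Ideal K) (f : CPA Q K) : f ∈ filtration Q I 0 := by
  intro p
  simp

theorem mul_mem_filtration {I : Ideal K} {m n : ℕ} {f g : CPA Q K} (hf : f ∈ filtration Q I m)
    (hg : g ∈ filtration Q I n) : f * g ∈ filtration Q I (m + n) := by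
  intro p
  rw [CPA.mul_apply]
  refine sum_mem fun k hk => ?_
  have h := Ideal.mul_mem_mul (hf (p.take k)) (hg (p.drop k))
  rw [← pow_add] at h
  refine Ideal.pow_le_pow_right ?_ h
  rw [Path.length_take, Path.length_drop]
  simp only [Finset.mem_range] at hk
  omega

theorem ofPath_mem_filtration (I : Ideal K) (p : Path Q) :
    CPA.ofPath K p ∈ filtration Q I p.length := by
  classical
  intro q
  rw [CPA.ofPath_apply]
  split_ifs with h
  · simp [h]
  · exact zero_mem _

theorem arrow_mem_filtration (I : Ideal K) (a : Q.Arrow) :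
    CPA.arrow K a ∈ filtration Q I 1 :=
  ofPath_mem_filtration I (Path.single Q a)

theorem prod_mem_filtration {S : Type*} {I : Ideal K} {x : S → CPA Q K}
    (hx : ∀ a, x a ∈ filtration Q I 1) (w : List S) :
    (w.map x).prod ∈ filtration Q I w.length := by
  induction w with
  | nil => exact mem_filtration_zero _ _
  | cons a w ih =>
    rw [List.map_cons, List.prod_cons, List.length_cons, add_comm]
    exact mul_mem_filtration (hx a) ih

/-- If `y s` lies ever deeper in the filtration given by a nilpotent ideal, then the sum of all
`y s` converges. -/
theorem finite_of_mem_filtration {S : Type*} {I : Ideal K} (hI : IsNilpotent I) (len : S → ℕ)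
    (hlen : ∀ n, {s | len s < n}.Finite) (y : S → CPA Q K)
    (hy : ∀ s, y s ∈ filtration Q I (len s - 1)) (q : Path Q) : {s | y s q ≠ 0}.Finite := by
  obtain ⟨m, hm⟩ := hI
  refine (hlen (q.length + m + 1)).subset fun s hs => ?_
  by_contra h
  simp only [Set.mem_ofPred_eq, not_lt] at h
  refine hs ?_
  have h1 := Ideal.pow_le_pow_right (show m ≤ len s - 1 - q.length by omega) (hy s q)
  rw [hm] at h1
  exact h1

/-- A family of elements of the completed path algebra whose constant coefficients generate a
nilpotent ideal. The arrows can be substituted by such a family. -/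
def IsTame {S : Type*} (x : S → CPA Q K) : Prop :=
  ∃ I : Ideal K, IsNilpotent I ∧ ∀ a, x a ∈ filtration Q I 1

end Filtration

/-! ### The universal property of the completed path algebra -/

section ArrowHom

variable {V : Type u} {R : QuiverOn.{u, v} V} {R' : QuiverOn.{u, v'} V} {K : Type w} [CommRing K]

/-- The product of the elements substituted for the arrows of a path. -/
noncomputable def pathProd (x : R.Arrow → CPA R' K) (p : Path R) : CPA R' K :=
  CPA.e R' K p.start * (p.word.map x).prod

theorem IsTame.finite_pathProd [Finite V] [Finite R.Arrow] {x : R.Arrow → CPA R' K}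
    (hx : IsTame x) (q : Path R') : {p | pathProd x p q ≠ 0}.Finite := by
  obtain ⟨I, hI, hx⟩ := hx
  refine finite_of_mem_filtration hI Path.length Path.finite_length_lt _ (fun p => ?_) q
  have := mul_mem_filtration (mem_filtration_zero I (CPA.e R' K p.start))
    (prod_mem_filtration hx p.word)
  refine filtration_antitone I ?_ this
  simp [Path.length]

theorem pathProd_cons {x : R.Arrow → CPA R' K} (hx : ∀ a, IsBetween (R.src a) (R.tgt a) (x a))
    (a : R.Arrow) (p : Path R) (h : p.start = R.tgt a) :
    pathProd x (Path.cons a p h) = x a * pathProd x p := by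
  simp only [pathProd, Path.cons, List.map_cons, List.prod_cons]
  rw [h, ← mul_assoc, ← mul_assoc, (hx a).left, (hx a).right]

theorem pathProd_nil (x : R.Arrow → CPA R' K) (i : V) :
    pathProd x (Path.nil R i) = CPA.e R' K i := by
  simp [pathProd, Path.nil]

theorem CPA.e_mul_ofPath_of_ne {i : V} {p : Path R} (h : p.start ≠ i) :
    CPA.e R K i * CPA.ofPath K p = 0 := by
  rw [← CPA.e_mul_ofPath_start, ← mul_assoc, CPA.e_mul_e_of_ne h.symm, zero_mul]

theorem e_mul_pathProd (x : R.Arrow → CPA R' K) (p : Path R) :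
    CPA.e R' K p.start * pathProd x p = pathProd x p := by
  rw [pathProd, ← mul_assoc, CPA.e_mul_e_self]

theorem e_mul_pathProd_of_ne (x : R.Arrow → CPA R' K) {i : V} {p : Path R} (h : p.start ≠ i) :
    CPA.e R' K i * pathProd x p = 0 := by
  rw [pathProd, ← mul_assoc, CPA.e_mul_e_of_ne h.symm, zero_mul]

/-- Continuous algebra homomorphisms that preserve the idempotents are determined by their values
on the arrows. -/
theorem algHom_eq_of_arrow {φ ψ : CPA R K →ₐ[K] CPA R' K} (hφ : Continuous φ) (hψ : Continuous ψ)
    (he : ∀ i, φ (CPA.e R K i) = ψ (CPA.e R K i))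
    (ha : ∀ a, φ (CPA.arrow K a) = ψ (CPA.arrow K a)) : φ = ψ := by
  refine AlgHom.ext fun f => ?_
  refine CPA.eq_of_eq_on_ofPath (U := φ.toLinearMap) (U' := ψ.toLinearMap) hφ hψ f fun p hp => ?_
  clear hp
  simp only [AlgHom.toLinearMap_apply]
  induction p using Path.cons_induction with
  | nil i => exact he i
  | cons a p h ih => rw [CPA.ofPath_cons, map_mul, map_mul, ha, ih]

theorem pathProd_eq_mul_e {x : R.Arrow → CPA R' K}
    (hx : ∀ a, IsBetween (R.src a) (R.tgt a) (x a)) (p : Path R) :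
    pathProd x p = (p.word.map x).prod * CPA.e R' K p.finish := by
  induction p using Path.cons_induction with
  | nil i => simp [pathProd, Path.nil, Path.finish, endOf]
  | cons a p h ih =>
    rw [pathProd_cons hx, ih, Path.finish_cons, ← mul_assoc]
    rfl

theorem map_ofPath_eq_pathProd {φ : CPA R K →ₐ[K] CPA R' K}
    (he : ∀ i, φ (CPA.e R K i) = CPA.e R' K i) (p : Path R) :
    φ (CPA.ofPath K p) = pathProd (fun a => φ (CPA.arrow K a)) p := by
  rw [CPA.ofPath_eq, map_mul, he, map_list_prod, List.map_map]
  rfl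

theorem CPA.ofPath_eq_mul_e (p : Path R) :
    CPA.ofPath K p = (p.word.map (CPA.arrow K)).prod * CPA.e R K p.finish :=
  (CPA.ofPath_eq p).trans (pathProd_eq_mul_e (fun a => IsBetween.arrow a) p)

variable [Fintype V] [Finite R.Arrow]

/-- The linear map underlying `arrowHom`. -/
noncomputable def arrowLinear (x : R.Arrow → CPA R' K) (hx : IsTame x) : CPA R K →ₗ[K] CPA R' K :=
  pathMap (pathProd x) hx.finite_pathProd

theorem arrowLinear_ofPath (x : R.Arrow → CPA R' K) (hx : IsTame x) (p : Path R) :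
    arrowLinear x hx (CPA.ofPath K p) = pathProd x p := pathMap_ofPath _ _ p

theorem arrowLinear_e (x : R.Arrow → CPA R' K) (hx : IsTame x) (i : V) :
    arrowLinear x hx (CPA.e R K i) = CPA.e R' K i :=
  (arrowLinear_ofPath x hx _).trans (pathProd_nil x i)

theorem arrowLinear_arrow {x : R.Arrow → CPA R' K} (hx : IsTame x)
    (hb : ∀ a, IsBetween (R.src a) (R.tgt a) (x a)) (a : R.Arrow) :
    arrowLinear x hx (CPA.arrow K a) = x a := by
  refine (arrowLinear_ofPath x hx _).trans ?_
  simp [pathProd, Path.single, (hb a).left]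

theorem continuous_arrowLinear (x : R.Arrow → CPA R' K) (hx : IsTame x) :
    Continuous (arrowLinear x hx) := continuous_pathMap _ _

theorem arrowLinear_e_mul {x : R.Arrow → CPA R' K} (hx : IsTame x) (i : V) (g : CPA R K) :
    arrowLinear x hx (CPA.e R K i * g) = CPA.e R' K i * arrowLinear x hx g := by
  have hc := continuous_arrowLinear x hx
  refine CPA.eq_of_eq_on_ofPath (U := arrowLinear x hx ∘ₗ LinearMap.mulLeft K (CPA.e R K i))
    (U' := LinearMap.mulLeft K (CPA.e R' K i) ∘ₗ arrowLinear x hx)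
    (hc.comp (continuous_const.mul continuous_id)) (continuous_const.mul hc) g fun p _ => ?_
  simp only [LinearMap.comp_apply, LinearMap.mulLeft_apply, arrowLinear_ofPath]
  by_cases h : p.start = i
  · subst h
    rw [CPA.e_mul_ofPath_start, arrowLinear_ofPath, e_mul_pathProd]
  · rw [CPA.e_mul_ofPath_of_ne h, e_mul_pathProd_of_ne x h, map_zero]

theorem arrowLinear_arrow_mul {x : R.Arrow → CPA R' K} (hx : IsTame x)
    (hb : ∀ a, IsBetween (R.src a) (R.tgt a) (x a)) (a : R.Arrow) (g : CPA R K) :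
    arrowLinear x hx (CPA.arrow K a * g) = x a * arrowLinear x hx g := by
  have hc := continuous_arrowLinear x hx
  refine CPA.eq_of_eq_on_ofPath (U := arrowLinear x hx ∘ₗ LinearMap.mulLeft K (CPA.arrow K a))
    (U' := LinearMap.mulLeft K (x a) ∘ₗ arrowLinear x hx)
    (hc.comp (continuous_const.mul continuous_id)) (continuous_const.mul hc) g fun p _ => ?_
  simp only [LinearMap.comp_apply, LinearMap.mulLeft_apply, arrowLinear_ofPath]
  by_cases h : p.start = R.tgt a
  · rw [← CPA.ofPath_cons a p h, arrowLinear_ofPath, pathProd_cons hb]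
  · rw [← CPA.arrow_mul_e, ← (hb a).right, mul_assoc, mul_assoc, CPA.e_mul_ofPath_of_ne h,
      e_mul_pathProd_of_ne x h, mul_zero, mul_zero, map_zero]

theorem arrowLinear_mul {x : R.Arrow → CPA R' K} (hx : IsTame x)
    (hb : ∀ a, IsBetween (R.src a) (R.tgt a) (x a)) (f g : CPA R K) :
    arrowLinear x hx (f * g) = arrowLinear x hx f * arrowLinear x hx g := by
  have hc := continuous_arrowLinear x hx
  refine CPA.eq_of_eq_on_ofPath (U := arrowLinear x hx ∘ₗ LinearMap.mulRight K g)
    (U' := LinearMap.mulRight K (arrowLinear x hx g) ∘ₗ arrowLinear x hx)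
    (hc.comp (continuous_id.mul continuous_const)) (hc.mul continuous_const) f fun p hp => ?_
  clear hp
  simp only [LinearMap.comp_apply, LinearMap.mulRight_apply, arrowLinear_ofPath]
  induction p using Path.cons_induction with
  | nil i => rw [pathProd_nil]; exact arrowLinear_e_mul hx i g
  | cons a p h ih =>
    rw [CPA.ofPath_cons, pathProd_cons hb, mul_assoc, arrowLinear_arrow_mul hx hb, ih, mul_assoc]

/-- The universal property of the completed path algebra: the continuous algebra homomorphism that
preserves the idempotents and sends an arrow `a` to `x a`. -/
noncomputable def arrowHom (x : R.Arrow → CPA R' K) (hx : IsTame x)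
    (hb : ∀ a, IsBetween (R.src a) (R.tgt a) (x a)) : CPA R K →ₐ[K] CPA R' K :=
  AlgHom.ofLinearMap (arrowLinear x hx)
    (by simp only [← CPA.sum_e, map_sum, arrowLinear_e]) (arrowLinear_mul hx hb)

theorem continuous_arrowHom (x : R.Arrow → CPA R' K) (hx : IsTame x)
    (hb : ∀ a, IsBetween (R.src a) (R.tgt a) (x a)) : Continuous (arrowHom x hx hb) :=
  continuous_arrowLinear x hx

theorem arrowHom_ofPath (x : R.Arrow → CPA R' K) (hx : IsTame x)
    (hb : ∀ a, IsBetween (R.src a) (R.tgt a) (x a)) (p : Path R) :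
    arrowHom x hx hb (CPA.ofPath K p) = pathProd x p :=
  arrowLinear_ofPath x hx p

theorem arrowHom_e (x : R.Arrow → CPA R' K) (hx : IsTame x)
    (hb : ∀ a, IsBetween (R.src a) (R.tgt a) (x a)) (i : V) :
    arrowHom x hx hb (CPA.e R K i) = CPA.e R' K i :=
  arrowLinear_e x hx i

theorem arrowHom_arrow (x : R.Arrow → CPA R' K) (hx : IsTame x)
    (hb : ∀ a, IsBetween (R.src a) (R.tgt a) (x a)) (a : R.Arrow) :
    arrowHom x hx hb (CPA.arrow K a) = x a :=
  arrowLinear_arrow hx hb a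

end ArrowHom

/-! ### Continuity of inverse isomorphisms -/

section AutomaticContinuity

variable {V : Type u} {Q : QuiverOn.{u, v} V} {Q' : QuiverOn.{u, v'} V} {K : Type w} [CommRing K]

variable (Q K) in
/-- The coefficient at the trivial path `e_i`, as an algebra homomorphism. -/
noncomputable def constCoeff (i : V) : CPA Q K →ₐ[K] K :=
  AlgHom.ofLinearMap (LinearMap.proj (Path.nil Q i) ∘ₗ (CPA.toPi Q K).toLinearMap)
    (by change (1 : CPA Q K) (Path.nil Q i) = 1; rw [CPA.one_apply]; rfl)
    (fun f g => by
      change (f * g) (Path.nil Q i) = f (Path.nil Q i) * g (Path.nil Q i)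
      rw [CPA.mul_apply]
      simp [Path.length, Path.nil, Path.take, Path.drop, endOf])

theorem constCoeff_apply (i : V) (f : CPA Q K) : constCoeff Q K i f = f (Path.nil Q i) := rfl

theorem constCoeff_arrow (i : V) (a : Q.Arrow) : constCoeff Q K i (CPA.arrow K a) = 0 := by
  classical
  rw [constCoeff_apply, CPA.arrow, CPA.ofPath_apply, if_neg]
  intro h
  simpa [Path.nil, Path.single] using congrArg Path.word h

theorem mem_filtration_one {I : Ideal K} {f : CPA Q K} (h : ∀ i, constCoeff Q K i f ∈ I) :
    f ∈ filtration Q I 1 := by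
  intro p
  by_cases hp : p.length = 0
  · have : p = Path.nil Q p.start := by
      ext1
      · rfl
      · exact List.length_eq_zero_iff.mp hp
    rw [hp, this, tsub_zero, pow_one]
    exact h p.start
  · simp [show 1 - p.length = 0 by omega]

theorem tendsto_arrow_pow (a : Q.Arrow) :
    Filter.Tendsto (fun n => (CPA.arrow K a) ^ n) Filter.atTop (nhds (0 : CPA Q K)) := by
  let : TopologicalSpace K := ⊥
  have : DiscreteTopology K := ⟨rfl⟩
  have h0 : Topology.IsInducing (CPA.toPi Q K) := ⟨rfl⟩
  rw [h0.tendsto_nhds_iff, tendsto_pi_nhds]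
  intro p
  refine tendsto_const_nhds.congr' ?_
  filter_upwards [Filter.eventually_gt_atTop p.length] with n hn
  have h1 : ∀ n, (CPA.arrow K a) ^ n ∈ filtration Q (⊥ : Ideal K) n := by
    intro n
    simpa using prod_mem_filtration (arrow_mem_filtration (⊥ : Ideal K)) (List.replicate n a)
  have h2 := h1 n p
  rw [← Ideal.zero_eq_bot, zero_pow (by omega)] at h2
  exact (Ideal.mem_bot.mp h2).symm

/-- The constant coefficients of the image of an arrow under a continuous homomorphism are
nilpotent, because the powers of the arrow converge to zero. -/
theorem isNilpotent_constCoeff {φ : CPA Q K →ₐ[K] CPA Q' K} (hφ : Continuous φ) (a : Q.Arrow)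
    (i : V) : IsNilpotent (constCoeff Q' K i (φ (CPA.arrow K a))) := by
  let : TopologicalSpace K := ⊥
  have : DiscreteTopology K := ⟨rfl⟩
  have hc : Continuous fun f => constCoeff Q' K i (φ f) := (CPA.continuous_apply _).comp hφ
  have h1 := (hc.tendsto 0).comp (tendsto_arrow_pow (K := K) a)
  rw [map_zero, map_zero, nhds_discrete K, Filter.tendsto_pure] at h1
  obtain ⟨n, hn⟩ := h1.exists
  exact ⟨n, by simpa using hn⟩

theorem exists_isNilpotent_ideal [Finite V] [Finite Q.Arrow] {φ : CPA Q K →ₐ[K] CPA Q' K}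
    (hφ : Continuous φ) : ∃ I : Ideal K, IsNilpotent I ∧
      ∀ a i, constCoeff Q' K i (φ (CPA.arrow K a)) ∈ I := by
  let g : Q.Arrow × V → K := fun x => constCoeff Q' K x.2 (φ (CPA.arrow K x.1))
  refine ⟨Ideal.span (Set.range g), ?_, fun a i => Ideal.subset_span ⟨(a, i), rfl⟩⟩
  have hfg : (Ideal.span (Set.range g)).FG := Submodule.fg_span (Set.finite_range g)
  rw [hfg.isNilpotent_iff_le_nilradical, Ideal.span_le]
  rintro _ ⟨x, rfl⟩
  exact isNilpotent_constCoeff hφ x.1 x.2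

theorem isTame_of_continuous [Finite V] [Finite Q.Arrow] {φ : CPA Q K →ₐ[K] CPA Q' K}
    (hφ : Continuous φ) : IsTame fun a => φ (CPA.arrow K a) := by
  obtain ⟨I, hI, h⟩ := exists_isNilpotent_ideal hφ
  exact ⟨I, hI, fun a => mem_filtration_one (h a)⟩

theorem constCoeff_map_sub_mem {φ : CPA Q K →ₐ[K] CPA Q' K} (hφ : Continuous φ)
    (he : ∀ i, φ (CPA.e Q K i) = CPA.e Q' K i) {I : Ideal K}
    (hI : ∀ a i, constCoeff Q' K i (φ (CPA.arrow K a)) ∈ I) (i : V) (f : CPA Q K) :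
    constCoeff Q' K i (φ f) - constCoeff Q K i f ∈ I := by
  classical
  let : TopologicalSpace K := ⊥
  have : DiscreteTopology K := ⟨rfl⟩
  have hc : Continuous fun f => constCoeff Q' K i (φ f) := (CPA.continuous_apply _).comp hφ
  have hc' : Continuous fun f => constCoeff Q K i f := CPA.continuous_apply _
  have h1 := (CPA.hasSum_ofPath f).map
    ((constCoeff Q' K i).toLinearMap ∘ₗ φ.toLinearMap - (constCoeff Q K i).toLinearMap)
    (hc.sub hc')
  have hcl : IsClosed (I : Set K) := isClosed_discrete _
  refine hcl.mem_of_tendsto h1 (Filter.Eventually.of_forall fun s => sum_mem fun p hp => ?_)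
  clear hp
  simp only [Function.comp_apply, map_smul]
  refine Ideal.mul_mem_left _ _ ?_
  change constCoeff Q' K i (φ (CPA.ofPath K p)) - constCoeff Q K i (CPA.ofPath K p) ∈ I
  induction p using Path.cons_induction with
  | nil j =>
    have h2 : φ (CPA.ofPath K (Path.nil Q j)) = CPA.e Q' K j := he j
    rw [h2, constCoeff_apply, constCoeff_apply, CPA.e, CPA.ofPath_apply, CPA.ofPath_apply]
    simp only [Path.ext_iff, Path.nil, and_true, sub_self, zero_mem]
  | cons a p h ih =>
    rw [CPA.ofPath_cons, map_mul, map_mul, map_mul, constCoeff_arrow, zero_mul, sub_zero]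
    exact Ideal.mul_mem_right _ _ (hI a i)

/-- An element without constant coefficients is a combination of the arrows. -/
theorem exists_eq_sum_arrow_mul [Fintype Q.Arrow] {n : ℕ} {f : CPA Q K}
    (hf : f ∈ filtration Q (⊥ : Ideal K) (n + 1)) :
    ∃ g : Q.Arrow → CPA Q K, (∀ a, g a ∈ filtration Q (⊥ : Ideal K) n) ∧
      f = ∑ a, CPA.arrow K a * g a := by
  classical
  refine ⟨fun a => ⟨fun p => f.coeff (Q.src a) (a :: p.word)⟩, fun a p => ?_, ?_⟩
  · change f.coeff (Q.src a) (a :: p.word) ∈ _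
    unfold CPA.coeff
    split_ifs with h
    · have := hf ⟨_, _, h⟩
      simpa [Path.length] using this
    · exact zero_mem _
  · ext p
    rw [CPA.sum_apply]
    simp only [CPA.arrow_mul_apply]
    obtain ⟨i, x, hx⟩ := p
    rcases x with _ | ⟨b, x⟩
    · have := hf ⟨i, [], hx⟩
      rw [← Ideal.zero_eq_bot, zero_pow (by simp [Path.length])] at this
      simpa using this
    · have h2 := hx
      obtain ⟨rfl, h3⟩ := hx
      rw [Finset.sum_eq_single b]
      · simp only [List.head?_cons, if_true]
        change _ = f.coeff (Q.src b) (b :: x)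
        rw [CPA.coeff, dif_pos h2]
      · intro c _ hc
        simp [hc.symm]
      · simp

theorem map_mem_filtration [Fintype Q.Arrow] {φ : CPA Q K →ₐ[K] CPA Q' K} {I : Ideal K}
    (hI : ∀ a, φ (CPA.arrow K a) ∈ filtration Q' I 1) {n : ℕ} {f : CPA Q K}
    (hf : f ∈ filtration Q (⊥ : Ideal K) n) : φ f ∈ filtration Q' I n := by
  induction n generalizing f with
  | zero => exact mem_filtration_zero _ _
  | succ n ih =>
    obtain ⟨g, hg, rfl⟩ := exists_eq_sum_arrow_mul hf
    rw [map_sum]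
    refine sum_mem fun a _ => ?_
    rw [map_mul, add_comm]
    exact mul_mem_filtration (hI a) (ih (hg a))

theorem eventually_mem_filtration [Finite V] [Finite Q.Arrow] (n : ℕ) :
    ∀ᶠ f in nhds (0 : CPA Q K), f ∈ filtration Q (⊥ : Ideal K) n := by
  let : TopologicalSpace K := ⊥
  have : DiscreteTopology K := ⟨rfl⟩
  have h1 : ∀ p ∈ {p : Path Q | p.length < n}, ∀ᶠ f in nhds (0 : CPA Q K), f p = 0 := by
    intro p _
    have := ((CPA.continuous_apply p).tendsto (0 : CPA Q K))
    rw [nhds_discrete K, Filter.tendsto_pure] at this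
    exact this
  filter_upwards [(Filter.eventually_all_finite (Path.finite_length_lt n)).mpr h1] with f hf p
  by_cases hp : p.length < n
  · rw [hf p hp]
    exact zero_mem _
  · simp [show n - p.length = 0 by omega]

theorem continuous_of_mem_filtration [Finite V] [Fintype Q.Arrow] {φ : CPA Q K →ₐ[K] CPA Q' K}
    {I : Ideal K} (hn : IsNilpotent I) (hI : ∀ a, φ (CPA.arrow K a) ∈ filtration Q' I 1) :
    Continuous φ := by
  let : TopologicalSpace K := ⊥
  have : DiscreteTopology K := ⟨rfl⟩
  refine CPA.continuous_iff.mpr fun q => ?_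
  obtain ⟨m, hm⟩ := hn
  refine continuous_of_continuousAt_zero
    ((LinearMap.proj q ∘ₗ (CPA.toPi Q' K).toLinearMap ∘ₗ φ.toLinearMap).toAddMonoidHom) ?_
  rw [ContinuousAt, map_zero, nhds_discrete K, Filter.tendsto_pure]
  filter_upwards [eventually_mem_filtration (q.length + m)] with f hf
  have h1 := map_mem_filtration hI hf q
  rw [Nat.add_sub_cancel_left, hm] at h1
  exact h1

/-- The inverse of a continuous isomorphism is continuous. For continuous linear bijections this
fails over some rings `K`; here it holds because the inverse sends the arrows to elements whose
constant coefficients generate a nilpotent ideal. -/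
theorem continuous_symm [Finite V] [Fintype Q.Arrow] [Fintype Q'.Arrow]
    (φ : CPA Q K ≃ₐ[K] CPA Q' K) (hφ : Continuous φ)
    (he : ∀ i, φ (CPA.e Q K i) = CPA.e Q' K i) : Continuous φ.symm := by
  obtain ⟨I, hI, h⟩ := exists_isNilpotent_ideal (φ := (φ : CPA Q K →ₐ[K] CPA Q' K)) hφ
  refine continuous_of_mem_filtration (φ := (φ.symm : CPA Q' K →ₐ[K] CPA Q K)) hI fun b =>
    mem_filtration_one fun i => ?_
  -- modulo `I` the isomorphism does not change constant coefficients, and those of `b` vanish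
  have h1 := constCoeff_map_sub_mem (φ := (φ : CPA Q K →ₐ[K] CPA Q' K)) hφ he h i
    (φ.symm (CPA.arrow K b))
  have h2 : (φ : CPA Q K →ₐ[K] CPA Q' K) (φ.symm (CPA.arrow K b)) = CPA.arrow K b :=
    φ.apply_symm_apply _
  rw [h2, constCoeff_arrow, zero_sub] at h1
  exact neg_mem_iff.mp h1

end AutomaticContinuity

/-! ### Cyclic derivatives -/

section CyclicDerivative

variable {V : Type u} {R : QuiverOn.{u, v} V} {R' : QuiverOn.{u, v'} V} {K : Type w} [CommRing K]

open Classical in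
/-- The cyclic derivative of a word with respect to the arrow `b`, with `m` inserted: the sum of
`x(v) * m * x(u)` over all factorizations `u b v` of the word. -/
noncomputable def wordDeriv (x : R.Arrow → CPA R' K) (b : R.Arrow) :
    List R.Arrow → CPA R' K →ₗ[K] CPA R' K
  | [] => 0
  | a :: w => (if a = b then LinearMap.mulLeft K (w.map x).prod else 0) +
      wordDeriv x b w ∘ₗ LinearMap.mulRight K (x a)

theorem wordDeriv_nil (x : R.Arrow → CPA R' K) (b : R.Arrow) (m : CPA R' K) :
    wordDeriv x b [] m = 0 := rfl

open Classical in
theorem wordDeriv_cons (x : R.Arrow → CPA R' K) (b a : R.Arrow) (w : List R.Arrow)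
    (m : CPA R' K) : wordDeriv x b (a :: w) m =
      (if a = b then (w.map x).prod * m else 0) + wordDeriv x b w (m * x a) := by
  rw [wordDeriv]
  split_ifs <;> simp

theorem continuous_wordDeriv (x : R.Arrow → CPA R' K) (b : R.Arrow) (w : List R.Arrow) :
    Continuous (wordDeriv x b w) := by
  classical
  induction w with
  | nil => exact continuous_const
  | cons a w ih =>
    have h : Continuous fun m => (if a = b then (w.map x).prod * m else 0) +
        wordDeriv x b w (m * x a) := by
      refine Continuous.add ?_ (ih.comp (continuous_id.mul continuous_const))
      split_ifs
      · exact continuous_const.mul continuous_id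
      · exact continuous_const
    exact h.congr fun m => (wordDeriv_cons x b a w m).symm

/-- Expansion of the commutator with a product into commutators with the factors. -/
theorem sum_commutator_wordDeriv [Fintype R.Arrow] (x : R.Arrow → CPA R' K) (w : List R.Arrow)
    (m : CPA R' K) : ∑ b, (x b * wordDeriv x b w m - wordDeriv x b w m * x b) =
      (w.map x).prod * m - m * (w.map x).prod := by
  classical
  induction w generalizing m with
  | nil => simp [wordDeriv_nil]
  | cons a w ih =>
    have h1 (b : R.Arrow) : x b * wordDeriv x b (a :: w) m - wordDeriv x b (a :: w) m * x b =
        (if a = b then x a * ((w.map x).prod * m) - (w.map x).prod * m * x a else 0) +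
        (x b * wordDeriv x b w (m * x a) - wordDeriv x b w (m * x a) * x b) := by
      rw [wordDeriv_cons]
      by_cases h : a = b
      · subst h
        simp only [if_true]
        noncomm_ring
      · simp [h]
    simp only [h1, Finset.sum_add_distrib, ih, Finset.sum_ite_eq, Finset.mem_univ, if_true,
      List.map_cons, List.prod_cons]
    noncomm_ring

theorem wordDeriv_append (x : R.Arrow → CPA R' K) (b : R.Arrow) (w w' : List R.Arrow)
    (m : CPA R' K) : wordDeriv x b (w ++ w') m =
      wordDeriv x b w ((w'.map x).prod * m) + wordDeriv x b w' (m * (w.map x).prod) := by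
  classical
  induction w generalizing m with
  | nil => simp [wordDeriv_nil]
  | cons a w ih =>
    rw [List.cons_append, wordDeriv_cons, wordDeriv_cons, ih]
    simp only [List.map_append, List.prod_append, List.map_cons, List.prod_cons, mul_assoc,
      add_assoc]

theorem wordDeriv_mem_filtration {x : R.Arrow → CPA R' K} {I : Ideal K}
    (hx : ∀ a, x a ∈ filtration R' I 1) (b : R.Arrow) (w : List R.Arrow) {n : ℕ} {m : CPA R' K}
    (hm : m ∈ filtration R' I n) : wordDeriv x b w m ∈ filtration R' I (n + w.length - 1) := by
  classical
  induction w generalizing n m with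
  | nil => exact zero_mem _
  | cons a w ih =>
    rw [wordDeriv_cons]
    refine add_mem ?_ ?_
    · split_ifs
      · refine filtration_antitone I ?_ (mul_mem_filtration (prod_mem_filtration hx w) hm)
        simp only [List.length_cons]
        omega
      · exact zero_mem _
    · refine filtration_antitone I ?_ (ih (mul_mem_filtration hm (hx a)))
      simp only [List.length_cons]
      omega

theorem map_wordDeriv {R'' : QuiverOn.{u, v''} V} (φ : CPA R' K →ₐ[K] CPA R'' K)
    (x : R.Arrow → CPA R' K) (b : R.Arrow) (w : List R.Arrow) (m : CPA R' K) :
    φ (wordDeriv x b w m) = wordDeriv (fun a => φ (x a)) b w (φ m) := by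
  classical
  induction w generalizing m with
  | nil => simp [wordDeriv_nil]
  | cons a w ih =>
    rw [wordDeriv_cons, wordDeriv_cons, map_add, ih, map_mul]
    congr 1
    split_ifs
    · rw [map_mul, map_list_prod, List.map_map]
      rfl
    · exact map_zero φ

/-- The cyclic derivative of a path with respect to the arrow `b`, with `m` inserted: the sum of
`x(v) * m * x(u)` over all factorizations `u b v` of the path, where only the part of `m` that can
be composed with `v` and `u` contributes. -/
noncomputable def pathDeriv (x : R.Arrow → CPA R' K) (b : R.Arrow) (m : CPA R' K) (p : Path R) :
    CPA R' K :=
  wordDeriv x b p.word (CPA.e R' K p.finish * m * CPA.e R' K p.start)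

theorem pathDeriv_of_isBetween (x : R.Arrow → CPA R' K) (b : R.Arrow) {m : CPA R' K} {p : Path R}
    (hm : IsBetween p.finish p.start m) : pathDeriv x b m p = wordDeriv x b p.word m := by
  rw [pathDeriv, hm]

theorem isBetween_pathDeriv {x : R.Arrow → CPA R' K}
    (hx : ∀ a, IsBetween (R.src a) (R.tgt a) (x a)) (b : R.Arrow) (m : CPA R' K) (p : Path R) :
    IsBetween (R.tgt b) (R.src b) (pathDeriv x b m p) := by
  classical
  suffices H : ∀ m, IsBetween p.finish p.start m →
      IsBetween (R.tgt b) (R.src b) (wordDeriv x b p.word m) by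
    refine H _ (IsBetween.of_left_right ?_ ?_)
    · rw [← mul_assoc, ← mul_assoc, CPA.e_mul_e_self]
    · rw [mul_assoc, CPA.e_mul_e_self]
  induction p using Path.cons_induction with
  | nil i =>
    intro m _
    simp [Path.nil, wordDeriv_nil, IsBetween]
  | cons a p h ih =>
    intro m hm
    rw [Path.finish_cons] at hm
    have hm' : IsBetween p.finish (R.src a) m := hm
    change IsBetween _ _ (wordDeriv x b (a :: p.word) m)
    rw [wordDeriv_cons]
    refine IsBetween.add ?_ (ih _ (h ▸ hm'.mul (hx a)))
    split_ifs with hab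
    · subst hab
      have h1 : (p.word.map x).prod * m = pathProd x p * m := by
        rw [pathProd_eq_mul_e hx, mul_assoc, hm'.left]
      rw [h1]
      refine IsBetween.of_left_right ?_ ?_
      · rw [← mul_assoc, ← h, e_mul_pathProd]
      · rw [mul_assoc, hm'.right]
    · simp [IsBetween]

theorem e_mul_mul_e_mem_filtration {I : Ideal K} {n : ℕ} {m : CPA R' K}
    (hm : m ∈ filtration R' I n) (i j : V) :
    CPA.e R' K i * m * CPA.e R' K j ∈ filtration R' I n := by
  have := mul_mem_filtration (mul_mem_filtration (mem_filtration_zero I (CPA.e R' K i)) hm)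
    (mem_filtration_zero I (CPA.e R' K j))
  simpa using this

theorem pathDeriv_mem_filtration {x : R.Arrow → CPA R' K} {I : Ideal K}
    (hx : ∀ a, x a ∈ filtration R' I 1) (b : R.Arrow) {n : ℕ} {m : CPA R' K}
    (hm : m ∈ filtration R' I n) (p : Path R) :
    pathDeriv x b m p ∈ filtration R' I (n + p.length - 1) :=
  wordDeriv_mem_filtration hx b p.word (e_mul_mul_e_mem_filtration hm _ _)

theorem IsTame.finite_pathDeriv [Finite V] [Finite R.Arrow] {x : R.Arrow → CPA R' K}
    (hx : IsTame x) (b : R.Arrow) (m : CPA R' K) (q : Path R') :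
    {p | pathDeriv x b m p q ≠ 0}.Finite := by
  obtain ⟨I, hI, hx⟩ := hx
  refine finite_of_mem_filtration hI Path.length Path.finite_length_lt _ (fun p => ?_) q
  simpa using pathDeriv_mem_filtration hx b (mem_filtration_zero I m) p

variable [Fintype V] [Finite R.Arrow]

/-- The cyclic derivative with respect to the arrow `b`, with `m` inserted, as a continuous linear
map on the completed path algebra. -/
noncomputable def cyclicDeriv (x : R.Arrow → CPA R' K) (hx : IsTame x) (b : R.Arrow)
    (m : CPA R' K) : CPA R K →ₗ[K] CPA R' K :=
  pathMap (pathDeriv x b m) (hx.finite_pathDeriv b m)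

theorem cyclicDeriv_ofPath (x : R.Arrow → CPA R' K) (hx : IsTame x) (b : R.Arrow)
    (m : CPA R' K) (p : Path R) : cyclicDeriv x hx b m (CPA.ofPath K p) = pathDeriv x b m p :=
  pathMap_ofPath _ _ p

theorem continuous_cyclicDeriv (x : R.Arrow → CPA R' K) (hx : IsTame x) (b : R.Arrow)
    (m : CPA R' K) : Continuous (cyclicDeriv x hx b m) := continuous_pathMap _ _

theorem isBetween_cyclicDeriv {x : R.Arrow → CPA R' K} (hx : IsTame x)
    (hb : ∀ a, IsBetween (R.src a) (R.tgt a) (x a)) (b : R.Arrow) (m : CPA R' K) (f : CPA R K) :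
    IsBetween (R.tgt b) (R.src b) (cyclicDeriv x hx b m f) := by
  have hc := continuous_cyclicDeriv x hx b m
  refine CPA.eq_of_eq_on_ofPath (U := LinearMap.mulRight K (CPA.e R' K (R.src b)) ∘ₗ
    LinearMap.mulLeft K (CPA.e R' K (R.tgt b)) ∘ₗ cyclicDeriv x hx b m)
    (U' := cyclicDeriv x hx b m)
    ((continuous_const.mul hc).mul continuous_const) hc f fun p _ => ?_
  simp only [LinearMap.comp_apply, LinearMap.mulRight_apply, LinearMap.mulLeft_apply,
    cyclicDeriv_ofPath]
  exact isBetween_pathDeriv hb b m p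

/-- The commutator with the image of `f` is expanded into commutators with the images of the
arrows, whose other entries are the cyclic derivatives of `f`. -/
theorem sum_commutator_cyclicDeriv [Fintype R.Arrow] {φ : CPA R K →ₐ[K] CPA R' K}
    (hφ : Continuous φ) (he : ∀ i, φ (CPA.e R K i) = CPA.e R' K i)
    (hx : IsTame fun a => φ (CPA.arrow K a)) {i j : V} {f : CPA R K} (hf : IsBetween i j f)
    {m : CPA R' K} (hm : IsBetween j i m) :
    ∑ b, (φ (CPA.arrow K b) * cyclicDeriv _ hx b m f - cyclicDeriv _ hx b m f * φ (CPA.arrow K b))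
      = φ f * m - m * φ f := by
  have hc (b : R.Arrow) := continuous_cyclicDeriv _ hx b m
  have h := CPA.eq_of_eq_on_ofPath
    (U := ∑ b, (LinearMap.mulLeft K (φ (CPA.arrow K b)) ∘ₗ cyclicDeriv _ hx b m -
      LinearMap.mulRight K (φ (CPA.arrow K b)) ∘ₗ cyclicDeriv _ hx b m))
    (U' := LinearMap.mulRight K m ∘ₗ φ.toLinearMap - LinearMap.mulLeft K m ∘ₗ φ.toLinearMap)
    ?_ ((hφ.mul continuous_const).sub (continuous_const.mul hφ)) f fun p hp => ?_
  · simpa [LinearMap.sum_apply] using h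
  · have : Continuous fun f => ∑ b, (φ (CPA.arrow K b) * cyclicDeriv _ hx b m f -
        cyclicDeriv _ hx b m f * φ (CPA.arrow K b)) :=
      continuous_finsetSum _ fun b _ =>
        (continuous_const.mul (hc b)).sub ((hc b).mul continuous_const)
    refine this.congr fun f => ?_
    simp [LinearMap.sum_apply]
  · obtain ⟨rfl, rfl⟩ := hf.parallel hp
    have hb (a : R.Arrow) := (IsBetween.arrow (K := K) a).map φ he
    simp only [LinearMap.sum_apply, LinearMap.sub_apply, LinearMap.comp_apply,
      LinearMap.mulRight_apply, LinearMap.mulLeft_apply, cyclicDeriv_ofPath,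
      AlgHom.toLinearMap_apply, pathDeriv_of_isBetween _ _ hm]
    rw [sum_commutator_wordDeriv, map_ofPath_eq_pathProd he]
    congr 1
    · rw [pathProd_eq_mul_e hb, mul_assoc, hm.left]
    · rw [pathProd, ← mul_assoc, hm.right]

end CyclicDerivative

/-! ### First Hochschild homology and the small complex -/

section HochschildHomology

variable {V : Type u} {Q : QuiverOn.{u, v} V} {Q' : QuiverOn.{u, v'} V} {K : Type w} [CommRing K]

variable (Q K) in
/-- The tensor product of elements, as a bilinear map. -/
noncomputable def tmulBilin : CPA Q K →ₗ[K] CPA Q K →ₗ[K] (Path Q × Path Q → K) :=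
  LinearMap.mk₂ K tmul
    (fun f f' g => by funext x; simp [tmul, CPA.add_apply, add_mul])
    (fun c f g => by funext x; simp [tmul, CPA.smul_apply, mul_assoc])
    (fun f g g' => by funext x; simp [tmul, CPA.add_apply, mul_add])
    (fun c f g => by funext x; simp [tmul, CPA.smul_apply, mul_left_comm])

theorem tmulBilin_apply (f g : CPA Q K) : tmulBilin Q K f g = tmul f g := rfl

theorem tmul_ofPath (p q : Path Q) :
    tmul (CPA.ofPath K p) (CPA.ofPath K q) = basisVec K (p, q) := by
  funext ⟨x, y⟩
  simp only [tmul, CPA.ofPath_apply, basisVec_apply, Prod.mk.injEq]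
  split_ifs <;> simp_all

/-- The element `f ⊗ g ⊗ h` of the completed tensor product `A ⊗ A ⊗ A`. -/
def tmul₃ (f g h : CPA Q K) : Path Q × Path Q × Path Q → K :=
  fun x => f x.1 * (g x.2.1 * h x.2.2)

theorem tmul₃_ofPath (p q r : Path Q) :
    tmul₃ (CPA.ofPath K p) (CPA.ofPath K q) (CPA.ofPath K r) = basisVec K (p, q, r) := by
  funext ⟨x, y, z⟩
  simp only [tmul₃, CPA.ofPath_apply, basisVec_apply, Prod.mk.injEq]
  split_ifs <;> simp_all

theorem hochschildD_tmul₃ (f g h : CPA Q K) :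
    hochschildD Q K (tmul₃ f g h) = tmul (f * g) h - tmul f (g * h) + tmul (h * f) g := by
  funext ⟨x, y⟩
  simp only [hochschildD, LinearMap.coe_mk, AddHom.coe_mk, tmul₃, tmul, Pi.add_apply,
    Pi.sub_apply, CPA.mul_apply, Finset.sum_mul, Finset.mul_sum]
  congr 1
  · congr 1
    exact Finset.sum_congr rfl fun k _ => by ring
  · exact Finset.sum_congr rfl fun k _ => by ring

theorem continuous_hochschildD [TopologicalSpace K] [DiscreteTopology K] :
    Continuous (hochschildD Q K) := by
  refine continuous_pi fun x => ?_
  refine Continuous.add (Continuous.sub ?_ ?_) ?_ <;>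
    exact continuous_finsetSum _ fun k _ => continuous_apply _

theorem continuous_tmul_left [TopologicalSpace K] [DiscreteTopology K] (g : CPA Q K) :
    Continuous fun f => tmul f g :=
  continuous_pi fun x => (CPA.continuous_apply x.1).mul continuous_const

theorem continuous_tmul_right [TopologicalSpace K] [DiscreteTopology K] (f : CPA Q K) :
    Continuous fun g => tmul f g :=
  continuous_pi fun x => continuous_const.mul (CPA.continuous_apply x.2)

/-- The concatenation of two paths. -/
def Path.comp (p q : Path Q) (h : p.finish = q.start) : Path Q :=
  ⟨p.start, p.word ++ q.word, by
    rw [isPath_append]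
    exact ⟨p.isPath, (show Q.endOf p.start p.word = q.start from h) ▸ q.isPath⟩⟩

theorem Path.finish_comp (p q : Path Q) (h : p.finish = q.start) :
    (Path.comp p q h).finish = q.finish := by
  change Q.endOf p.start (p.word ++ q.word) = q.finish
  rw [endOf_append, show Q.endOf p.start p.word = q.start from h]
  rfl

theorem CPA.ofPath_comp (p q : Path Q) (h : p.finish = q.start) :
    CPA.ofPath K (Path.comp p q h) = CPA.ofPath K p * CPA.ofPath K q := by
  rw [CPA.ofPath_eq q, ← h, ← mul_assoc, CPA.ofPath_mul_e_finish, CPA.ofPath_eq, CPA.ofPath_eq p,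
    mul_assoc, ← List.prod_append, ← List.map_append]
  rfl

theorem CPA.ofPath_mul_ofPath_of_ne {p q : Path Q} (h : p.finish ≠ q.start) :
    CPA.ofPath K p * CPA.ofPath K q = 0 := by
  rw [← CPA.ofPath_mul_e_finish, mul_assoc, CPA.e_mul_ofPath_of_ne h.symm, mul_zero]

theorem CPA.ofPath_mul_e_of_ne {p : Path Q} {i : V} (h : p.finish ≠ i) :
    CPA.ofPath K p * CPA.e Q K i = 0 :=
  CPA.ofPath_mul_ofPath_of_ne (q := Path.nil Q i) h

theorem continuous_pathDeriv {R' : QuiverOn.{u, v'} V} (x : Q.Arrow → CPA R' K) (b : Q.Arrow)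
    (p : Path Q) : Continuous fun m => pathDeriv x b m p :=
  (continuous_wordDeriv x b p.word).comp
    ((continuous_const.mul continuous_id).mul continuous_const)

/-- The cyclic derivative of a path, as a linear map in the inserted element. -/
noncomputable def pathDerivLinear {R' : QuiverOn.{u, v'} V} (x : Q.Arrow → CPA R' K)
    (b : Q.Arrow) (p : Path Q) : CPA R' K →ₗ[K] CPA R' K :=
  wordDeriv x b p.word ∘ₗ LinearMap.mulRight K (CPA.e R' K p.start) ∘ₗ
    LinearMap.mulLeft K (CPA.e R' K p.finish)

/-- The part of the contracting homotopy that involves the word `w`, preceded by `u`: the sum of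
`v m ⊗ u u' ⊗ b` over all factorizations `u' b v` of `w`. -/
noncomputable def wordHomotopy (m : CPA Q K) : CPA Q K → List Q.Arrow → Path Q × Path Q × Path Q → K
  | _, [] => 0
  | u, a :: w => tmul₃ ((w.map (CPA.arrow K)).prod * m) u (CPA.arrow K a) +
      wordHomotopy m (u * CPA.arrow K a) w

theorem hochschildD_wordHomotopy [Fintype Q.Arrow] (m u : CPA Q K) (w : List Q.Arrow) :
    hochschildD Q K (wordHomotopy m u w) =
      ∑ b, tmul (wordDeriv (CPA.arrow K) b w (m * u)) (CPA.arrow K b)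
        - tmul m (u * (w.map (CPA.arrow K)).prod) + tmul ((w.map (CPA.arrow K)).prod * m) u := by
  classical
  induction w generalizing u with
  | nil => simp [wordHomotopy, wordDeriv_nil, ← tmulBilin_apply]
  | cons a w ih =>
    have h1 (b : Q.Arrow) : tmul (wordDeriv (CPA.arrow K) b (a :: w) (m * u)) (CPA.arrow K b) =
        (if a = b then tmul ((w.map (CPA.arrow K)).prod * (m * u)) (CPA.arrow K a) else 0) +
        tmul (wordDeriv (CPA.arrow K) b w (m * u * CPA.arrow K a)) (CPA.arrow K b) := by
      rw [wordDeriv_cons]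
      simp only [← tmulBilin_apply, map_add, LinearMap.add_apply]
      congr 1
      split_ifs with h
      · rw [h]
      · simp
    rw [wordHomotopy, map_add, ih, hochschildD_tmul₃]
    simp only [h1, Finset.sum_add_distrib, Finset.sum_ite_eq, Finset.mem_univ, if_true,
      List.map_cons, List.prod_cons, mul_assoc]
    abel

theorem tmul₃_apply_ne_zero {l m n : ℕ} {f g h : CPA Q K}
    (hf : f ∈ filtration Q (⊥ : Ideal K) l) (hg : g ∈ filtration Q (⊥ : Ideal K) m)
    (hh : h ∈ filtration Q (⊥ : Ideal K) n) {x : Path Q × Path Q × Path Q}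
    (hx : tmul₃ f g h x ≠ 0) : l + m + n ≤ x.1.length + x.2.1.length + x.2.2.length := by
  have key {n : ℕ} {f : CPA Q K} (hf : f ∈ filtration Q (⊥ : Ideal K) n) {p : Path Q}
      (hp : f p ≠ 0) : n ≤ p.length := by
    by_contra h
    have := hf p
    rw [← Ideal.zero_eq_bot, zero_pow (by omega)] at this
    exact hp this
  have h1 := key hf (left_ne_zero_of_mul hx)
  have h2 := key hg (left_ne_zero_of_mul (right_ne_zero_of_mul hx))
  have h3 := key hh (right_ne_zero_of_mul (right_ne_zero_of_mul hx))
  omega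

theorem wordHomotopy_apply_ne_zero {k l : ℕ} {m u : CPA Q K}
    (hm : m ∈ filtration Q (⊥ : Ideal K) k) (hu : u ∈ filtration Q (⊥ : Ideal K) l)
    (w : List Q.Arrow) {x : Path Q × Path Q × Path Q} (hx : wordHomotopy m u w x ≠ 0) :
    k + l + w.length ≤ x.1.length + x.2.1.length + x.2.2.length := by
  induction w generalizing u l with
  | nil => exact absurd rfl hx
  | cons a w ih =>
    by_cases h : tmul₃ ((w.map (CPA.arrow K)).prod * m) u (CPA.arrow K a) x = 0
    · have h1 : wordHomotopy m (u * CPA.arrow K a) w x ≠ 0 := by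
        intro h1
        refine hx ?_
        rw [wordHomotopy, Pi.add_apply, h, h1, add_zero]
      have := ih (mul_mem_filtration hu (arrow_mem_filtration _ a)) h1
      simp only [List.length_cons]
      omega
    · have := tmul₃_apply_ne_zero (mul_mem_filtration
        (prod_mem_filtration (arrow_mem_filtration (⊥ : Ideal K)) w) hm) hu
        (arrow_mem_filtration _ a) h
      simp only [List.length_cons]
      omega

variable [Fintype V] [Fintype Q.Arrow]

theorem finite_arrow_pathDeriv (b : Q.Arrow) (r : Path Q) :
    {s : Path Q × Path Q | pathDeriv (CPA.arrow K) b (CPA.ofPath K s.1) s.2 r ≠ 0}.Finite := by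
  refine finite_of_mem_filtration (I := (⊥ : Ideal K)) ⟨1, by simp⟩
    (fun s => s.1.length + s.2.length) (fun n => ?_) _ (fun s => ?_) r
  · refine ((Path.finite_length_lt n).prod (Path.finite_length_lt n)).subset fun s hs => ?_
    simp only [Set.mem_ofPred_eq, Set.mem_prod] at hs ⊢
    omega
  · exact pathDeriv_mem_filtration (arrow_mem_filtration _) b (ofPath_mem_filtration _ s.1) s.2

variable (K) in
/-- The component at the arrow `b` of the map from the Hochschild complex to the small complex
`⨁ e_{t(b)} A e_{s(b)} → A`, which sends `m ⊗ p` to the sum of `v m u` over all factorizations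
`u b v` of `p`. -/
noncomputable def hochschildComponent (b : Q.Arrow) : (Path Q × Path Q → K) →ₗ[K] CPA Q K :=
  sumMap (fun s => pathDeriv (CPA.arrow K) b (CPA.ofPath K s.1) s.2) (finite_arrow_pathDeriv b)

theorem continuous_hochschildComponent [TopologicalSpace K] [DiscreteTopology K] (b : Q.Arrow) :
    Continuous (hochschildComponent K b) := continuous_sumMap _ _

theorem hochschildComponent_tmul_ofPath (b : Q.Arrow) (m : CPA Q K) (p : Path Q) :
    hochschildComponent K b (tmul m (CPA.ofPath K p)) = pathDeriv (CPA.arrow K) b m p := by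
  classical
  let : TopologicalSpace K := ⊥
  have : DiscreteTopology K := ⟨rfl⟩
  refine CPA.eq_of_eq_on_ofPath
    (U := hochschildComponent K b ∘ₗ (tmulBilin Q K).flip (CPA.ofPath K p))
    (U' := pathDerivLinear (CPA.arrow K) b p)
    ((continuous_hochschildComponent b).comp (continuous_tmul_left _))
    (continuous_pathDeriv (CPA.arrow K) b p) m fun q _ => ?_
  change hochschildComponent K b (tmul (CPA.ofPath K q) (CPA.ofPath K p)) = _
  rw [tmul_ofPath, hochschildComponent, sumMap_basisVec]
  rfl

/-- The components of a boundary vanish. -/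
theorem hochschildComponent_hochschildD (b : Q.Arrow) (G : Path Q × Path Q × Path Q → K) :
    hochschildComponent K b (hochschildD Q K G) = 0 := by
  classical
  let : TopologicalSpace K := ⊥
  have : DiscreteTopology K := ⟨rfl⟩
  refine eq_of_eq_on_basisVec (U := hochschildComponent K b ∘ₗ hochschildD Q K) (U' := 0)
    ((continuous_hochschildComponent b).comp continuous_hochschildD) continuous_const G ?_
  rintro ⟨p, q, r⟩ -
  simp only [LinearMap.comp_apply, LinearMap.zero_apply]
  rw [← tmul₃_ofPath, hochschildD_tmul₃, map_add, map_sub, hochschildComponent_tmul_ofPath,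
    hochschildComponent_tmul_ofPath]
  by_cases h : q.finish = r.start
  · rw [← CPA.ofPath_comp q r h, hochschildComponent_tmul_ofPath]
    simp only [pathDeriv]
    rw [Path.finish_comp]
    change _ - wordDeriv _ b (q.word ++ r.word) (_ * _ * CPA.e Q K q.start) + _ = 0
    rw [wordDeriv_append]
    have h1 : (r.word.map (CPA.arrow K)).prod *
        (CPA.e Q K r.finish * CPA.ofPath K p * CPA.e Q K q.start) =
        CPA.e Q K q.finish * (CPA.ofPath K r * CPA.ofPath K p) * CPA.e Q K q.start := by
      rw [h, ← mul_assoc, ← mul_assoc, ← CPA.ofPath_eq_mul_e, ← mul_assoc,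
        CPA.e_mul_ofPath_start]
    have h2 : CPA.e Q K r.finish * CPA.ofPath K p * CPA.e Q K q.start *
        (q.word.map (CPA.arrow K)).prod =
        CPA.e Q K r.finish * (CPA.ofPath K p * CPA.ofPath K q) * CPA.e Q K r.start := by
      rw [← h, mul_assoc, ← CPA.ofPath_eq, mul_assoc, mul_assoc, mul_assoc,
        CPA.ofPath_mul_e_finish]
    rw [h1, h2]
    abel
  · rw [CPA.ofPath_mul_ofPath_of_ne h]
    have h1 : CPA.e Q K r.finish * (CPA.ofPath K p * CPA.ofPath K q) * CPA.e Q K r.start = 0 := by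
      rw [mul_assoc, mul_assoc, CPA.ofPath_mul_e_of_ne h, mul_zero, mul_zero]
    have h2 : CPA.e Q K q.finish * (CPA.ofPath K r * CPA.ofPath K p) * CPA.e Q K q.start = 0 := by
      rw [← mul_assoc, CPA.e_mul_ofPath_of_ne (Ne.symm h), zero_mul, zero_mul]
    rw [pathDeriv, pathDeriv, h1, h2, ← tmulBilin_apply]
    simp

/-- Cyclic derivatives are compatible with homomorphisms. -/
theorem cyclicDeriv_map {φ : CPA Q K →ₐ[K] CPA Q' K}
    (hφ : Continuous φ) (he : ∀ i, φ (CPA.e Q K i) = CPA.e Q' K i)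
    (hx : IsTame fun a => φ (CPA.arrow K a)) (b : Q.Arrow) (m f : CPA Q K) :
    cyclicDeriv _ hx b (φ m) f = φ (hochschildComponent K b (tmul m f)) := by
  let : TopologicalSpace K := ⊥
  have : DiscreteTopology K := ⟨rfl⟩
  refine CPA.eq_of_eq_on_ofPath (U := cyclicDeriv _ hx b (φ m))
    (U' := φ.toLinearMap ∘ₗ hochschildComponent K b ∘ₗ tmulBilin Q K m)
    (continuous_cyclicDeriv _ hx b (φ m))
    (hφ.comp ((continuous_hochschildComponent b).comp (continuous_tmul_right m))) f fun p _ => ?_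
  rw [cyclicDeriv_ofPath]
  change _ = φ (hochschildComponent K b (tmul m (CPA.ofPath K p)))
  rw [hochschildComponent_tmul_ofPath, pathDeriv, pathDeriv, map_wordDeriv, map_mul φ, map_mul φ,
    he, he]

variable (K) in
/-- The contracting homotopy on the basis elements `q ⊗ p`. -/
noncomputable def pathHomotopy (s : Path Q × Path Q) : Path Q × Path Q × Path Q → K :=
  tmul₃ (CPA.ofPath K s.2 * CPA.ofPath K s.1) (CPA.e Q K s.2.start) (CPA.e Q K s.2.start) -
    wordHomotopy (CPA.ofPath K s.1) (CPA.e Q K s.2.start) s.2.word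

theorem finite_pathHomotopy (x : Path Q × Path Q × Path Q) :
    {s : Path Q × Path Q | pathHomotopy K s x ≠ 0}.Finite := by
  set n := x.1.length + x.2.1.length + x.2.2.length with hn
  refine ((Path.finite_length_lt (n + 1)).prod (Path.finite_length_lt (n + 1))).subset
    fun s hs => ?_
  simp only [Set.mem_prod, Set.mem_ofPred_eq] at hs ⊢
  suffices h : s.1.length + s.2.length ≤ n by omega
  by_cases h : tmul₃ (CPA.ofPath K s.2 * CPA.ofPath K s.1) (CPA.e Q K s.2.start)
      (CPA.e Q K s.2.start) x = 0
  · have h1 : wordHomotopy (CPA.ofPath K s.1) (CPA.e Q K s.2.start) s.2.word x ≠ 0 := by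
      intro h1
      refine hs ?_
      rw [pathHomotopy, Pi.sub_apply, h, h1, sub_zero]
    have := wordHomotopy_apply_ne_zero (ofPath_mem_filtration _ _) (mem_filtration_zero _ _) _ h1
    simp only [Path.length] at this hn ⊢
    omega
  · have := tmul₃_apply_ne_zero (mul_mem_filtration (ofPath_mem_filtration (⊥ : Ideal K) s.2)
      (ofPath_mem_filtration _ s.1)) (mem_filtration_zero _ _) (mem_filtration_zero _ _) h
    omega

theorem hochschildD_pathHomotopy {p q : Path Q} (h : q.start = p.finish) (h' : q.finish = p.start) :
    hochschildD Q K (pathHomotopy K (q, p)) = tmul (CPA.ofPath K q) (CPA.ofPath K p) -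
      ∑ b, tmul (hochschildComponent K b (tmul (CPA.ofPath K q) (CPA.ofPath K p)))
        (CPA.arrow K b) := by
  have hq : IsBetween p.finish p.start (CPA.ofPath K q) := by
    rw [← h, ← h']
    exact IsBetween.of_left_right (CPA.e_mul_ofPath_start q) (CPA.ofPath_mul_e_finish q)
  have h1 : (p.word.map (CPA.arrow K)).prod * CPA.ofPath K q =
      CPA.ofPath K p * CPA.ofPath K q := by
    rw [CPA.ofPath_eq_mul_e p, mul_assoc, hq.left]
  rw [pathHomotopy, map_sub, hochschildD_tmul₃, hochschildD_wordHomotopy]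
  simp only [hochschildComponent_tmul_ofPath, pathDeriv_of_isBetween _ _ hq]
  rw [hq.right, ← CPA.ofPath_eq, h1, mul_assoc (CPA.ofPath K p), hq.right, CPA.e_mul_e_self,
    ← mul_assoc, CPA.e_mul_ofPath_start]
  abel

/-- A cyclic chain all of whose components vanish is a boundary. -/
theorem mem_range_hochschildD {F : Path Q × Path Q → K}
    (hF : ∀ q p, F (q, p) ≠ 0 → q.start = p.finish ∧ q.finish = p.start)
    (h : ∀ b, hochschildComponent K b F = 0) : F ∈ LinearMap.range (hochschildD Q K) := by
  classical
  let : TopologicalSpace K := ⊥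
  have : DiscreteTopology K := ⟨rfl⟩
  refine ⟨matrixMap (pathHomotopy K) finite_pathHomotopy F, ?_⟩
  have key := eq_of_eq_on_basisVec
    (U := hochschildD Q K ∘ₗ matrixMap (pathHomotopy K) finite_pathHomotopy)
    (U' := LinearMap.id -
      ∑ b, (tmulBilin Q K).flip (CPA.arrow K b) ∘ₗ hochschildComponent K b)
    (continuous_hochschildD.comp (continuous_matrixMap _ _)) ?_ F ?_
  · rw [LinearMap.comp_apply] at key
    rw [key]
    simp [LinearMap.sum_apply, h]
  · have hc : Continuous fun F : Path Q × Path Q → K =>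
        F - ∑ b, tmul (hochschildComponent K b F) (CPA.arrow K b) :=
      continuous_id.sub (continuous_finsetSum _ fun b _ =>
        (continuous_tmul_left _).comp (continuous_hochschildComponent b))
    refine hc.congr fun F => ?_
    simp [LinearMap.sum_apply, tmulBilin_apply]
  · rintro ⟨q, p⟩ hqp
    obtain ⟨h1, h2⟩ := hF q p hqp
    rw [LinearMap.comp_apply, matrixMap_basisVec, hochschildD_pathHomotopy h1 h2, tmul_ofPath]
    simp [LinearMap.sum_apply, tmulBilin_apply]

theorem hochschildComponent_hyperpotential (h : Hyperpotential Q K) (b : Q.Arrow) :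
    hochschildComponent K b (∑ a, tmul (h.ρ a) (CPA.arrow K a)) = h.ρ b := by
  classical
  rw [map_sum, Finset.sum_eq_single b]
  · rw [CPA.arrow, hochschildComponent_tmul_ofPath,
      pathDeriv_of_isBetween (p := Path.single Q b) _ _
        (show IsBetween (Q.tgt b) (Q.src b) _ from h.mem b)]
    simp [Path.single, wordDeriv_cons, wordDeriv_nil]
  · intro a _ ha
    rw [CPA.arrow, hochschildComponent_tmul_ofPath, pathDeriv]
    simp [Path.single, wordDeriv_cons, wordDeriv_nil, ha]
  · simp

variable [Fintype Q'.Arrow]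

/-- The homology class of a hyperpotential is determined by its components. -/
theorem mapsHyperpotential_iff {φ : CPA Q K →ₐ[K] CPA Q' K}
    (he : ∀ i, φ (CPA.e Q K i) = CPA.e Q' K i) (h : Hyperpotential Q K)
    (h' : Hyperpotential Q' K) : MapsHyperpotential φ h h' ↔
      ∀ b, ∑ a, hochschildComponent K b (tmul (φ (h.ρ a)) (φ (CPA.arrow K a))) = h'.ρ b := by
  constructor
  · rintro ⟨G, hG⟩ b
    have h1 := hochschildComponent_hochschildD b G
    rw [hG, map_sub, hochschildComponent_hyperpotential, map_sum, sub_eq_zero] at h1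
    exact h1
  · intro H
    refine mem_range_hochschildD (fun q p hqp => ?_) fun b => ?_
    · have key {i j : V} {f g : CPA Q' K} (hf : IsBetween j i f) (hg : IsBetween i j g)
          (hfg : tmul f g (q, p) ≠ 0) : q.start = p.finish ∧ q.finish = p.start := by
        obtain ⟨h1, h2⟩ := hf.parallel (left_ne_zero_of_mul hfg)
        obtain ⟨h3, h4⟩ := hg.parallel (right_ne_zero_of_mul hfg)
        exact ⟨h1.trans h4.symm, h2.trans h3.symm⟩
      by_contra hne
      refine hqp ?_
      rw [Pi.sub_apply, Finset.sum_apply, Finset.sum_apply,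
        Finset.sum_eq_zero fun a _ => ?_, Finset.sum_eq_zero fun b _ => ?_, sub_zero]
      · by_contra h1
        exact hne (key (h'.mem b) (IsBetween.arrow b) h1)
      · by_contra h1
        exact hne (key (IsBetween.map φ he (h.mem a)) (IsBetween.map φ he (IsBetween.arrow a)) h1)
    · rw [map_sub, hochschildComponent_hyperpotential, map_sum, H, sub_self]

end HochschildHomology

/-! ### Coefficients of products with arrows -/

section Coefficients

variable {V : Type u} {Q : QuiverOn.{u, v} V} {K : Type w} [CommRing K]

variable (K) in
/-- The coefficient at a word starting at `i`, as a linear form. -/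
noncomputable def coeffLinear (i : V) (x : List Q.Arrow) : CPA Q K →ₗ[K] K where
  toFun f := f.coeff i x
  map_add' f g := CPA.coeff_add f g i x
  map_smul' c f := CPA.coeff_smul c f i x

theorem coeffLinear_apply (i : V) (x : List Q.Arrow) (f : CPA Q K) :
    coeffLinear K i x f = f.coeff i x := rfl

theorem CPA.coeff_path (f : CPA Q K) (p : Path Q) : f.coeff p.start p.word = f p :=
  dif_pos p.isPath

open Classical in
theorem CPA.coeff_arrow (a : Q.Arrow) (i : V) (x : List Q.Arrow) :
    (CPA.arrow K a : CPA Q K).coeff i x = if i = Q.src a ∧ x = [a] then 1 else 0 := by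
  simp only [CPA.coeff, CPA.arrow, CPA.ofPath_apply]
  by_cases h1 : i = Q.src a ∧ x = [a]
  · obtain ⟨rfl, rfl⟩ := h1
    have : Q.IsPath (Q.src a) [a] := ⟨rfl, trivial⟩
    rw [dif_pos this, if_pos (by rfl), if_pos ⟨rfl, rfl⟩]
  · rw [if_neg h1]
    split_ifs with h2 h3
    · exact absurd ⟨congrArg Path.start h3, congrArg Path.word h3⟩ h1
    · rfl
    · rfl

open Classical in
theorem CPA.coeff_arrow_mul (a c : Q.Arrow) (f : CPA Q K) (i : V) (x : List Q.Arrow) :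
    (CPA.arrow K a * f).coeff i (c :: x) =
      if i = Q.src a ∧ c = a then f.coeff (Q.tgt a) x else 0 := by
  rw [CPA.coeff_mul, Finset.sum_eq_single 1]
  · simp only [CPA.coeff_arrow, List.take_succ_cons, List.take_zero, List.cons.injEq, and_true,
      List.drop_succ_cons, List.drop_zero, endOf]
    split_ifs with h
    · rw [h.2, one_mul]
    · rw [zero_mul]
  · intro k hk hk1
    rw [CPA.coeff_arrow, if_neg, zero_mul]
    rintro ⟨-, h⟩
    have := congrArg List.length h
    simp only [List.length_take, List.length_cons, List.length_nil] at this
    simp only [Finset.mem_range, List.length_cons] at hk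
    omega
  · simp

open Classical in
theorem CPA.coeff_mul_arrow (a c : Q.Arrow) (f : CPA Q K) (i : V) (x : List Q.Arrow) :
    (f * CPA.arrow K a).coeff i (x ++ [c]) =
      if Q.endOf i x = Q.src a ∧ c = a then f.coeff i x else 0 := by
  rw [CPA.coeff_mul, Finset.sum_eq_single x.length]
  · simp only [CPA.coeff_arrow, List.take_left, List.drop_left, List.cons.injEq, and_true]
    split_ifs with h
    · rw [mul_one]
    · rw [mul_zero]
  · intro k hk hk1
    rw [CPA.coeff_arrow, if_neg, mul_zero]
    rintro ⟨-, h⟩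
    have := congrArg List.length h
    simp only [List.length_drop, List.length_append, List.length_cons, List.length_nil] at this
    omega
  · intro h
    simp at h

end Coefficients

/-! ### The part of degree zero of the Ginzburg algebra -/

section Inclusion

variable {V : Type u} {Q : QuiverOn.{u, v} V} {K : Type w} [CommRing K]

theorem arrowDegree_nonpos (a : (ginzburgQuiver Q).Arrow) : arrowDegree a ≤ 0 := by
  rcases a with a | a | i <;> simp [arrowDegree]

theorem sum_arrowDegree_nonpos (w : List (ginzburgQuiver Q).Arrow) :
    (w.map arrowDegree).sum ≤ 0 := by
  induction w with
  | nil => simp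
  | cons a w ih =>
    rw [List.map_cons, List.sum_cons]
    have := arrowDegree_nonpos a
    omega

theorem sum_arrowDegree_map_orig (w : List Q.Arrow) :
    ((w.map GArrow.orig).map (arrowDegree (Q := Q))).sum = 0 := by
  induction w with
  | nil => rfl
  | cons a w ih =>
    rw [List.map_cons, List.map_cons, List.sum_cons, ih]
    rfl

/-- A word either consists of arrows of `Q` or has a first arrow of negative degree. -/
theorem exists_eq_map_orig_or (w : List (ginzburgQuiver Q).Arrow) :
    (∃ u : List Q.Arrow, w = u.map GArrow.orig) ∨
      ∃ (u : List Q.Arrow) (s : (ginzburgQuiver Q).Arrow) (v : List (ginzburgQuiver Q).Arrow),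
        arrowDegree s ≠ 0 ∧ w = u.map GArrow.orig ++ s :: v := by
  induction w with
  | nil => exact Or.inl ⟨[], rfl⟩
  | cons a w ih =>
    by_cases ha : arrowDegree a = 0
    · rcases a with a | a | i
      · rcases ih with ⟨u, rfl⟩ | ⟨u, s, v, hs, rfl⟩
        · exact Or.inl ⟨a :: u, rfl⟩
        · exact Or.inr ⟨a :: u, s, v, hs, rfl⟩
      · simp [arrowDegree] at ha
      · simp [arrowDegree] at ha
    · exact Or.inr ⟨[], a, w, ha, rfl⟩

theorem isPath_of_isPath_map_orig (i : V) (x : List Q.Arrow)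
    (h : (ginzburgQuiver Q).IsPath i (x.map GArrow.orig)) : Q.IsPath i x := by
  induction x generalizing i with
  | nil => trivial
  | cons a x ih => exact ⟨h.1, ih _ h.2⟩

theorem degree_toGinzburgPath (p : Path Q) : degree (toGinzburgPath p) = 0 :=
  sum_arrowDegree_map_orig p.word

theorem exists_toGinzburgPath_eq {p : Path (ginzburgQuiver Q)} (hp : degree p = 0) :
    ∃ q, toGinzburgPath q = p := by
  obtain ⟨i, w, hw⟩ := p
  rcases exists_eq_map_orig_or w with ⟨u, rfl⟩ | ⟨u, s, v, hs, rfl⟩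
  · exact ⟨⟨i, u, isPath_of_isPath_map_orig i u hw⟩, rfl⟩
  · have h1 : (((u.map GArrow.orig ++ s :: v)).map (arrowDegree (Q := Q))).sum = 0 := hp
    rw [List.map_append, List.sum_append, sum_arrowDegree_map_orig, List.map_cons,
      List.sum_cons] at h1
    have h2 := sum_arrowDegree_nonpos v
    have h3 := arrowDegree_nonpos s
    omega

theorem toGinzburgPath_injective : Function.Injective (toGinzburgPath (Q := Q)) := by
  intro x y hxy
  ext1
  · exact congrArg (fun z => z.start) hxy
  · have := congrArg (fun z => z.word) hxy
    exact List.map_injective_iff.mpr (fun b c hbc => by injection hbc) this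

theorem toGinzburg_apply (f : CPA Q K) (p : Path Q) :
    toGinzburg f (toGinzburgPath p) = f p :=
  toGinzburgPath_injective.extend_apply _ _ _

theorem toGinzburg_apply_of_ne (f : CPA Q K) {p : Path (ginzburgQuiver Q)} (hp : degree p ≠ 0) :
    toGinzburg f p = 0 :=
  Function.extend_apply' _ _ _ fun ⟨q, hq⟩ => hp (hq ▸ degree_toGinzburgPath q)

variable (Q K) in
/-- The inclusion of the completed path algebra into the Ginzburg algebra, as a linear map. -/
noncomputable def toGinzburgLinear : CPA Q K →ₗ[K] CPA (ginzburgQuiver Q) K where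
  toFun := toGinzburg
  map_add' f g := by
    ext p
    by_cases hp : degree p = 0
    · obtain ⟨q, rfl⟩ := exists_toGinzburgPath_eq hp
      simp only [CPA.add_apply, toGinzburg_apply]
    · simp only [CPA.add_apply, toGinzburg_apply_of_ne _ hp, add_zero]
  map_smul' c f := by
    ext p
    by_cases hp : degree p = 0
    · obtain ⟨q, rfl⟩ := exists_toGinzburgPath_eq hp
      simp only [CPA.smul_apply, toGinzburg_apply, RingHom.id_apply]
    · simp only [CPA.smul_apply, toGinzburg_apply_of_ne _ hp, mul_zero]

theorem continuous_toGinzburgLinear : Continuous (toGinzburgLinear Q K) := by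
  let : TopologicalSpace K := ⊥
  have : DiscreteTopology K := ⟨rfl⟩
  refine CPA.continuous_iff.mpr fun p => ?_
  by_cases hp : degree p = 0
  · obtain ⟨q, rfl⟩ := exists_toGinzburgPath_eq hp
    exact (CPA.continuous_apply q).congr fun f => (toGinzburg_apply f q).symm
  · exact continuous_const.congr fun f => (toGinzburg_apply_of_ne f hp).symm

theorem toGinzburg_ofPath (p : Path Q) :
    toGinzburg (CPA.ofPath K p) = CPA.ofPath K (toGinzburgPath p) := by
  classical
  ext q
  by_cases hq : degree q = 0
  · obtain ⟨q, rfl⟩ := exists_toGinzburgPath_eq hq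
    rw [toGinzburg_apply, CPA.ofPath_apply, CPA.ofPath_apply]
    simp only [toGinzburgPath_injective.eq_iff]
  · rw [toGinzburg_apply_of_ne _ hq, CPA.ofPath_apply, if_neg]
    rintro rfl
    exact hq (degree_toGinzburgPath p)

variable (Q K) in
/-- The part of degree zero of an element of the Ginzburg algebra, as an element of the completed
path algebra of `Q`. -/
noncomputable def restriction : CPA (ginzburgQuiver Q) K →ₗ[K] CPA Q K where
  toFun f := ⟨fun p => f (toGinzburgPath p)⟩
  map_add' _ _ := rfl
  map_smul' _ _ := rfl

theorem restriction_apply (f : CPA (ginzburgQuiver Q) K) (p : Path Q) :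
    restriction Q K f p = f (toGinzburgPath p) := rfl

theorem continuous_restriction : Continuous (restriction Q K) := by
  let : TopologicalSpace K := ⊥
  have : DiscreteTopology K := ⟨rfl⟩
  exact CPA.continuous_iff.mpr fun p => CPA.continuous_apply _

variable (K) in
/-- An arrow of `Q`, as an element of the Ginzburg algebra. -/
noncomputable abbrev gOrig (a : Q.Arrow) : CPA (ginzburgQuiver Q) K :=
  CPA.arrow (Q := ginzburgQuiver Q) K (GArrow.orig a)

variable (K) in
/-- A reversed arrow, as an element of the Ginzburg algebra. -/
noncomputable abbrev gStar (a : Q.Arrow) : CPA (ginzburgQuiver Q) K :=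
  CPA.arrow (Q := ginzburgQuiver Q) K (GArrow.star a)

variable (Q K) in
/-- The loop at a vertex, as an element of the Ginzburg algebra. -/
noncomputable abbrev gLoop (i : V) : CPA (ginzburgQuiver Q) K :=
  CPA.arrow (Q := ginzburgQuiver Q) K (GArrow.loop i)

theorem isTame_gOrig : IsTame (gOrig (Q := Q) K) :=
  ⟨⊥, ⟨1, by simp⟩, fun _ => arrow_mem_filtration _ _⟩

theorem gStar_mem_homogeneous (b : Q.Arrow) : gStar K b ∈ homogeneous Q K (-1) :=
  ofPath_mem_homogeneous (Path.single (ginzburgQuiver Q) (GArrow.star b))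

theorem constCoeff_eq_zero {n : ℤ} (hn : n ≠ 0) {f : CPA (ginzburgQuiver Q) K}
    (hf : f ∈ homogeneous Q K n) (i : V) : constCoeff (ginzburgQuiver Q) K i f = 0 := by
  by_contra h
  exact hn (hf _ h).symm

variable [Fintype V] [Fintype Q.Arrow]

variable (Q K) in
/-- The inclusion of the completed path algebra into the Ginzburg algebra. -/
noncomputable def inclusion : CPA Q K →ₐ[K] CPA (ginzburgQuiver Q) K :=
  arrowHom (gOrig K) isTame_gOrig fun a => IsBetween.arrow (Q := ginzburgQuiver Q) (GArrow.orig a)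

theorem continuous_inclusion : Continuous (inclusion Q K) := continuous_arrowHom _ _ _

theorem inclusion_e (i : V) : inclusion Q K (CPA.e Q K i) = CPA.e (ginzburgQuiver Q) K i :=
  arrowHom_e _ _ _ i

theorem inclusion_arrow (a : Q.Arrow) : inclusion Q K (CPA.arrow K a) = gOrig K a :=
  arrowHom_arrow _ _ _ a

theorem inclusion_eq_toGinzburg (f : CPA Q K) : inclusion Q K f = toGinzburg f := by
  refine CPA.eq_of_eq_on_ofPath (U := (inclusion Q K).toLinearMap) (U' := toGinzburgLinear Q K)
    continuous_inclusion continuous_toGinzburgLinear f fun p _ => ?_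
  change inclusion Q K (CPA.ofPath K p) = toGinzburg (CPA.ofPath K p)
  rw [toGinzburg_ofPath, inclusion, arrowHom_ofPath, CPA.ofPath_eq]
  simp only [pathProd, toGinzburgPath, List.map_map]
  rfl

theorem restriction_inclusion (f : CPA Q K) : restriction Q K (inclusion Q K f) = f := by
  ext p
  rw [restriction_apply, inclusion_eq_toGinzburg, toGinzburg_apply]

theorem inclusion_injective : Function.Injective (inclusion Q K) :=
  Function.LeftInverse.injective restriction_inclusion

theorem inclusion_mem_homogeneous (f : CPA Q K) : inclusion Q K f ∈ homogeneous Q K 0 := by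
  intro p hp
  by_contra h
  rw [inclusion_eq_toGinzburg] at hp
  exact hp (toGinzburg_apply_of_ne f h)

theorem inclusion_restriction {f : CPA (ginzburgQuiver Q) K} (hf : f ∈ homogeneous Q K 0) :
    inclusion Q K (restriction Q K f) = f := by
  ext p
  rw [inclusion_eq_toGinzburg]
  by_cases hp : degree p = 0
  · obtain ⟨q, rfl⟩ := exists_toGinzburgPath_eq hp
    rw [toGinzburg_apply, restriction_apply]
  · rw [toGinzburg_apply_of_ne _ hp]
    by_contra h
    exact hp (hf p (Ne.symm h))

end Inclusion

/-! ### Homogeneous elements -/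

section Grading

variable {V : Type u} {Q : QuiverOn.{u, v} V} {Q' : QuiverOn.{u, v'} V} {K : Type w} [CommRing K]

theorem mem_ginzburgAlgebra_of_mem_homogeneous {n : ℤ} {f : CPA (ginzburgQuiver Q) K}
    (hf : f ∈ homogeneous Q K n) : f ∈ ginzburgAlgebra Q K := by
  rw [mem_ginzburgAlgebra]
  refine (Set.finite_singleton n).subset ?_
  rintro _ ⟨p, hp, rfl⟩
  exact hf p hp

theorem exists_degree_zero_decomposition (x : ginzburgAlgebra Q K) :
    ∃ x₀ ∈ gradedPiece Q K 0, ∃ x₁ ∈ ⨆ n : {n : ℤ // n ≠ 0}, gradedPiece Q K n,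
      x = x₀ + x₁ := by
  classical
  have hx := (mem_ginzburgAlgebra x.1).mp x.2
  let comp (n : ℤ) : CPA (ginzburgQuiver Q) K := ⟨fun p => if degree p = n then x.1 p else 0⟩
  have happly (n : ℤ) (p : Path (ginzburgQuiver Q)) :
      comp n p = if degree p = n then x.1 p else 0 := rfl
  have hcomp (n : ℤ) : comp n ∈ homogeneous Q K n := by
    intro p hp
    by_contra h
    exact hp (if_neg h)
  let c (n : ℤ) : ginzburgAlgebra Q K :=
    ⟨comp n, mem_ginzburgAlgebra_of_mem_homogeneous (hcomp n)⟩
  refine ⟨c 0, hcomp 0, ∑ n ∈ hx.toFinset.erase 0, c n, ?_, ?_⟩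
  · refine Submodule.sum_mem _ fun n hn => ?_
    exact Submodule.mem_iSup_of_mem (p := fun n : {n : ℤ // n ≠ 0} => gradedPiece Q K n)
      ⟨n, Finset.ne_of_mem_erase hn⟩ (hcomp n)
  · refine Subtype.ext (CPA.ext fun p => ?_)
    change x.1 p = comp 0 p + (ginzburgAlgebra Q K).val (∑ n ∈ hx.toFinset.erase 0, c n) p
    rw [map_sum, CPA.sum_apply]
    change x.1 p = comp 0 p + ∑ n ∈ hx.toFinset.erase 0, comp n p
    simp only [happly]
    rw [Finset.sum_ite_eq]
    by_cases h0 : degree p = 0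
    · simp [h0]
    · by_cases hp : x.1 p = 0
      · simp [hp]
      · rw [if_neg h0, zero_add, if_pos]
        rw [Finset.mem_erase, Set.Finite.mem_toFinset]
        exact ⟨h0, p, hp, rfl⟩

/-- An isomorphism that preserves degrees also reflects them, because the Ginzburg algebra is the
sum of its graded pieces. -/
theorem symm_mem_gradedPiece_zero {Φ : ginzburgAlgebra Q K ≃ₐ[K] ginzburgAlgebra Q' K}
    (hΦ : ∀ n : ℤ, ∀ x ∈ gradedPiece Q K n, Φ x ∈ gradedPiece Q' K n)
    {y : ginzburgAlgebra Q' K} (hy : y ∈ gradedPiece Q' K 0) : Φ.symm y ∈ gradedPiece Q K 0 := by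
  obtain ⟨x₀, hx₀, x₁, hx₁, hx⟩ := exists_degree_zero_decomposition (Φ.symm y)
  have h1 : ∀ p, (Φ x₁).1 p ≠ 0 → degree p ≠ 0 := by
    refine Submodule.iSup_induction (fun n : {n : ℤ // n ≠ 0} => gradedPiece Q K n)
      (motive := fun x => ∀ p, (Φ x).1 p ≠ 0 → degree p ≠ 0) hx₁ ?_ ?_ ?_
    · rintro ⟨n, hn⟩ x hx p hp
      rw [hΦ n x hx p hp]
      exact hn
    · intro p hp
      rw [map_zero] at hp
      exact absurd rfl hp
    · intro x x' hx hx' p hp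
      by_cases h : (Φ x).1 p = 0
      · refine hx' p fun h' => hp ?_
        rw [map_add]
        change (Φ x).1 p + (Φ x').1 p = 0
        rw [h, h', add_zero]
      · exact hx p h
  have h2 : Φ x₁ ∈ gradedPiece Q' K 0 := by
    have h3 : Φ x₁ = y - Φ x₀ := by
      rw [eq_sub_iff_add_eq', ← map_add, ← hx, Φ.apply_symm_apply]
    rw [h3]
    exact Submodule.sub_mem _ hy (hΦ 0 x₀ hx₀)
  have h3 : Φ x₁ = 0 := by
    refine Subtype.ext (CPA.ext fun p => ?_)
    by_contra hp
    exact h1 p hp (h2 p hp)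
  rw [map_eq_zero_iff Φ Φ.injective] at h3
  rw [hx, h3, add_zero]
  exact hx₀

end Grading

/-! ### Sums of commutators with the arrows -/

section Commutators

variable {V : Type u} {Q : QuiverOn.{u, v} V} {K : Type w} [CommRing K] [Fintype Q.Arrow]

/-- A sum of commutators with the arrows of `Q` whose other entries have no component of degree
zero vanishes only if all entries vanish. Comparing coefficients shows that the coefficient at a
path `a r` of an entry equals the coefficient of another entry at a path `r b`, in which the first
arrow of negative degree comes earlier; and the coefficients at the paths that start with an arrow
of negative degree vanish. -/
theorem eq_zero_of_sum_commutator_eq_zero {m : Q.Arrow → CPA (ginzburgQuiver Q) K}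
    (hm : ∀ b, IsBetween (Q.tgt b) (Q.src b) (m b)) (hdeg : ∀ b p, m b p ≠ 0 → degree p ≠ 0)
    (h : ∑ b, (gOrig K b * m b - m b * gOrig K b) = 0) (b : Q.Arrow) : m b = 0 := by
  classical
  have key (u : List Q.Arrow) : ∀ (b : Q.Arrow) (s : (ginzburgQuiver Q).Arrow)
      (v : List (ginzburgQuiver Q).Arrow), arrowDegree s ≠ 0 →
      (m b).coeff (Q.tgt b) (u.map GArrow.orig ++ s :: v) = 0 := by
    induction u with
    | nil =>
      intro b s v hs
      by_contra hne
      have hend : (ginzburgQuiver Q).endOf (Q.tgt b) (s :: v) = Q.src b := by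
        unfold CPA.coeff at hne
        split_ifs at hne with hp
        · exact ((hm b).parallel hne).2
        · exact absurd rfl hne
      have h1 := congrArg (coeffLinear K (Q.tgt b) ((s :: v) ++ [GArrow.orig b])) h
      simp only [map_sum, map_sub, map_zero, coeffLinear_apply] at h1
      rw [Finset.sum_eq_single b] at h1
      · rw [CPA.coeff_mul_arrow, if_pos ⟨hend, rfl⟩, List.cons_append, CPA.coeff_arrow_mul,
          if_neg, zero_sub, neg_eq_zero] at h1
        · exact hne h1
        · rintro ⟨-, rfl⟩
          exact hs rfl
      · intro c _ hc
        rw [CPA.coeff_mul_arrow, if_neg, List.cons_append, CPA.coeff_arrow_mul, if_neg, sub_zero]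
        · rintro ⟨-, rfl⟩
          exact hs rfl
        · rintro ⟨-, h2⟩
          injection h2 with h2
          exact hc h2.symm
      · simp
    | cons a u ih =>
      intro b s v hs
      by_contra hne
      have hend : (ginzburgQuiver Q).endOf (Q.tgt b) ((a :: u).map GArrow.orig ++ s :: v) =
          Q.src b := by
        unfold CPA.coeff at hne
        split_ifs at hne with hp
        · exact ((hm b).parallel hne).2
        · exact absurd rfl hne
      have h1 := congrArg (coeffLinear K (Q.tgt b)
        (((a :: u).map GArrow.orig ++ s :: v) ++ [GArrow.orig b])) h
      simp only [map_sum, map_sub, map_zero, coeffLinear_apply] at h1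
      have h2 (c : Q.Arrow) : (gOrig K c * m c).coeff (Q.tgt b)
          (((a :: u).map GArrow.orig ++ s :: v) ++ [GArrow.orig b]) = 0 := by
        rw [List.map_cons, List.cons_append, List.cons_append, CPA.coeff_arrow_mul]
        split_ifs with h3
        · rw [List.append_assoc, List.cons_append]
          exact ih c s _ hs
        · rfl
      rw [Finset.sum_eq_single b] at h1
      · rw [h2, CPA.coeff_mul_arrow, if_pos ⟨hend, rfl⟩, zero_sub, neg_eq_zero] at h1
        exact hne h1
      · intro c _ hc
        rw [h2, CPA.coeff_mul_arrow, if_neg, sub_zero]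
        rintro ⟨-, h2⟩
        injection h2 with h2
        exact hc h2.symm
      · simp
  ext p
  by_contra hne
  have hstart := ((hm b).parallel hne).1
  rcases exists_eq_map_orig_or p.word with ⟨u, hu⟩ | ⟨u, s, v, hs, hu⟩
  · refine hdeg b p hne ?_
    rw [degree, hu, sum_arrowDegree_map_orig]
  · refine hne ?_
    rw [← CPA.coeff_path, hstart, hu]
    exact key u b s v hs

variable (Q K) in
/-- The sum of the commutators `[b, b*]`. -/
noncomputable def commutatorSum : CPA (ginzburgQuiver Q) K :=
  ∑ b : Q.Arrow, (gOrig K b * gStar K b - gStar K b * gOrig K b)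

theorem sum_e_mul_commutatorSum_mul_e [Fintype V] :
    ∑ i, CPA.e (ginzburgQuiver Q) K i * commutatorSum Q K * CPA.e (ginzburgQuiver Q) K i =
      commutatorSum Q K := by
  have h1 (b : Q.Arrow) := IsBetween.arrow (Q := ginzburgQuiver Q) (K := K) (GArrow.orig b)
  have h2 (b : Q.Arrow) := IsBetween.arrow (Q := ginzburgQuiver Q) (K := K) (GArrow.star b)
  have key {i : V} {f : CPA (ginzburgQuiver Q) K} (hf : IsBetween i i f) :
      ∑ j, CPA.e (ginzburgQuiver Q) K j * f * CPA.e (ginzburgQuiver Q) K j = f := by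
    rw [Finset.sum_eq_single i]
    · exact hf
    · intro j _ hj
      rw [← hf.left, ← mul_assoc, CPA.e_mul_e_of_ne hj, zero_mul, zero_mul]
    · simp
  simp only [commutatorSum, Finset.mul_sum, Finset.sum_mul]
  rw [Finset.sum_comm]
  refine Finset.sum_congr rfl fun b _ => ?_
  simp only [mul_sub, sub_mul, Finset.sum_sub_distrib]
  rw [key ((h1 b).mul (h2 b)), key ((h2 b).mul (h1 b))]

end Commutators

/-! ### The differential and cyclic derivatives -/

section Differential

variable {V : Type u} {Q : QuiverOn.{u, v} V} {K : Type w} [CommRing K] [Fintype V]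
  [Fintype Q.Arrow]

/-- The differential on all infinite linear combinations of paths, as a linear map. -/
noncomputable def differentialLinear (h : Hyperpotential Q K) :
    CPA (ginzburgQuiver Q) K →ₗ[K] CPA (ginzburgQuiver Q) K where
  toFun := differentialFun h
  map_add' f g := by
    ext p
    simp only [CPA.add_apply, differentialFun_apply, CPA.coeff_add, mul_add,
      Finset.sum_add_distrib]
  map_smul' c f := by
    ext p
    simp only [CPA.smul_apply, differentialFun_apply, CPA.coeff_smul, Finset.mul_sum,
      RingHom.id_apply]
    refine Finset.sum_congr rfl fun k _ => Finset.sum_congr rfl fun l _ =>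
      Finset.sum_congr rfl fun a _ => ?_
    ring

theorem continuous_differentialLinear (h : Hyperpotential Q K) :
    Continuous (differentialLinear h) := continuous_differentialFun h

theorem differentialLinear_gStar (h : Hyperpotential Q K) (a : Q.Arrow) :
    differentialLinear h (gStar K a) = inclusion Q K (h.ρ a) := by
  rw [inclusion_eq_toGinzburg]
  exact differentialFun_arrow h (GArrow.star a)

theorem differentialLinear_gLoop (h : Hyperpotential Q K) (i : V) :
    differentialLinear h (gLoop Q K i) =
      CPA.e (ginzburgQuiver Q) K i * commutatorSum Q K * CPA.e (ginzburgQuiver Q) K i :=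
  differentialFun_arrow h (GArrow.loop i)

/-- There are no paths of positive degree, so the differential vanishes in degree zero. -/
theorem differentialLinear_inclusion (h : Hyperpotential Q K) (f : CPA Q K) :
    differentialLinear h (inclusion Q K f) = 0 := by
  ext p
  by_contra hp
  obtain ⟨q, hq, hpq⟩ := differentialFun_degree h _ p hp
  rw [inclusion_mem_homogeneous f q hq] at hpq
  have : degree p ≤ 0 := sum_arrowDegree_nonpos p.word
  omega

theorem differentialLinear_mul (h : Hyperpotential Q K) {n : ℤ} {f : CPA (ginzburgQuiver Q) K}
    (hf : f ∈ homogeneous Q K n) (g : CPA (ginzburgQuiver Q) K) :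
    differentialLinear h (f * g) = differentialLinear h f * g +
      ((Int.negOnePow n : ℤ) : K) • (f * differentialLinear h g) :=
  differentialFun_mul h n f g hf

theorem differentialLinear_inclusion_mul (h : Hyperpotential Q K) (f : CPA Q K)
    (g : CPA (ginzburgQuiver Q) K) : differentialLinear h (inclusion Q K f * g) =
      inclusion Q K f * differentialLinear h g := by
  rw [differentialLinear_mul h (inclusion_mem_homogeneous f), differentialLinear_inclusion]
  simp

theorem differentialLinear_mul_inclusion (h : Hyperpotential Q K) {n : ℤ}
    {g : CPA (ginzburgQuiver Q) K} (hg : g ∈ homogeneous Q K n) (f : CPA Q K) :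
    differentialLinear h (g * inclusion Q K f) = differentialLinear h g * inclusion Q K f := by
  rw [differentialLinear_mul h hg, differentialLinear_inclusion]
  simp

variable {R : QuiverOn.{u, v'} V}

theorem prod_inclusion (y : R.Arrow → CPA Q K) (w : List R.Arrow) :
    (w.map fun a => inclusion Q K (y a)).prod = inclusion Q K (w.map y).prod := by
  rw [map_list_prod, List.map_map]
  rfl

theorem wordDeriv_mem_homogeneous (y : R.Arrow → CPA Q K) (b : R.Arrow) (w : List R.Arrow)
    {n : ℤ} {m : CPA (ginzburgQuiver Q) K} (hm : m ∈ homogeneous Q K n) :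
    wordDeriv (fun a => inclusion Q K (y a)) b w m ∈ homogeneous Q K n := by
  classical
  induction w generalizing m with
  | nil => exact zero_mem _
  | cons a w ih =>
    rw [wordDeriv_cons, prod_inclusion]
    refine add_mem ?_ (ih ?_)
    · split_ifs
      · simpa using mul_mem_homogeneous (inclusion_mem_homogeneous (w.map y).prod) hm
      · exact zero_mem _
    · simpa using mul_mem_homogeneous hm (inclusion_mem_homogeneous (y a))

theorem differentialLinear_wordDeriv (h : Hyperpotential Q K) (y : R.Arrow → CPA Q K)
    (b : R.Arrow) (w : List R.Arrow) {n : ℤ} {m : CPA (ginzburgQuiver Q) K}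
    (hm : m ∈ homogeneous Q K n) :
    differentialLinear h (wordDeriv (fun a => inclusion Q K (y a)) b w m) =
      wordDeriv (fun a => inclusion Q K (y a)) b w (differentialLinear h m) := by
  classical
  induction w generalizing m with
  | nil => simp [wordDeriv_nil]
  | cons a w ih =>
    have hma : m * inclusion Q K (y a) ∈ homogeneous Q K n := by
      simpa using mul_mem_homogeneous hm (inclusion_mem_homogeneous (y a))
    rw [wordDeriv_cons, wordDeriv_cons, map_add, ih hma, differentialLinear_mul_inclusion h hm,
      prod_inclusion]
    congr 1
    split_ifs
    · rw [differentialLinear_inclusion_mul]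
    · exact map_zero _

theorem e_mul_mul_e_mem_homogeneous {n : ℤ} {m : CPA (ginzburgQuiver Q) K}
    (hm : m ∈ homogeneous Q K n) (i j : V) :
    CPA.e (ginzburgQuiver Q) K i * m * CPA.e (ginzburgQuiver Q) K j ∈ homogeneous Q K n := by
  rw [← inclusion_e, ← inclusion_e]
  simpa using mul_mem_homogeneous (mul_mem_homogeneous (inclusion_mem_homogeneous _) hm)
    (inclusion_mem_homogeneous _)

variable [Fintype R.Arrow]

theorem cyclicDeriv_mem_homogeneous {y : R.Arrow → CPA Q K}
    (hx : IsTame fun a => inclusion Q K (y a)) (b : R.Arrow) {n : ℤ}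
    {m : CPA (ginzburgQuiver Q) K} (hm : m ∈ homogeneous Q K n) (f : CPA R K) :
    cyclicDeriv _ hx b m f ∈ homogeneous Q K n := by
  intro q hq
  obtain ⟨p, -, hp⟩ := CPA.exists_of_map_apply_ne_zero (continuous_cyclicDeriv _ hx b m) hq
  rw [cyclicDeriv_ofPath] at hp
  exact wordDeriv_mem_homogeneous y b p.word (e_mul_mul_e_mem_homogeneous hm _ _) q hp

theorem differentialLinear_cyclicDeriv (h : Hyperpotential Q K) {y : R.Arrow → CPA Q K}
    (hx : IsTame fun a => inclusion Q K (y a)) (b : R.Arrow) {n : ℤ}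
    {m : CPA (ginzburgQuiver Q) K} (hm : m ∈ homogeneous Q K n) (f : CPA R K) :
    differentialLinear h (cyclicDeriv _ hx b m f) =
      cyclicDeriv _ hx b (differentialLinear h m) f := by
  refine CPA.eq_of_eq_on_ofPath (U := differentialLinear h ∘ₗ cyclicDeriv _ hx b m)
    (U' := cyclicDeriv _ hx b (differentialLinear h m))
    ((continuous_differentialLinear h).comp (continuous_cyclicDeriv _ hx b m))
    (continuous_cyclicDeriv _ hx b _) f fun p _ => ?_
  rw [LinearMap.comp_apply, cyclicDeriv_ofPath, cyclicDeriv_ofPath, pathDeriv, pathDeriv,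
    differentialLinear_wordDeriv h y b p.word (e_mul_mul_e_mem_homogeneous hm _ _)]
  congr 1
  have h1 : CPA.e (ginzburgQuiver Q) K p.finish * m ∈ homogeneous Q K n := by
    rw [← inclusion_e]
    simpa using mul_mem_homogeneous (inclusion_mem_homogeneous _) hm
  rw [← inclusion_e p.start, differentialLinear_mul_inclusion h h1, ← inclusion_e p.finish,
    differentialLinear_inclusion_mul]

end Differential

/-! ### Extending an isomorphism to the Ginzburg algebras -/

section Extension

variable {V : Type u} {Q : QuiverOn.{u, v} V} {Q' : QuiverOn.{u, v'} V} {K : Type w} [CommRing K]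
  [Fintype V] [Fintype Q.Arrow] [Fintype Q'.Arrow]

theorem isTame_inclusion_map {φ : CPA Q K ≃ₐ[K] CPA Q' K} (hφ : Continuous φ) :
    IsTame fun a => inclusion Q' K (φ (CPA.arrow K a)) :=
  isTame_of_continuous (φ := (inclusion Q' K).comp (φ : CPA Q K →ₐ[K] CPA Q' K))
    (continuous_inclusion.comp hφ)

theorem isTame_inclusion_arrow : IsTame fun a => inclusion Q K (CPA.arrow K a) := by
  simp only [inclusion_arrow]
  exact isTame_gOrig

/-- The image of `a*` under the dg-homomorphism that extends the isomorphism `φ`: the sum over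
the arrows `b` of `Q'` of the cyclic derivatives of `φ⁻¹ b` with respect to `a`, with `b*`
inserted. -/
noncomputable def starImage (φ : CPA Q K ≃ₐ[K] CPA Q' K) (hφ : Continuous φ) (a : Q.Arrow) :
    CPA (ginzburgQuiver Q') K :=
  ∑ b, cyclicDeriv _ (isTame_inclusion_map hφ) a
    (gStar K b) (φ.symm (CPA.arrow K b))

/-- The images of the arrows under the dg-homomorphism that extends the isomorphism `φ` and scales
the loops by `c`. -/
noncomputable def extensionArrow (φ : CPA Q K ≃ₐ[K] CPA Q' K) (hφ : Continuous φ) (c : K) :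
    (ginzburgQuiver Q).Arrow → CPA (ginzburgQuiver Q') K
  | .orig a => inclusion Q' K (φ (CPA.arrow K a))
  | .star a => c • starImage φ hφ a
  | .loop i => c • gLoop Q' K i

variable (φ : CPA Q K ≃ₐ[K] CPA Q' K) (hφ : Continuous φ) (c : K)

theorem extensionArrow_mem_homogeneous (a : (ginzburgQuiver Q).Arrow) :
    extensionArrow φ hφ c a ∈ homogeneous Q' K (arrowDegree a) := by
  rcases a with a | a | i
  · exact inclusion_mem_homogeneous _
  · exact Submodule.smul_mem _ _ (Submodule.sum_mem _ fun b _ =>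
      cyclicDeriv_mem_homogeneous _ a (gStar_mem_homogeneous b) _)
  · exact Submodule.smul_mem _ _
      (ofPath_mem_homogeneous (Path.single (ginzburgQuiver Q') (GArrow.loop i)))

theorem isTame_extensionArrow : IsTame (extensionArrow φ hφ c) := by
  obtain ⟨I, hI, h⟩ := isTame_inclusion_map hφ
  refine ⟨I, hI, fun a => ?_⟩
  by_cases ha : arrowDegree a = 0
  · rcases a with a | a | i
    · exact h a
    · simp [arrowDegree] at ha
    · simp [arrowDegree] at ha
  · refine mem_filtration_one fun i => ?_
    rw [constCoeff_eq_zero ha (extensionArrow_mem_homogeneous φ hφ c a)]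
    exact zero_mem _

theorem isBetween_extensionArrow (he : ∀ i, φ (CPA.e Q K i) = CPA.e Q' K i)
    (a : (ginzburgQuiver Q).Arrow) :
    IsBetween ((ginzburgQuiver Q).src a) ((ginzburgQuiver Q).tgt a) (extensionArrow φ hφ c a) := by
  have h1 (a : Q.Arrow) : IsBetween (Q.src a) (Q.tgt a) (inclusion Q' K (φ (CPA.arrow K a))) :=
    ((IsBetween.arrow a).map φ he).map (inclusion Q' K) inclusion_e
  rcases a with a | a | i
  · exact h1 a
  · exact IsBetween.smul c (IsBetween.sum _ fun b _ => isBetween_cyclicDeriv _ h1 a _ _)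
  · exact IsBetween.smul c (IsBetween.arrow (Q := ginzburgQuiver Q') (GArrow.loop i))

variable (he : ∀ i, φ (CPA.e Q K i) = CPA.e Q' K i)

/-- The continuous homomorphism that extends the isomorphism `φ` and scales the loops by `c`. -/
noncomputable def extension : CPA (ginzburgQuiver Q) K →ₐ[K] CPA (ginzburgQuiver Q') K :=
  arrowHom (extensionArrow φ hφ c) (isTame_extensionArrow φ hφ c)
    (isBetween_extensionArrow φ hφ c he)

theorem continuous_extension : Continuous (extension φ hφ c he) := continuous_arrowHom _ _ _

theorem extension_e (i : V) :
    extension φ hφ c he (CPA.e (ginzburgQuiver Q) K i) = CPA.e (ginzburgQuiver Q') K i :=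
  arrowHom_e _ _ _ i

theorem extension_arrow (a : (ginzburgQuiver Q).Arrow) :
    extension φ hφ c he (CPA.arrow K a) = extensionArrow φ hφ c a :=
  arrowHom_arrow _ _ _ a

theorem extension_inclusion (f : CPA Q K) :
    extension φ hφ c he (inclusion Q K f) = inclusion Q' K (φ f) := by
  have := algHom_eq_of_arrow (φ := (extension φ hφ c he).comp (inclusion Q K))
    (ψ := (inclusion Q' K).comp (φ : CPA Q K →ₐ[K] CPA Q' K))
    ((continuous_extension φ hφ c he).comp continuous_inclusion)
    (continuous_inclusion.comp hφ) (fun i => ?_) (fun a => ?_)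
  · exact DFunLike.congr_fun this f
  · simp [inclusion_e, extension_e, he]
  · simp only [AlgHom.comp_apply, inclusion_arrow, extension_arrow]
    rfl

theorem extension_ofPath_mem_homogeneous (p : Path (ginzburgQuiver Q)) :
    extension φ hφ c he (CPA.ofPath K p) ∈ homogeneous Q' K (degree p) := by
  induction p using Path.cons_induction with
  | nil i =>
    have h1 : extension φ hφ c he (CPA.ofPath K (Path.nil _ i)) = CPA.e _ K i :=
      extension_e φ hφ c he i
    rw [h1]
    exact ofPath_mem_homogeneous (Path.nil _ i)
  | cons a p h ih =>
    rw [CPA.ofPath_cons, map_mul, extension_arrow]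
    have h1 : degree (Path.cons a p h) = arrowDegree a + degree p := by
      simp [degree, Path.cons]
    rw [h1]
    exact mul_mem_homogeneous (extensionArrow_mem_homogeneous φ hφ c a) ih

theorem exists_degree_eq {f : CPA (ginzburgQuiver Q) K} {q : Path (ginzburgQuiver Q')}
    (hq : extension φ hφ c he f q ≠ 0) : ∃ p, f p ≠ 0 ∧ degree q = degree p := by
  obtain ⟨p, hp, hpq⟩ := CPA.exists_of_map_apply_ne_zero
    (U := (extension φ hφ c he).toLinearMap) (continuous_extension φ hφ c he) hq
  exact ⟨p, hp, extension_ofPath_mem_homogeneous φ hφ c he p q hpq⟩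

theorem extension_mem_homogeneous {n : ℤ} {f : CPA (ginzburgQuiver Q) K}
    (hf : f ∈ homogeneous Q K n) : extension φ hφ c he f ∈ homogeneous Q' K n := by
  intro q hq
  obtain ⟨p, hp, hpq⟩ := exists_degree_eq φ hφ c he hq
  rw [hpq, hf p hp]

theorem extension_mem_ginzburgAlgebra {f : CPA (ginzburgQuiver Q) K}
    (hf : f ∈ ginzburgAlgebra Q K) : extension φ hφ c he f ∈ ginzburgAlgebra Q' K := by
  rw [mem_ginzburgAlgebra] at hf ⊢
  refine hf.subset ?_
  rintro _ ⟨q, hq, rfl⟩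
  obtain ⟨p, hp, hpq⟩ := exists_degree_eq φ hφ c he hq
  exact ⟨p, hp, hpq.symm⟩

/-- The images of the `a*` are chosen so that this relation holds, which says that the extension is
compatible with the differentials of the loops. -/
theorem extension_commutatorSum :
    extension φ hφ c he (commutatorSum Q K) = c • commutatorSum Q' K := by
  have hsymm (i : V) : φ.symm (CPA.e Q' K i) = CPA.e Q K i := by
    rw [← he, φ.symm_apply_apply]
  have hc : Continuous ((inclusion Q' K).comp (φ : CPA Q K →ₐ[K] CPA Q' K)) :=
    continuous_inclusion.comp hφ
  have h1 (b : Q'.Arrow) : ∑ a, (inclusion Q' K (φ (CPA.arrow K a)) *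
      cyclicDeriv _ (isTame_inclusion_map hφ) a (gStar K b) (φ.symm (CPA.arrow K b)) -
      cyclicDeriv _ (isTame_inclusion_map hφ) a (gStar K b) (φ.symm (CPA.arrow K b)) *
        inclusion Q' K (φ (CPA.arrow K a))) = gOrig K b * gStar K b - gStar K b * gOrig K b := by
    rw [← inclusion_arrow, ← φ.apply_symm_apply (CPA.arrow K b)]
    simp only [φ.symm_apply_apply]
    exact sum_commutator_cyclicDeriv hc (fun i => by simp [he, inclusion_e])
      (isTame_inclusion_map hφ) ((IsBetween.arrow (K := K) b).map φ.symm hsymm)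
      (IsBetween.arrow (Q := ginzburgQuiver Q') (K := K) (GArrow.star b))
  have h2 (a : Q.Arrow) : extension φ hφ c he (gStar K a) = c • starImage φ hφ a :=
    extension_arrow φ hφ c he (GArrow.star a)
  have h3 (a : Q.Arrow) : extension φ hφ c he (gOrig K a) =
      inclusion Q' K (φ (CPA.arrow K a)) :=
    extension_arrow φ hφ c he (GArrow.orig a)
  simp only [commutatorSum, map_sum, map_sub, map_mul, h2, h3]
  rw [← Finset.sum_congr rfl fun b _ => h1 b, Finset.sum_comm, Finset.smul_sum]
  refine Finset.sum_congr rfl fun a _ => ?_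
  rw [mul_smul_comm, smul_mul_assoc, ← smul_sub, starImage, Finset.mul_sum, Finset.sum_mul,
    Finset.sum_sub_distrib]

/-- The extensions of mutually inverse isomorphisms are mutually inverse: their composite fixes
the arrows of `Q`, the loops and `∑ [b, b*]`, hence also the arrows `b*`. -/
theorem extension_symm_extension {c' : K} (hcc : c' * c = 1) (hφ' : Continuous φ.symm)
    (he' : ∀ i, φ.symm (CPA.e Q' K i) = CPA.e Q K i) (f : CPA (ginzburgQuiver Q) K) :
    extension φ.symm hφ' c' he' (extension φ hφ c he f) = f := by
  set Θ := (extension φ.symm hφ' c' he').comp (extension φ hφ c he) with hΘ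
  have hc : Continuous Θ := (continuous_extension _ _ _ he').comp (continuous_extension _ _ _ he)
  have hΘe (i : V) : Θ (CPA.e (ginzburgQuiver Q) K i) = CPA.e (ginzburgQuiver Q) K i := by
    simp [hΘ, extension_e]
  have horig (a : Q.Arrow) : Θ (gOrig K a) = gOrig K a := by
    simp [hΘ, ← inclusion_arrow, extension_inclusion]
  have hsum : Θ (commutatorSum Q K) = commutatorSum Q K := by
    simp only [hΘ, AlgHom.comp_apply, extension_commutatorSum, map_smul, smul_smul]
    rw [mul_comm, hcc, one_smul]
  have hstar (a : Q.Arrow) : Θ (gStar K a) = gStar K a := by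
    have hh (a : Q.Arrow) : Θ (gStar K a) - gStar K a ∈ homogeneous Q K (-1) :=
      Submodule.sub_mem _ (extension_mem_homogeneous _ _ _ he'
        (extension_mem_homogeneous _ _ _ he (gStar_mem_homogeneous a))) (gStar_mem_homogeneous a)
    -- the differences `Θ a* - a*` solve the homogeneous equation `∑ [a, m a] = 0`
    refine sub_eq_zero.mp (eq_zero_of_sum_commutator_eq_zero
      (m := fun a => Θ (gStar K a) - gStar K a) (fun b => ?_) (fun b p hp => ?_) ?_ a)
    · have hb := IsBetween.arrow (Q := ginzburgQuiver Q) (K := K) (GArrow.star b)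
      exact (hb.map Θ hΘe).sub hb
    · rw [hh b p hp]
      decide
    · have h1 := sub_eq_zero.mpr hsum
      simp only [commutatorSum, map_sum, map_sub, map_mul, horig] at h1
      rw [← h1, ← Finset.sum_sub_distrib]
      refine Finset.sum_congr rfl fun b _ => ?_
      noncomm_ring
  have key := algHom_eq_of_arrow (φ := Θ) (ψ := AlgHom.id K _) hc continuous_id hΘe fun a => ?_
  · exact DFunLike.congr_fun key f
  · rcases a with a | a | i
    · exact horig a
    · exact hstar a
    · have h1 : extension φ hφ c he (gLoop Q K i) = c • gLoop Q' K i :=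
        extension_arrow φ hφ c he (GArrow.loop i)
      have h2 : extension φ.symm hφ' c' he' (gLoop Q' K i) = c' • gLoop Q K i :=
        extension_arrow φ.symm hφ' c' he' (GArrow.loop i)
      change extension φ.symm hφ' c' he' (extension φ hφ c he (gLoop Q K i)) = gLoop Q K i
      rw [h1, map_smul, h2, smul_smul, mul_comm, hcc, one_smul]

/-- If the inverse of `φ` is compatible with the hyperpotentials up to the scalar `c`, then the
extension of `φ` commutes with the differentials. -/
theorem differentialLinear_extension (h : Hyperpotential Q K) (h' : Hyperpotential Q' K)
    (H : ∀ a, c • ∑ b, hochschildComponent K a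
      (tmul (φ.symm (h'.ρ b)) (φ.symm (CPA.arrow K b))) = h.ρ a)
    (f : CPA (ginzburgQuiver Q) K) :
    differentialLinear h' (extension φ hφ c he f) =
      extension φ hφ c he (differentialLinear h f) := by
  have hc : Continuous ((inclusion Q' K).comp (φ : CPA Q K →ₐ[K] CPA Q' K)) :=
    continuous_inclusion.comp hφ
  have harrow (a : (ginzburgQuiver Q).Arrow) :
      differentialLinear h' (extension φ hφ c he (CPA.arrow K a)) =
      extension φ hφ c he (differentialLinear h (CPA.arrow K a)) := by
    rcases a with a | a | i
    · change differentialLinear h' (extension φ hφ c he (gOrig K a)) =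
        extension φ hφ c he (differentialLinear h (gOrig K a))
      rw [← inclusion_arrow, extension_inclusion, differentialLinear_inclusion,
        differentialLinear_inclusion, map_zero]
    · change differentialLinear h' (extension φ hφ c he (gStar K a)) =
        extension φ hφ c he (differentialLinear h (gStar K a))
      have h2 : extension φ hφ c he (gStar K a) = c • starImage φ hφ a :=
        extension_arrow φ hφ c he (GArrow.star a)
      rw [differentialLinear_gStar, extension_inclusion, h2, map_smul, starImage, map_sum, ← H a,
        map_smul, map_smul, map_sum, map_sum]
      congr 1
      refine Finset.sum_congr rfl fun b _ => ?_
      rw [differentialLinear_cyclicDeriv h'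
        (isTame_inclusion_map hφ) a (gStar_mem_homogeneous b),
        differentialLinear_gStar]
      have h3 : cyclicDeriv _ (isTame_inclusion_map hφ) a
          (inclusion Q' K (φ (φ.symm (h'.ρ b)))) (φ.symm (CPA.arrow K b)) =
          inclusion Q' K (φ (hochschildComponent K a
            (tmul (φ.symm (h'.ρ b)) (φ.symm (CPA.arrow K b))))) :=
        cyclicDeriv_map hc (fun i => by simp [he, inclusion_e]) (isTame_inclusion_map hφ) a _ _
      rwa [φ.apply_symm_apply] at h3
    · change differentialLinear h' (extension φ hφ c he (gLoop Q K i)) =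
        extension φ hφ c he (differentialLinear h (gLoop Q K i))
      have h1 : extension φ hφ c he (gLoop Q K i) = c • gLoop Q' K i :=
        extension_arrow φ hφ c he (GArrow.loop i)
      rw [h1, map_smul, differentialLinear_gLoop, differentialLinear_gLoop, map_mul, map_mul,
        extension_e, extension_commutatorSum, mul_smul_comm, smul_mul_assoc]
  refine CPA.eq_of_eq_on_ofPath
    (U := differentialLinear h' ∘ₗ (extension φ hφ c he).toLinearMap)
    (U' := (extension φ hφ c he).toLinearMap ∘ₗ differentialLinear h)
    ((continuous_differentialLinear h').comp (continuous_extension φ hφ c he))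
    ((continuous_extension φ hφ c he).comp (continuous_differentialLinear h)) f fun p hp => ?_
  clear hp
  change differentialLinear h' (extension φ hφ c he (CPA.ofPath K p)) =
    extension φ hφ c he (differentialLinear h (CPA.ofPath K p))
  induction p using Path.cons_induction with
  | nil i =>
    change differentialLinear h' (extension φ hφ c he (CPA.e _ K i)) =
      extension φ hφ c he (differentialLinear h (CPA.e _ K i))
    rw [← inclusion_e, extension_inclusion, differentialLinear_inclusion,
      differentialLinear_inclusion, map_zero]
  | cons a p hp ih =>
    have h1 : CPA.arrow K a ∈ homogeneous Q K (arrowDegree a) := by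
      have h2 := ofPath_mem_homogeneous (K := K) (Path.single (ginzburgQuiver Q) a)
      rwa [show degree (Path.single (ginzburgQuiver Q) a) = arrowDegree a by
        simp [degree, Path.single]] at h2
    rw [CPA.ofPath_cons, map_mul, differentialLinear_mul h h1,
      differentialLinear_mul h' (extension_mem_homogeneous φ hφ c he h1), harrow, ih, map_add,
      map_mul, map_smul, map_mul]

/-- The extension of an isomorphism of completed path algebras to the Ginzburg algebras. -/
theorem exists_dgIso_of_components (h : Hyperpotential Q K) (h' : Hyperpotential Q' K) (c : Kˣ)
    (hφ : Continuous φ) (he : ∀ i, φ (CPA.e Q K i) = CPA.e Q' K i)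
    (H : ∀ b, ∑ a, hochschildComponent K b (tmul (φ (h.ρ a)) (φ (CPA.arrow K a))) =
      (c : K) • h'.ρ b) :
    ∃ Φ : ginzburgAlgebra Q K ≃ₐ[K] ginzburgAlgebra Q' K, IsContinuousDGIso h h' Φ ∧
      ∀ i : V, Φ (ginzburgE Q K i) = ginzburgE Q' K i ∧
        Φ (ginzburgT Q K i) = (c : K) • ginzburgT Q' K i := by
  have hφ' := continuous_symm φ hφ he
  have he' (i : V) : φ.symm (CPA.e Q' K i) = CPA.e Q K i := by
    rw [← he, φ.symm_apply_apply]
  have hl := extension_symm_extension φ hφ (c : K) he (c' := ((c⁻¹ : Kˣ) : K)) (by simp) hφ' he'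
  have hr := extension_symm_extension φ.symm hφ' ((c⁻¹ : Kˣ) : K) he' (c' := (c : K)) (by simp)
    hφ he
  have hd' := differentialLinear_extension φ.symm hφ' ((c⁻¹ : Kˣ) : K) he' h' h fun b => by
    change ((c⁻¹ : Kˣ) : K) • ∑ a, hochschildComponent K b
      (tmul (φ (h.ρ a)) (φ (CPA.arrow K a))) = _
    rw [H b, smul_smul, Units.inv_mul, one_smul]
  have hd (f : CPA (ginzburgQuiver Q) K) :
      extension φ hφ (c : K) he (differentialLinear h f) =
        differentialLinear h' (extension φ hφ (c : K) he f) := by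
    have h1 := hd' (extension φ hφ (c : K) he f)
    rw [hl] at h1
    rw [h1]
    exact hr _
  let Φ₁ : ginzburgAlgebra Q K →ₐ[K] ginzburgAlgebra Q' K :=
    ((extension φ hφ (c : K) he).comp (ginzburgAlgebra Q K).val).codRestrict _
      fun x => extension_mem_ginzburgAlgebra _ _ _ he x.2
  let Φ₂ : ginzburgAlgebra Q' K →ₐ[K] ginzburgAlgebra Q K :=
    ((extension φ.symm hφ' ((c⁻¹ : Kˣ) : K) he').comp (ginzburgAlgebra Q' K).val).codRestrict _
      fun x => extension_mem_ginzburgAlgebra _ _ _ he' x.2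
  refine ⟨AlgEquiv.ofAlgHom Φ₁ Φ₂ (AlgHom.ext fun x => Subtype.ext (hr x.1))
    (AlgHom.ext fun x => Subtype.ext (hl x.1)), ⟨?_, ?_, ?_⟩, fun i => ⟨?_, ?_⟩⟩
  · exact ((continuous_extension φ hφ (c : K) he).comp continuous_subtype_val).subtype_mk _
  · intro n x hx
    exact extension_mem_homogeneous φ hφ (c : K) he hx
  · intro x
    exact Subtype.ext (hd x.1)
  · exact Subtype.ext (extension_e φ hφ (c : K) he i)
  · exact Subtype.ext (extension_arrow φ hφ (c : K) he (GArrow.loop i))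

end Extension

/-! ### Restricting a dg-isomorphism to degree zero -/

section DegreeZero

variable {V : Type u} {Q : QuiverOn.{u, v} V} {Q' : QuiverOn.{u, v'} V} {K : Type w} [CommRing K]
  [Fintype V] [Fintype Q.Arrow] [Fintype Q'.Arrow]

variable (Q K) in
/-- The inclusion of the completed path algebra into the Ginzburg dg-algebra. -/
noncomputable def ginzburgInclusion : CPA Q K →ₐ[K] ginzburgAlgebra Q K :=
  (inclusion Q K).codRestrict _ fun f =>
    mem_ginzburgAlgebra_of_mem_homogeneous (inclusion_mem_homogeneous f)

theorem inclusion_restriction_map {F : ginzburgAlgebra Q K →ₐ[K] ginzburgAlgebra Q' K}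
    (hF : ∀ x ∈ gradedPiece Q K 0, F x ∈ gradedPiece Q' K 0) (f : CPA Q K) :
    inclusion Q' K (restriction Q' K (F (ginzburgInclusion Q K f)).1) =
      (F (ginzburgInclusion Q K f)).1 :=
  inclusion_restriction (hF _ (inclusion_mem_homogeneous f))

/-- The homomorphism of completed path algebras that a homomorphism of Ginzburg algebras induces
in degree zero. -/
noncomputable def degreeZeroHom (F : ginzburgAlgebra Q K →ₐ[K] ginzburgAlgebra Q' K)
    (hF : ∀ x ∈ gradedPiece Q K 0, F x ∈ gradedPiece Q' K 0) : CPA Q K →ₐ[K] CPA Q' K :=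
  AlgHom.ofLinearMap (restriction Q' K ∘ₗ (ginzburgAlgebra Q' K).val.toLinearMap ∘ₗ
      F.toLinearMap ∘ₗ (ginzburgInclusion Q K).toLinearMap)
    (inclusion_injective <| by
      change inclusion Q' K (restriction Q' K (F (ginzburgInclusion Q K 1)).1) = _
      rw [inclusion_restriction_map hF, map_one, map_one, map_one]
      rfl)
    (fun f g => inclusion_injective <| by
      change inclusion Q' K (restriction Q' K (F (ginzburgInclusion Q K (f * g))).1) =
        inclusion Q' K (restriction Q' K (F (ginzburgInclusion Q K f)).1 *
          restriction Q' K (F (ginzburgInclusion Q K g)).1)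
      rw [map_mul (inclusion Q' K), inclusion_restriction_map hF, inclusion_restriction_map hF,
        inclusion_restriction_map hF, map_mul, map_mul]
      rfl)

theorem inclusion_degreeZeroHom (F : ginzburgAlgebra Q K →ₐ[K] ginzburgAlgebra Q' K)
    (hF : ∀ x ∈ gradedPiece Q K 0, F x ∈ gradedPiece Q' K 0) (f : CPA Q K) :
    inclusion Q' K (degreeZeroHom F hF f) = (F (ginzburgInclusion Q K f)).1 :=
  inclusion_restriction_map hF f

theorem ginzburgInclusion_degreeZeroHom (F : ginzburgAlgebra Q K →ₐ[K] ginzburgAlgebra Q' K)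
    (hF : ∀ x ∈ gradedPiece Q K 0, F x ∈ gradedPiece Q' K 0) (f : CPA Q K) :
    ginzburgInclusion Q' K (degreeZeroHom F hF f) = F (ginzburgInclusion Q K f) :=
  Subtype.ext (inclusion_degreeZeroHom F hF f)

/-- A dg-isomorphism that scales the loops restricts in degree zero to an isomorphism of completed
path algebras that is compatible with the hyperpotentials up to a scalar. -/
theorem exists_algEquiv_of_dgIso (h : Hyperpotential Q K) (h' : Hyperpotential Q' K) (c : K)
    (Φ : ginzburgAlgebra Q K ≃ₐ[K] ginzburgAlgebra Q' K) (hΦ : IsContinuousDGIso h h' Φ)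
    (hE : ∀ i : V, Φ (ginzburgE Q K i) = ginzburgE Q' K i)
    (hT : ∀ i : V, Φ (ginzburgT Q K i) = c • ginzburgT Q' K i) :
    ∃ φ : CPA Q K ≃ₐ[K] CPA Q' K, Continuous φ ∧ (∀ i, φ (CPA.e Q K i) = CPA.e Q' K i) ∧
      ∀ b, ∑ a, hochschildComponent K b (tmul (φ (h.ρ a)) (φ (CPA.arrow K a))) =
        c • h'.ρ b := by
  obtain ⟨hcont, hdeg, hdiff⟩ := hΦ
  have h0 : ∀ x ∈ gradedPiece Q K 0, (Φ : ginzburgAlgebra Q K →ₐ[K] ginzburgAlgebra Q' K) x ∈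
      gradedPiece Q' K 0 := hdeg 0
  have h0' : ∀ y ∈ gradedPiece Q' K 0,
      (Φ.symm : ginzburgAlgebra Q' K →ₐ[K] ginzburgAlgebra Q K) y ∈ gradedPiece Q K 0 :=
    fun y hy => symm_mem_gradedPiece_zero hdeg hy
  let φ : CPA Q K ≃ₐ[K] CPA Q' K := AlgEquiv.ofAlgHom (degreeZeroHom _ h0) (degreeZeroHom _ h0')
    (AlgHom.ext fun f => inclusion_injective <| by
      change inclusion Q' K (degreeZeroHom _ h0 (degreeZeroHom _ h0' f)) = inclusion Q' K f
      rw [inclusion_degreeZeroHom, ginzburgInclusion_degreeZeroHom]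
      exact congrArg Subtype.val (Φ.apply_symm_apply (ginzburgInclusion Q' K f)))
    (AlgHom.ext fun f => inclusion_injective <| by
      change inclusion Q K (degreeZeroHom _ h0' (degreeZeroHom _ h0 f)) = inclusion Q K f
      rw [inclusion_degreeZeroHom, ginzburgInclusion_degreeZeroHom]
      exact congrArg Subtype.val (Φ.symm_apply_apply (ginzburgInclusion Q K f)))
  have hφι (f : CPA Q K) : inclusion Q' K (φ f) = (Φ (ginzburgInclusion Q K f)).1 :=
    inclusion_degreeZeroHom _ h0 f
  have hφ : Continuous φ := by
    have h1 : Continuous fun f : CPA Q K => ginzburgInclusion Q K f :=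
      continuous_inclusion.subtype_mk _
    exact continuous_restriction.comp (continuous_subtype_val.comp (hcont.comp h1))
  have he (i : V) : φ (CPA.e Q K i) = CPA.e Q' K i := by
    refine inclusion_injective ?_
    have h1 : ginzburgInclusion Q K (CPA.e Q K i) = ginzburgE Q K i :=
      Subtype.ext (inclusion_e i)
    rw [hφι, h1, hE, inclusion_e]
    rfl
  refine ⟨φ, hφ, he, ?_⟩
  let star (a : Q.Arrow) : ginzburgAlgebra Q K :=
    ⟨gStar K a, mem_ginzburgAlgebra_of_mem_homogeneous (gStar_mem_homogeneous a)⟩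
  let η (a : Q.Arrow) : CPA (ginzburgQuiver Q') K := (Φ (star a)).1
  have hη (a : Q.Arrow) : IsBetween (Q.tgt a) (Q.src a) (η a) := by
    have h1 : ginzburgE Q K (Q.tgt a) * star a * ginzburgE Q K (Q.src a) = star a :=
      Subtype.ext (IsBetween.arrow (Q := ginzburgQuiver Q) (K := K) (GArrow.star a))
    have h2 := congrArg Φ h1
    rw [map_mul, map_mul, hE, hE] at h2
    exact congrArg Subtype.val h2
  have hηd (a : Q.Arrow) : η a ∈ homogeneous Q' K (-1) :=
    hdeg (-1) (star a) (gStar_mem_homogeneous a)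
  have hdη (a : Q.Arrow) : differentialLinear h' (η a) = inclusion Q' K (φ (h.ρ a)) := by
    have h1 := hdiff (star a)
    have h2 : differential h (star a) = ginzburgInclusion Q K (h.ρ a) :=
      Subtype.ext (differentialLinear_gStar h a)
    rw [h2] at h1
    rw [hφι, h1]
    rfl
  let ω : ginzburgAlgebra Q K := ∑ a, (ginzburgInclusion Q K (CPA.arrow K a) * star a -
    star a * ginzburgInclusion Q K (CPA.arrow K a))
  have hω : ω.1 = commutatorSum Q K := by
    change (ginzburgAlgebra Q K).val ω = _
    simp only [ω, map_sum, map_sub, map_mul, commutatorSum, ← inclusion_arrow]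
    rfl
  have hΦω : (Φ ω).1 = c • commutatorSum Q' K := by
    have h1 (i : V) : differential h (ginzburgT Q K i) =
        ginzburgE Q K i * ω * ginzburgE Q K i := by
      refine Subtype.ext ((differentialLinear_gLoop h i).trans ?_)
      rw [← hω]
      rfl
    have h2 (i : V) : (ginzburgE Q' K i * Φ ω * ginzburgE Q' K i).1 =
        c • (CPA.e (ginzburgQuiver Q') K i * commutatorSum Q' K *
          CPA.e (ginzburgQuiver Q') K i) := by
      have h3 := hdiff (ginzburgT Q K i)
      rw [h1, map_mul, map_mul, hE, hT, map_smul] at h3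
      rw [h3, ← differentialLinear_gLoop h' i]
      rfl
    have h3 : ∑ i, ginzburgE Q K i * ω * ginzburgE Q K i = ω := by
      refine Subtype.ext ?_
      change (ginzburgAlgebra Q K).val (∑ i, ginzburgE Q K i * ω * ginzburgE Q K i) = ω.1
      rw [map_sum, hω, ← sum_e_mul_commutatorSum_mul_e, ← hω]
      rfl
    have h4 := congrArg Φ h3
    simp only [map_sum, map_mul, hE] at h4
    rw [← h4]
    change (ginzburgAlgebra Q' K).val (∑ i, ginzburgE Q' K i * Φ ω * ginzburgE Q' K i) = _
    rw [map_sum, ← sum_e_mul_commutatorSum_mul_e, Finset.smul_sum]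
    exact Finset.sum_congr rfl fun i _ => h2 i
  -- the images of the arrows satisfy the same relation as the arrows, up to the scalar
  have hsum : ∑ a, (inclusion Q' K (φ (CPA.arrow K a)) * η a -
      η a * inclusion Q' K (φ (CPA.arrow K a))) = c • commutatorSum Q' K := by
    rw [← hΦω]
    change _ = (ginzburgAlgebra Q' K).val (Φ ω)
    simp only [ω, map_sum, map_sub, map_mul, hφι]
    rfl
  have hexp (a : Q.Arrow) := sum_commutator_cyclicDeriv (continuous_inclusion (Q := Q') (K := K))
    inclusion_e isTame_inclusion_arrow
    ((IsBetween.arrow (K := K) a).map φ he) (hη a)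
  -- expanding these commutators in the arrows of `Q'` and comparing with `∑ [b, b*]`
  have hD (b : Q'.Arrow) : ∑ a, cyclicDeriv _
      isTame_inclusion_arrow b (η a)
      (φ (CPA.arrow K a)) = c • gStar K b := by
    refine sub_eq_zero.mp (eq_zero_of_sum_commutator_eq_zero (m := fun b => ∑ a, cyclicDeriv _
      isTame_inclusion_arrow b (η a)
      (φ (CPA.arrow K a)) - c • gStar K b) (fun b => ?_) (fun b p hp => ?_) ?_ b)
    · refine IsBetween.sub (IsBetween.sum _ fun a _ => isBetween_cyclicDeriv _ (fun a =>
        (IsBetween.arrow a).map (inclusion Q' K) inclusion_e) b _ _) (IsBetween.smul c ?_)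
      exact IsBetween.arrow (Q := ginzburgQuiver Q') (GArrow.star b)
    · have h1 := Submodule.sub_mem (homogeneous Q' K (-1)) (Submodule.sum_mem _
        fun a (_ : a ∈ Finset.univ) => cyclicDeriv_mem_homogeneous isTame_inclusion_arrow b (hηd a)
          (φ (CPA.arrow K a))) (Submodule.smul_mem _ c (gStar_mem_homogeneous b))
      rw [h1 p hp]
      decide
    · rw [← Finset.sum_congr rfl fun a _ => hexp a, Finset.sum_comm, ← sub_eq_zero, commutatorSum,
        Finset.smul_sum, ← Finset.sum_sub_distrib] at hsum
      rw [← hsum]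
      refine Finset.sum_congr rfl fun b _ => ?_
      rw [inclusion_arrow, Finset.sum_sub_distrib, ← Finset.mul_sum, ← Finset.sum_mul, mul_sub,
        sub_mul, mul_smul_comm, smul_mul_assoc, smul_sub]
      abel
  -- the differential turns these equations into the desired relation between the components
  intro b
  refine inclusion_injective ?_
  have h1 := congrArg (differentialLinear h') (hD b)
  rw [map_sum, map_smul, differentialLinear_gStar] at h1
  rw [map_smul, ← h1, map_sum]
  refine Finset.sum_congr rfl fun a _ => ?_
  rw [differentialLinear_cyclicDeriv h' (y := fun b => CPA.arrow K b) _ b (hηd a), hdη]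
  exact (cyclicDeriv_map continuous_inclusion inclusion_e _ b _ _).symm

end DegreeZero

/-! ### Right equivalence and isomorphisms of Ginzburg algebras -/

section Equivalence

variable {V : Type u} {Q : QuiverOn.{u, v} V} {Q' : QuiverOn.{u, v'} V} {K : Type w} [CommRing K]
  [Fintype V] [Fintype Q.Arrow] [Fintype Q'.Arrow]

/-- Scaling the first hyperpotential by `c⁻¹` corresponds to scaling the loops by `c`. -/
theorem rightEquivalent_smul_iff (h : Hyperpotential Q K) (h' : Hyperpotential Q' K) (c : Kˣ) :
    RightEquivalent (h.smul ((c⁻¹ : Kˣ) : K)) h' ↔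
      ∃ Φ : ginzburgAlgebra Q K ≃ₐ[K] ginzburgAlgebra Q' K, IsContinuousDGIso h h' Φ ∧
        ∀ i : V, Φ (ginzburgE Q K i) = ginzburgE Q' K i ∧
          Φ (ginzburgT Q K i) = (c : K) • ginzburgT Q' K i := by
  have key (φ : CPA Q K ≃ₐ[K] CPA Q' K) (he : ∀ i, φ (CPA.e Q K i) = CPA.e Q' K i) :
      MapsHyperpotential (φ : CPA Q K →ₐ[K] CPA Q' K) (h.smul ((c⁻¹ : Kˣ) : K)) h' ↔
      ∀ b, ∑ a, hochschildComponent K b (tmul (φ (h.ρ a)) (φ (CPA.arrow K a))) =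
        (c : K) • h'.ρ b := by
    rw [mapsHyperpotential_iff (φ := (φ : CPA Q K →ₐ[K] CPA Q' K)) he]
    refine forall_congr' fun b => ?_
    have h1 : ∑ a, hochschildComponent K b (tmul ((φ : CPA Q K →ₐ[K] CPA Q' K)
        ((h.smul ((c⁻¹ : Kˣ) : K)).ρ a)) ((φ : CPA Q K →ₐ[K] CPA Q' K) (CPA.arrow K a))) =
        ((c⁻¹ : Kˣ) : K) •
          ∑ a, hochschildComponent K b (tmul (φ (h.ρ a)) (φ (CPA.arrow K a))) := by
      rw [Finset.smul_sum]
      refine Finset.sum_congr rfl fun a _ => ?_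
      simp [Hyperpotential.smul, ← tmulBilin_apply]
    rw [h1]
    constructor
    · intro h2
      rw [← h2, smul_smul, Units.mul_inv, one_smul]
    · intro h2
      rw [h2, smul_smul, Units.inv_mul, one_smul]
  constructor
  · rintro ⟨φ, hφ, he, hm⟩
    exact exists_dgIso_of_components φ h h' c hφ he ((key φ he).mp hm)
  · rintro ⟨Φ, hΦ, hi⟩
    obtain ⟨φ, hφ, he, hm⟩ := exists_algEquiv_of_dgIso h h' (c : K) Φ hΦ (fun i => (hi i).1)
      fun i => (hi i).2
    exact ⟨φ, hφ, he, (key φ he).mpr hm⟩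

end Equivalence

end Hyperpot

theorem proposition2 {K : Type*} [CommRing K] {V : Type*} [Fintype V]
    (Q : Hyperpot.QuiverOn V) (Q' : Hyperpot.QuiverOn V) [Fintype Q.Arrow] [Fintype Q'.Arrow]
    (h : Hyperpot.Hyperpotential Q K) (h' : Hyperpot.Hyperpotential Q' K) :
    (Hyperpot.RightEquivalent h h' ↔
      ∃ Φ : Hyperpot.ginzburgAlgebra Q K ≃ₐ[K] Hyperpot.ginzburgAlgebra Q' K,
        Hyperpot.IsContinuousDGIso h h' Φ ∧
        ∀ i : V, Φ (Hyperpot.ginzburgE Q K i) = Hyperpot.ginzburgE Q' K i ∧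
          Φ (Hyperpot.ginzburgT Q K i) = Hyperpot.ginzburgT Q' K i) ∧
    (Hyperpot.WeaklyRightEquivalent h h' ↔
      ∃ (Φ : Hyperpot.ginzburgAlgebra Q K ≃ₐ[K] Hyperpot.ginzburgAlgebra Q' K) (c : Kˣ),
        Hyperpot.IsContinuousDGIso h h' Φ ∧
        ∀ i : V, Φ (Hyperpot.ginzburgE Q K i) = Hyperpot.ginzburgE Q' K i ∧
          Φ (Hyperpot.ginzburgT Q K i) = (c : K) • Hyperpot.ginzburgT Q' K i) := by
  constructor
  · have h1 := Hyperpot.rightEquivalent_smul_iff h h' 1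
    have h2 : h.smul (((1 : Kˣ)⁻¹ : Kˣ) : K) = h := by
      simp [Hyperpot.Hyperpotential.smul]
    rw [h2] at h1
    simpa using h1
  · constructor
    · rintro ⟨c, hc⟩
      obtain ⟨Φ, hΦ⟩ := (Hyperpot.rightEquivalent_smul_iff h h' c⁻¹).mp (by rwa [inv_inv])
      exact ⟨Φ, c⁻¹, hΦ⟩
    · rintro ⟨Φ, c, hΦ⟩
      exact ⟨c⁻¹, (Hyperpot.rightEquivalent_smul_iff h h' c).mpr ⟨Φ, hΦ⟩⟩
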